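/- Let $(y_i,x_i)_{i\ge 1}$ be i.i.d. copies of $(Y,X)$, with $Y$ real and $X=(X_1,X_2')'\in\mathbb R^d$, $d\ge1$; let $\mathcal X$ be the support of $X$ and let $\tau\in(0,1)$, $\epsilon\in(0,\tfrac12)$, $r\ge2$ an integer. Let $f_Y$ be the density of $Y$, $f_{Y|X}$ the conditional density, and $f_X$ a density of $X$ with respect to a $\sigma$-finite reference measure (so that $X$ may contain a constant), $f_{Y,X}=f_{Y|X}f_X$. Let $Q_Y[\tau]$ and $Q_Y[\eta|X=x]$ be the unconditional and conditional quantiles, and let $\xi_\tau(x)$ be the $\eta\in(0,1)$ with $Q_Y[\eta|X=x]=Q_Y[\tau]$. *Estimators.* With $\rho_\eta(u)=u(\eta-1[u<0])$, let $\hat\beta(\eta)\in\arg\min_b \frac1n\sum_{i\le n}\rho_\eta(y_i-x_i'b)$ for $\eta\in[\epsilon,1-\epsilon]$ and $\hat Q\in\arg\min_q\frac1n\sum_{i\le n}\rho_\tau(y_i-q)$ (measurable selections). On a grid $\epsilon=\eta_1<\dots<\eta_m=1-\epsilon$ (depending on $n$) let $\hat\xi_\tau(x)$ be $\epsilon$ if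 $\hat Q<x'\hat\beta(\eta_1)$; $\eta_j$ if $x'\hat\beta(\eta_j)\le\hat Q<x'\hat\beta(\eta_{j+1})$; and $\eta_m$ if $x'\hat\beta(\eta_m)\le\hat Q$ (any measurable choice if several apply). For a kernel $K$ and bandwidth $h=h_n>0$, $K_h(u)=h^{-1}K(u/h)$, put $$\widehat{UQPE}_{X_1}(\tau)=\frac{\sum_{i=1}^nK_h(y_i-\hat Q)\,\hat\beta_1(\hat\xi_\tau(x_i))}{\sum_{i=1}^nK_h(y_i-\hat Q)},\qquad UQPE_{X_1}(\tau)=E[\beta_1(\xi_\tau(X))\mid Y=Q_Y[\tau]].$$ *Assumptions.* 1. (a) $Q_Y[\eta|X=x]=x'\beta(\eta)$ for $x\in\mathcal X$, $\eta\in[\epsilon,1-\epsilon]$, and $E\|X\|^2<\infty$; (b) for every $x\in\mathcal X$, $f_{Y|X}(\cdot|x)$ is bounded away from zero on $[x'\beta(\epsilon),x'\beta(1-\epsilon)]$, and $\xi_\tau(x)$ exists and lies in $[\epsilon,1-\epsilon]$; (c) $J(\eta)=E[f_{Y|X}(X'\beta(\eta)|X)XX']$ is invertible and differentiable with bounded derivative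 on $[\epsilon,1-\epsilon]$, and $\hat\beta(\eta)-\beta(\eta)=J(\eta)^{-1}\frac1n\sum_{i\le n}(\eta-1\{y_i\le x_i'\beta(\eta)\})x_i+o_p(n^{-1/2})$ uniformly in $\eta\in[\epsilon,1-\epsilon]$; (d) $\hat Q-Q_Y[\tau]=f_Y(Q_Y[\tau])^{-1}\frac1n\sum_{i\le n}(\tau-1\{y_i\le Q_Y[\tau]\})+o_p(n^{-1/2})$; (e) $\max_j(\eta_{j+1}-\eta_j)=o(n^{-1/2})$. 2. $K$ is symmetric and twice differentiable; $K$ and $|u|^rK$ are integrable, $\int K=1$, $\int u^jK(u)\,du=0$ for $1\le j\le r-1$; $K'$ is integrable with $\int K'=0$; $u^jK(u)\to0$ as $u\to\pm\infty$ for $1\le j\le r+1$; $K'$, $K''$ are bounded; $(K')^2$ and $u(K')^2$ are integrable. 3. $h\propto n^{-a}$ (that is, $hn^{a}\to c$ for some $c>0$) with $1/(1+2r)<a<1/2$. 4. $f_Y$ and, for every $x\in\mathcal X$, $y\mapsto f_{Y,X}(y,x)$ are $r+1$ times continuously differentiable with bounded derivatives. 5. Uniformly over $x\in\mathcal X$,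 $\hat\xi_\tau(x)-\xi_\tau(x)=f_{Y|X}(x'\beta(\xi_\tau(x))|x)\bigl[-x'(\hat\beta(\xi_\tau(x))-\beta(\xi_\tau(x)))+\hat Q-Q_Y[\tau]\bigr]+o_p(n^{-1/2})$; $\beta_1$ is differentiable on $[\epsilon,1-\epsilon]$ with bounded derivative, and $f_{Y|X}$ is bounded on $\mathbb R\times\mathcal X$. 6. For $U_\tau=\beta_1(\xi_\tau(X))-E[\beta_1(\xi_\tau(X))|Y]$ and some $\gamma>0$: $E[|U_\tau|^{2+\gamma}|Y]<C$ a.s. for a constant $C$; $\int|K|^{2+\gamma}<\infty$; $y\mapsto E[\beta_1(\xi_\tau(X))|Y=y]$ is $r+1$ times continuously differentiable with bounded derivatives; $y\mapsto\sigma_\tau^2(y)=E[U_\tau^2|Y=y]$ is continuous. Then, as $n\to\infty$, $$\sqrt{nh}\,\bigl(\widehat{UQPE}_{X_1}(\tau)-UQPE_{X_1}(\tau)\bigr)\overset{d}{\to}N\Bigl(0,\ \sigma_\tau^2(Q_Y[\tau])\,f_Y(Q_Y[\tau])^{-1}\int K(u)^2\,du\Bigr).$$ -/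

import Mathlib

open MeasureTheory ProbabilityTheory Filter Topology
open scoped Matrix

noncomputable section

namespace UQPE

/-- The `τ`-quantile `inf {y | P (-∞, y] ≥ τ}` of a law `P` on the line. -/
def quantile (P : Measure ℝ) (τ : ℝ) : ℝ :=
  sInf {y : ℝ | τ ≤ P.real (Set.Iic y)}

/-- The law on the line with density `f (· | x)`. -/
def condLaw {d : ℕ} (f : ℝ → (Fin (d + 1) → ℝ) → ℝ) (x : Fin (d + 1) → ℝ) : Measure ℝ :=
  volume.withDensity fun y => ENNReal.ofReal (f y x)

/-- The check function `ρ_η(u) = u (η - 1[u < 0])`. -/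
def checkLoss (η u : ℝ) : ℝ := u * (η - if u < 0 then 1 else 0)

/-- `R n a = o_p(1)` uniformly over `a ∈ S`, for real random functions `R n`. -/
def UnifLittleOp {Ω α : Type*} [MeasurableSpace Ω] (μ : Measure Ω) (S : Set α)
    (R : ℕ → Ω → α → ℝ) : Prop :=
  ∀ δ : ℝ, 0 < δ → Tendsto (fun n => μ {ω | ∃ a ∈ S, δ ≤ |R n ω a|}) atTop (𝓝 0)

/-- `g` is a version of the regression function `y ↦ E[V | Y = y]`. -/
def IsRegression {Ω : Type*} [MeasurableSpace Ω] (μ : Measure Ω) (V Y : Ω → ℝ) (g : ℝ → ℝ) :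
    Prop :=
  Measurable g ∧
    (fun ω => g (Y ω)) =ᵐ[μ] μ[V | MeasurableSpace.comap Y inferInstance]

/-- `f` is `k` times continuously differentiable, and its derivatives of orders `1, …, k` are
bounded on the whole line. -/
def SmoothBddDeriv (k : ℕ) (f : ℝ → ℝ) : Prop :=
  ContDiff ℝ k f ∧ ∀ j : ℕ, 1 ≤ j → j ≤ k → ∃ C : ℝ, ∀ y, |iteratedDeriv j f y| ≤ C

/-- The observations `(y_i, x_i)` are independent and identically distributed. -/
structure IsIIDSample {Ω : Type*} [MeasurableSpace Ω] (μ : Measure Ω) {d : ℕ}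
    (X : ℕ → Ω → Fin (d + 1) → ℝ) (Y : ℕ → Ω → ℝ) : Prop where
  measurable_X : ∀ i, Measurable (X i)
  measurable_Y : ∀ i, Measurable (Y i)
  indep : iIndepFun (fun i ω => (X i ω, Y i ω)) μ
  ident : ∀ i, IdentDistrib (fun ω => (X i ω, Y i ω)) (fun ω => (X 0 ω, Y 0 ω)) μ μ

/-- `fYX`, `fX`, `fY` are versions of the conditional density of `Y` given `X`, of the density of
`X` with respect to a reference measure `ν`, and of the (Lebesgue) density of `Y`. The measure `ν`
need not be Lebesgue measure, so that a component of `X` may be constant or discrete; the joint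
density of `(Y, X)` with respect to `volume × ν` is `(y, x) ↦ fYX y x * fX x`. -/
structure AreDensities {Ω : Type*} [MeasurableSpace Ω] (μ : Measure Ω) {d : ℕ}
    (X : Ω → Fin (d + 1) → ℝ) (Y : Ω → ℝ) (ν : Measure (Fin (d + 1) → ℝ))
    (fYX : ℝ → (Fin (d + 1) → ℝ) → ℝ) (fX : (Fin (d + 1) → ℝ) → ℝ) (fY : ℝ → ℝ) : Prop where
  measurable_fYX : Measurable (Function.uncurry fYX)
  fYX_nonneg : ∀ y x, 0 ≤ fYX y x
  fYX_prob : ∀ x ∈ (μ.map X).support, IsProbabilityMeasure (condLaw fYX x)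
  joint : μ.map (fun ω => (Y ω, X ω)) =
    (volume.prod (μ.map X)).withDensity fun p => ENNReal.ofReal (fYX p.1 p.2)
  measurable_fX : Measurable fX
  fX_nonneg : ∀ x, 0 ≤ fX x
  law_X : μ.map X = ν.withDensity fun x => ENNReal.ofReal (fX x)
  measurable_fY : Measurable fY
  fY_nonneg : ∀ y, 0 ≤ fY y
  law_Y : μ.map Y = volume.withDensity fun y => ENNReal.ofReal (fY y)

/-- The matching set: all `η ∈ (0, 1)` with `Q_Y[η | X = x] = q`. -/
def matchingSet {d : ℕ} (fYX : ℝ → (Fin (d + 1) → ℝ) → ℝ) (q : ℝ) (x : Fin (d + 1) → ℝ) :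
    Set ℝ :=
  {η | η ∈ Set.Ioo (0 : ℝ) 1 ∧ quantile (condLaw fYX x) η = q}

/-- The matching function: the element of the matching set when that set is a singleton. -/
def matching {d : ℕ} (fYX : ℝ → (Fin (d + 1) → ℝ) → ℝ) (q : ℝ) (x : Fin (d + 1) → ℝ) : ℝ :=
  sInf (matchingSet fYX q x)

/-- The matrix `J(η) = E[f_{Y|X}(X'β(η) | X) X X']`. -/
def qrMatrix {Ω : Type*} [MeasurableSpace Ω] (μ : Measure Ω) {d : ℕ}
    (X : Ω → Fin (d + 1) → ℝ) (fYX : ℝ → (Fin (d + 1) → ℝ) → ℝ)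
    (β : ℝ → Fin (d + 1) → ℝ) (η : ℝ) : Matrix (Fin (d + 1)) (Fin (d + 1)) ℝ :=
  Matrix.of fun j k => ∫ ω, fYX (X ω ⬝ᵥ β η) (X ω) * X ω j * X ω k ∂μ

/-- The sample average `n⁻¹ ∑ (η - 1{y_i ≤ x_i'β(η)}) x_i`. -/
def qrScore {Ω : Type*} {d : ℕ} (X : ℕ → Ω → Fin (d + 1) → ℝ) (Y : ℕ → Ω → ℝ)
    (β : ℝ → Fin (d + 1) → ℝ) (n : ℕ) (ω : Ω) (η : ℝ) : Fin (d + 1) → ℝ :=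
  (n : ℝ)⁻¹ • ∑ i ∈ Finset.range n,
    (η - if Y i ω ≤ X i ω ⬝ᵥ β η then 1 else 0) • X i ω

/-- A grid `ε = η_0 < η_1 < … < η_m = 1 - ε`. -/
structure IsGrid (ε : ℝ) {m : ℕ} (grid : Fin (m + 1) → ℝ) : Prop where
  strictMono : StrictMono grid
  first : grid 0 = ε
  last : grid (Fin.last m) = 1 - ε

/-- `e` is a value of the estimated matching function at `x`, computed on `grid` from quantile
regression coefficients `b` and an unconditional quantile `q`. If the fitted quantiles
`η_j ↦ x' b(η_j)` cross, there may be several such values. -/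
def IsEstimatedMatch {d m : ℕ} (ε : ℝ) (grid : Fin (m + 1) → ℝ) (b : ℝ → Fin (d + 1) → ℝ)
    (q : ℝ) (x : Fin (d + 1) → ℝ) (e : ℝ) : Prop :=
  (q < x ⬝ᵥ b (grid 0) ∧ e = ε) ∨
  (∃ j : Fin m, x ⬝ᵥ b (grid j.castSucc) ≤ q ∧ q < x ⬝ᵥ b (grid j.succ) ∧
    e = grid j.castSucc) ∨
  (x ⬝ᵥ b (grid (Fin.last m)) ≤ q ∧ e = grid (Fin.last m))

/-- The estimators of the first step: quantile regression coefficients `βhat n ω η`, the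
unconditional `τ`-quantile `Qhat n ω`, and the matching function `ξhat n ω x`, computed from the
first `n` observations, where minimizers and matches may be selected in any measurable way. -/
structure IsFirstStep {Ω : Type*} [MeasurableSpace Ω] (μ : Measure Ω) {d : ℕ}
    (X : ℕ → Ω → Fin (d + 1) → ℝ) (Y : ℕ → Ω → ℝ) (ε τ : ℝ)
    (m : ℕ → ℕ) (grid : (n : ℕ) → Fin (m n + 1) → ℝ)
    (βhat : ℕ → Ω → ℝ → Fin (d + 1) → ℝ) (Qhat : ℕ → Ω → ℝ)
    (ξhat : ℕ → Ω → (Fin (d + 1) → ℝ) → ℝ) : Prop where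
  βhat_measurable : ∀ n, ∀ η ∈ Set.Icc ε (1 - ε), Measurable fun ω => βhat n ω η
  βhat_argmin : ∀ (n : ℕ) (ω : Ω), ∀ η ∈ Set.Icc ε (1 - ε),
    IsMinOn (fun b : Fin (d + 1) → ℝ =>
      (n : ℝ)⁻¹ * ∑ i ∈ Finset.range n, checkLoss η (Y i ω - X i ω ⬝ᵥ b)) Set.univ (βhat n ω η)
  Qhat_measurable : ∀ n, Measurable (Qhat n)
  Qhat_argmin : ∀ (n : ℕ) (ω : Ω),
    IsMinOn (fun q : ℝ => (n : ℝ)⁻¹ * ∑ i ∈ Finset.range n, checkLoss τ (Y i ω - q))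
      Set.univ (Qhat n ω)
  ξhat_measurable : ∀ n i, Measurable fun ω => ξhat n ω (X i ω)
  ξhat_match : ∀ n ω, ∀ x ∈ (μ.map (X 0)).support,
    IsEstimatedMatch ε (grid n) (βhat n ω) (Qhat n ω) x (ξhat n ω x)

/-- The Nadaraya-Watson-type estimator
`∑ K_h(y_i - Qhat) βhat₁(ξhat(x_i)) / ∑ K_h(y_i - Qhat)`, with `K_h(u) = h⁻¹ K(u / h)`. -/
def uqpeHat {Ω : Type*} {d : ℕ} (X : ℕ → Ω → Fin (d + 1) → ℝ) (Y : ℕ → Ω → ℝ)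
    (K : ℝ → ℝ) (h : ℕ → ℝ) (βhat : ℕ → Ω → ℝ → Fin (d + 1) → ℝ) (Qhat : ℕ → Ω → ℝ)
    (ξhat : ℕ → Ω → (Fin (d + 1) → ℝ) → ℝ) (n : ℕ) (ω : Ω) : ℝ :=
  (∑ i ∈ Finset.range n,
      (h n)⁻¹ * K ((Y i ω - Qhat n ω) / h n) * βhat n ω (ξhat n ω (X i ω)) 0) /
    ∑ i ∈ Finset.range n, (h n)⁻¹ * K ((Y i ω - Qhat n ω) / h n)

/-- Linear conditional quantiles, positive conditional density, existence of the match,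
the Bahadur representations of the quantile estimators, and the mesh of the grid. -/
structure MatchingAssumption {Ω : Type*} [MeasurableSpace Ω] (μ : Measure Ω) {d : ℕ}
    (X : ℕ → Ω → Fin (d + 1) → ℝ) (Y : ℕ → Ω → ℝ)
    (fYX : ℝ → (Fin (d + 1) → ℝ) → ℝ) (fY : ℝ → ℝ) (β : ℝ → Fin (d + 1) → ℝ) (ε τ : ℝ)
    (m : ℕ → ℕ) (grid : (n : ℕ) → Fin (m n + 1) → ℝ)
    (βhat : ℕ → Ω → ℝ → Fin (d + 1) → ℝ) (Qhat : ℕ → Ω → ℝ) : Prop where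
  linear : ∀ x ∈ (μ.map (X 0)).support, ∀ η ∈ Set.Icc ε (1 - ε),
    quantile (condLaw fYX x) η = x ⬝ᵥ β η
  moment : MemLp (X 0) 2 μ
  /-- For every `x`, the conditional density is bounded away from zero between the outermost
  conditional quantiles `x'β(ε)` and `x'β(1 - ε)`. -/
  density_pos : ∀ x ∈ (μ.map (X 0)).support, ∃ c : ℝ, 0 < c ∧
    ∀ y ∈ Set.Icc (x ⬝ᵥ β ε) (x ⬝ᵥ β (1 - ε)), c ≤ fYX y x
  match_exists : ∀ x ∈ (μ.map (X 0)).support,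
    ∃ η ∈ Set.Icc ε (1 - ε), η ∈ matchingSet fYX (quantile (μ.map (Y 0)) τ) x
  J_invertible : ∀ η ∈ Set.Icc ε (1 - ε), IsUnit (qrMatrix μ (X 0) fYX β η)
  J_deriv : ∀ j k, DifferentiableOn ℝ (fun η => qrMatrix μ (X 0) fYX β η j k)
      (Set.Icc ε (1 - ε)) ∧
    ∃ C : ℝ, ∀ η ∈ Set.Icc ε (1 - ε),
      |derivWithin (fun η => qrMatrix μ (X 0) fYX β η j k) (Set.Icc ε (1 - ε)) η| ≤ C
  bahadur : UnifLittleOp μ (Set.Icc ε (1 - ε)) fun n ω η =>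
    √(n : ℝ) * ‖βhat n ω η - β η - (qrMatrix μ (X 0) fYX β η)⁻¹ *ᵥ qrScore X Y β n ω η‖
  bahadur_uncond : TendstoInMeasure μ (fun (n : ℕ) ω =>
      √(n : ℝ) * (Qhat n ω - quantile (μ.map (Y 0)) τ -
        (fY (quantile (μ.map (Y 0)) τ))⁻¹ * ((n : ℝ)⁻¹ * ∑ i ∈ Finset.range n,
          (τ - if Y i ω ≤ quantile (μ.map (Y 0)) τ then 1 else 0))))
    atTop (fun _ => 0)
  isGrid : ∀ n, IsGrid ε (grid n)
  mesh : ∀ δ : ℝ, 0 < δ → ∀ᶠ n : ℕ in atTop, ∀ j : Fin (m n),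
    √(n : ℝ) * (grid n j.succ - grid n j.castSucc) ≤ δ

/-- `K` is a smooth symmetric kernel of order `r`. -/
structure KernelAssumption (K : ℝ → ℝ) (r : ℕ) : Prop where
  symm : ∀ u, K (-u) = K u
  integrable : Integrable K
  integral_eq_one : ∫ u, K u = 1
  moments : ∀ j : ℕ, 1 ≤ j → j ≤ r - 1 → ∫ u, u ^ j * K u = 0
  moment_order : Integrable fun u => |u| ^ r * K u
  differentiable : Differentiable ℝ K
  differentiable_deriv : Differentiable ℝ (deriv K)
  integrable_deriv : Integrable (deriv K)
  integral_deriv : ∫ u, deriv K u = 0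
  tails_atTop : ∀ j : ℕ, 1 ≤ j → j ≤ r + 1 → Tendsto (fun u => u ^ j * K u) atTop (𝓝 0)
  tails_atBot : ∀ j : ℕ, 1 ≤ j → j ≤ r + 1 → Tendsto (fun u => u ^ j * K u) atBot (𝓝 0)
  deriv_bdd : ∃ C : ℝ, ∀ u, |deriv K u| ≤ C
  deriv_two_bdd : ∃ C : ℝ, ∀ u, |deriv (deriv K) u| ≤ C
  deriv_sq : Integrable fun u => deriv K u ^ 2
  deriv_sq_moment : Integrable fun u => u * deriv K u ^ 2

/-- The bandwidth is positive and asymptotically proportional to `n ^ (-a)`, where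
`1 / (1 + 2 r) < a < 1 / 2`. -/
structure BandwidthAssumption (h : ℕ → ℝ) (a : ℝ) (r : ℕ) : Prop where
  pos : ∀ n, 0 < h n
  lower : 1 / (1 + 2 * (r : ℝ)) < a
  upper : a < 1 / 2
  proportional : ∃ c : ℝ, 0 < c ∧ Tendsto (fun n : ℕ => h n * (n : ℝ) ^ a) atTop (𝓝 c)

/-- Smoothness of the density of `Y` and, in `y`, of the joint density. -/
structure DensityAssumption {Ω : Type*} [MeasurableSpace Ω] (μ : Measure Ω) {d : ℕ}
    (X : Ω → Fin (d + 1) → ℝ) (fYX : ℝ → (Fin (d + 1) → ℝ) → ℝ)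
    (fX : (Fin (d + 1) → ℝ) → ℝ) (fY : ℝ → ℝ) (r : ℕ) : Prop where
  smooth_fY : SmoothBddDeriv (r + 1) fY
  smooth_joint : ∀ x ∈ (μ.map X).support, SmoothBddDeriv (r + 1) fun y => fYX y x * fX x

/-- Uniformity of the remainder of the estimated matching function over the support of `X`, and
boundedness of the derivative of `β₁` and of the conditional density. -/
structure ApproxAssumption {Ω : Type*} [MeasurableSpace Ω] (μ : Measure Ω) {d : ℕ}
    (X : ℕ → Ω → Fin (d + 1) → ℝ) (Y : ℕ → Ω → ℝ)
    (fYX : ℝ → (Fin (d + 1) → ℝ) → ℝ) (β : ℝ → Fin (d + 1) → ℝ) (ε τ : ℝ)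
    (βhat : ℕ → Ω → ℝ → Fin (d + 1) → ℝ) (Qhat : ℕ → Ω → ℝ)
    (ξhat : ℕ → Ω → (Fin (d + 1) → ℝ) → ℝ) : Prop where
  remainder : UnifLittleOp μ (μ.map (X 0)).support fun n ω x =>
    let q := quantile (μ.map (Y 0)) τ
    let ξ := matching fYX q x
    √(n : ℝ) * (ξhat n ω x - ξ -
      fYX (x ⬝ᵥ β ξ) x * (-(x ⬝ᵥ (βhat n ω ξ - β ξ)) + (Qhat n ω - q)))
  slope_differentiable : DifferentiableOn ℝ (fun η => β η 0) (Set.Icc ε (1 - ε))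
  slope_deriv_bdd : ∃ C : ℝ, ∀ η ∈ Set.Icc ε (1 - ε),
    |derivWithin (fun η => β η 0) (Set.Icc ε (1 - ε)) η| ≤ C
  density_bdd : ∃ C : ℝ, ∀ x ∈ (μ.map (X 0)).support, ∀ y, fYX y x ≤ C

/-- The residual `V - E[V | Y]`. -/
def residual {Ω : Type*} [MeasurableSpace Ω] (μ : Measure Ω) (V Y : Ω → ℝ) (ω : Ω) : ℝ :=
  V ω - (μ[V | MeasurableSpace.comap Y inferInstance]) ω

/-- Moment and smoothness conditions for the matched slope `V = β₁(ξ_τ(X))` and its residual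
`U = V - E[V | Y]`; here `g y = E[V | Y = y]` and `s y = E[U² | Y = y]`. The
parameter `UQPE(τ) = E[β₁(ξ_τ(X)) | Y = Q_Y[τ]]` is the value of `g` at `Q_Y[τ]`. -/
structure CLTAssumption {Ω : Type*} [MeasurableSpace Ω] (μ : Measure Ω) (V Y : Ω → ℝ)
    (K : ℝ → ℝ) (r : ℕ) (γ : ℝ) (g s : ℝ → ℝ) : Prop where
  γ_pos : 0 < γ
  residual_moment : ∃ C : ℝ, ∀ᵐ ω ∂μ,
    (μ[fun ω => |residual μ V Y ω| ^ (2 + γ) | MeasurableSpace.comap Y inferInstance]) ω < C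
  kernel_moment : Integrable fun u => |K u| ^ (2 + γ)
  regression : IsRegression μ V Y g
  regression_smooth : SmoothBddDeriv (r + 1) g
  variance : IsRegression μ (fun ω => residual μ V Y ω ^ 2) Y s
  variance_continuous : Continuous s

end UQPE

end

/-! Write `q` for the unconditional `τ`-quantile and `g` for the regression function of the matched
slope `β₁(ξ_τ(X))` on `Y`. The normalized estimation error is exactly `N · f_Y(q) / D` wherever `D ≠
0`. Here `D = (nh)⁻¹ ∑ K((y_i - Q̂)/h)` is a kernel density estimator, and `N = (f_Y(q) √(nh))⁻¹ ∑
K((y_i - Q̂)/h) (β̂₁(ξ̂(x_i)) - g(q))`. As `D → f_Y(q) > 0` in probability, Slutsky's theorem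
(`tendstoInDistribution_ratio`) leaves only the law of `N` to be found.

The first step is almost root-`n` consistent, whereas the kernel step converges at the slower rate
`√(nh)`. A crude first-step rate `ρ = n^θ/√n` with a small `θ > 0` is therefore enough.
`exists_rate` picks `θ` so that `√(nh) ρ = √h n^θ → 0` and `ρ/h → 0`; the latter is possible because
`a < 1/2`. Three errors separate `N` from a centred kernel sum evaluated at the true `q` with the
true slopes. (i) Estimated slopes: they are off by `O(ρ (1 + ‖x‖))` uniformly over the support, the
expected kernel mass is of order `nh`, and the effect is of order `√h n^θ`
(`tendstoInMeasure_kernel_error`). (ii) Estimated evaluation point: the centred kernel sum is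
differentiable in that point, so its oscillation over a window of width `ρ` is at most the integral
of its derivative, which contributes `ρ/h`; its mean is Lipschitz and contributes `√(nh) ρ`
(`tendstoInMeasure_kernel_sub`). (iii) Bias: `(g - g(q)) f_Y` vanishes at `q` and the kernel has
order `r`, so the bias is `O(√(nh) h^r)`, negligible because `a > 1/(1 + 2r)`.

The remaining centred sum has independent terms bounded by a multiple of `(nh)^(-1/2)`, since `β₁`
is continuous on the compact interval `[ε, 1 - ε]`. A characteristic function argument
(`tendstoInDistribution_triangular_array`) yields normality, and a change of variables yields the
variance.

The uniform first-step rate rests on the Bahadur representation and a maximal inequality for the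
quantile regression score. The indicators are monotone in `η` because the conditional quantiles are,
so dyadic chaining loses only a logarithm, which `n^θ` absorbs. Finally, `ξ_τ(x)` is the conditional
distribution function at `q`. This makes the matched slope measurable, and `f_Y(q) > 0` follows from
positivity of the conditional densities through Fatou's lemma. -/

namespace UQPE

/-! ### Moment bounds for i.i.d. sums and a triangular-array central limit theorem -/

section Toolbox

variable {Ω E : Type*} [MeasurableSpace Ω] [MeasurableSpace E] {μ : Measure Ω}
  {Z : ℕ → Ω → E}

/-- A sequence dominated, off sets of vanishing measure, by random variables with vanishing
expectation tends to zero in probability. -/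
lemma tendstoInMeasure_zero_of_le {R : ℕ → Ω → ℝ} {T : ℕ → Ω → ENNReal} {bad : ℕ → Set Ω}
    (hT : ∀ n, AEMeasurable (T n) μ) (hbad : Tendsto (fun n => μ (bad n)) atTop (𝓝 0))
    (hle : ∀ᶠ n in atTop, ∀ᵐ ω ∂μ, ω ∉ bad n → ‖R n ω‖ₑ ≤ T n ω)
    (hlim : Tendsto (fun n => ∫⁻ ω, T n ω ∂μ) atTop (𝓝 0)) :
    TendstoInMeasure μ R atTop (fun _ => 0) := by
  rw [tendstoInMeasure_iff_enorm]
  intro δ hδ hδ'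
  have h1 : Tendsto (fun n => μ (bad n) + (∫⁻ ω, T n ω ∂μ) / δ) atTop (𝓝 0) := by
    have := hbad.add (ENNReal.Tendsto.div_const hlim (Or.inr hδ.ne'))
    simpa using this
  refine tendsto_of_tendsto_of_tendsto_of_le_of_le' tendsto_const_nhds h1
    (Eventually.of_forall fun _ => zero_le) ?_
  filter_upwards [hle] with n hn
  calc μ {ω | δ ≤ ‖R n ω - 0‖ₑ} ≤ μ (bad n ∪ {ω | δ ≤ T n ω}) := by
        refine measure_mono_ae ?_
        filter_upwards [hn] with ω hω hmem
        by_cases hb : ω ∈ bad n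
        · exact Or.inl hb
        · refine Or.inr (le_trans ?_ (hω hb))
          have h' : δ ≤ ‖R n ω - 0‖ₑ := hmem
          simpa using h'
    _ ≤ μ (bad n) + μ {ω | δ ≤ T n ω} := measure_union_le _ _
    _ ≤ μ (bad n) + (∫⁻ ω, T n ω ∂μ) / δ := by
        gcongr
        exact meas_ge_le_lintegral_div (hT n) hδ.ne' hδ'

variable [IsProbabilityMeasure μ]

/-- The second moment of a centered sum of i.i.d. variables. -/
lemma integral_sq_sum_sub_le (hindep : iIndepFun Z μ)
    (hident : ∀ i, IdentDistrib (Z i) (Z 0) μ μ) {f : E → ℝ} (hf : Measurable f)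
    (hf2 : MemLp (fun ω => f (Z 0 ω)) 2 μ) (n : ℕ) :
    MemLp (fun ω => ∑ i ∈ Finset.range n, (f (Z i ω) - ∫ ω, f (Z 0 ω) ∂μ)) 2 μ ∧
    ∫ ω, (∑ i ∈ Finset.range n, (f (Z i ω) - ∫ ω, f (Z 0 ω) ∂μ)) ^ 2 ∂μ
      ≤ n * ∫ ω, f (Z 0 ω) ^ 2 ∂μ := by
  set c := ∫ ω, f (Z 0 ω) ∂μ with hc
  have hid : ∀ i, IdentDistrib (fun ω => f (Z i ω)) (fun ω => f (Z 0 ω)) μ μ :=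
    fun i => (hident i).comp hf
  have hL : ∀ i, MemLp (fun ω => f (Z i ω)) 2 μ := fun i => (hid i).memLp_iff.2 hf2
  have hL' : ∀ i, MemLp (fun ω => f (Z i ω) - c) 2 μ := fun i => (hL i).sub (memLp_const c)
  have hS : MemLp (fun ω => ∑ i ∈ Finset.range n, (f (Z i ω) - c)) 2 μ :=
    memLp_finsetSum _ fun i _ => hL' i
  refine ⟨hS, ?_⟩
  have hmean : ∫ ω, ∑ i ∈ Finset.range n, (f (Z i ω) - c) ∂μ = 0 := by
    rw [integral_finsetSum _ fun i _ => (hL' i).integrable (by norm_num)]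
    refine Finset.sum_eq_zero fun i _ => ?_
    rw [integral_sub ((hL i).integrable (by norm_num)) (integrable_const c), (hid i).integral_eq]
    simp [hc]
  have hvar : Var[∑ i ∈ Finset.range n, fun ω => f (Z i ω) - c; μ] =
      ∑ i ∈ Finset.range n, Var[fun ω => f (Z i ω) - c; μ] := by
    refine IndepFun.variance_sum (fun i _ => hL' i) fun i _ j _ hij => ?_
    exact (hindep.indepFun hij).comp (φ := fun z => f z - c) (ψ := fun z => f z - c)
      (by fun_prop) (by fun_prop)
  have hfun : (∑ i ∈ Finset.range n, fun ω => f (Z i ω) - c) =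
      fun ω => ∑ i ∈ Finset.range n, (f (Z i ω) - c) := by
    ext ω; simp
  rw [hfun, variance_eq_sub hS, hmean] at hvar
  simp only [Pi.pow_apply, ne_eq, OfNat.ofNat_ne_zero, not_false_eq_true, zero_pow, sub_zero]
    at hvar
  rw [hvar]
  -- The variance is at most the raw second moment; dropping the squared mean keeps the bound in a
  -- form that a change of variables can evaluate.
  have hv : ∀ i ∈ Finset.range n, Var[fun ω => f (Z i ω) - c; μ] ≤ ∫ ω, f (Z 0 ω) ^ 2 ∂μ := by
    intro i _
    rw [variance_sub_const (hL i).1, (hid i).variance_eq]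
    exact variance_le_expectation_sq hf2.1
  simpa using Finset.sum_le_sum hv

/-- This is nonnegativity of the variance of `|f|`. -/
lemma integral_abs_le_sqrt {f : Ω → ℝ} (hf : MemLp f 2 μ) :
    ∫ ω, |f ω| ∂μ ≤ √(∫ ω, f ω ^ 2 ∂μ) := by
  refine Real.le_sqrt_of_sq_le ?_
  have h := variance_nonneg |f| μ
  rw [variance_eq_sub hf.abs] at h
  simp only [Pi.pow_apply, Pi.abs_apply, sq_abs] at h
  linarith

/-- The first absolute moment of a centered sum of i.i.d. variables. -/
lemma lintegral_enorm_sum_sub_le (hindep : iIndepFun Z μ)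
    (hident : ∀ i, IdentDistrib (Z i) (Z 0) μ μ) {f : E → ℝ} (hf : Measurable f)
    (hf2 : MemLp (fun ω => f (Z 0 ω)) 2 μ) (n : ℕ) :
    ∫⁻ ω, ‖∑ i ∈ Finset.range n, (f (Z i ω) - ∫ ω, f (Z 0 ω) ∂μ)‖ₑ ∂μ
      ≤ ENNReal.ofReal √(n * ∫ ω, f (Z 0 ω) ^ 2 ∂μ) := by
  obtain ⟨hL, hle⟩ := integral_sq_sum_sub_le hindep hident hf hf2 n
  rw [← ofReal_integral_norm_eq_lintegral_enorm (hL.integrable (by norm_num))]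
  refine ENNReal.ofReal_le_ofReal ?_
  exact (integral_abs_le_sqrt hL).trans (Real.sqrt_le_sqrt hle)

lemma norm_exp_mul_I_sub_taylor_le {x : ℝ} (hx : |x| ≤ 1) :
    ‖Complex.exp (x * Complex.I) - (1 + x * Complex.I - (x : ℂ) ^ 2 / 2)‖ ≤ |x| ^ 3 := by
  have h := Complex.exp_bound (x := x * Complex.I) (by simpa using hx) (n := 3) (by norm_num)
  have e : ∑ m ∈ Finset.range 3, ((x : ℂ) * Complex.I) ^ m / (m.factorial : ℂ) =
      1 + x * Complex.I - (x : ℂ) ^ 2 / 2 := by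
    simp [Finset.sum_range_succ, mul_pow]
    ring
  rw [e] at h
  refine h.trans ?_
  simp only [norm_mul, Complex.norm_real, Real.norm_eq_abs, Complex.norm_I, mul_one]
  have : (0 : ℝ) ≤ |x| ^ 3 := by positivity
  norm_num [Nat.factorial]
  linarith

/-- Central limit theorem for a triangular array of uniformly small, row-wise i.i.d. variables. -/
theorem tendstoInDistribution_triangular_array (hmeas : ∀ i, Measurable (Z i))
    (hindep : iIndepFun Z μ) (hident : ∀ i, IdentDistrib (Z i) (Z 0) μ μ)
    {f : ℕ → E → ℝ} (hf : ∀ n, Measurable (f n)) {c : ℕ → ℝ} (hc : Tendsto c atTop (𝓝 0))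
    (hfc : ∀ n z, |f n z| ≤ c n) (hmean : ∀ n, ∫ ω, f n (Z 0 ω) ∂μ = 0) {v : ℝ}
    (hvar : Tendsto (fun n : ℕ => n * ∫ ω, f n (Z 0 ω) ^ 2 ∂μ) atTop (𝓝 v)) :
    TendstoInDistribution (fun (n : ℕ) ω => ∑ i ∈ Finset.range n, f n (Z i ω)) atTop id
      (fun _ => μ) (gaussianReal 0 v.toNNReal) where
  forall_aemeasurable n :=
    (Finset.measurable_sum _ fun i _ => (hf n).comp (hmeas i)).aemeasurable
  tendsto := by
    have hv : 0 ≤ v := by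
      refine ge_of_tendsto' hvar fun n => ?_
      have : 0 ≤ ∫ ω, f n (Z 0 ω) ^ 2 ∂μ := integral_nonneg fun _ => sq_nonneg _
      positivity
    refine ProbabilityMeasure.tendsto_iff_tendsto_charFun.2 fun t => ?_
    simp only [ProbabilityMeasure.coe_mk, Measure.map_id]
    have hpow : ∀ n : ℕ, charFun (μ.map fun ω => ∑ i ∈ Finset.range n, f n (Z i ω)) t =
        (1 + ∫ ω, (Complex.exp (((t * f n (Z 0 ω) : ℝ) : ℂ) * Complex.I) - 1) ∂μ) ^ n := by
      intro n
      have hind : iIndepFun (fun i ω => f n (Z i ω)) μ := hindep.comp (fun _ => f n) fun _ => hf n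
      rw [iIndepFun.charFun_map_fun_finsetSum_eq_prod (X := fun i ω => f n (Z i ω))
        (fun i _ => ((hf n).comp (hmeas i)).aemeasurable) (hind.restrict _)]
      have hone : ∀ i, charFun (μ.map fun ω => f n (Z i ω)) t =
          1 + ∫ ω, (Complex.exp (((t * f n (Z 0 ω) : ℝ) : ℂ) * Complex.I) - 1) ∂μ := by
        intro i
        have hmap : μ.map (fun ω => f n (Z i ω)) = μ.map (fun ω => f n (Z 0 ω)) :=
          ((hident i).comp (hf n)).map_eq
        have hfm : Measurable fun ω => f n (Z 0 ω) := (hf n).comp (hmeas 0)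
        rw [hmap, charFun_apply_real, integral_map hfm.aemeasurable (by fun_prop), integral_sub]
        · simp
        · refine Integrable.of_bound (C := 1) ?_ (ae_of_all _ fun ω => ?_)
          · have h2 : Measurable fun ω =>
                Complex.exp (((t * f n (Z 0 ω) : ℝ) : ℂ) * Complex.I) := by fun_prop
            exact h2.aestronglyMeasurable
          · exact (Complex.norm_exp_ofReal_mul_I _).le
        · exact integrable_const _
      simp only [Finset.prod_apply, hone, Finset.prod_const, Finset.card_range]
    simp_rw [hpow, charFun_gaussianReal]
    -- The characteristic function of the sum is `(1 + z/n)^n` with `z = n E[exp(i t f_n) - 1]`, so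
    -- it suffices that `z → -t² v / 2`.
    apply Complex.tendsto_one_add_pow_exp_of_tendsto
    have hlimC : Tendsto (fun n : ℕ =>
        (-(t ^ 2 / 2 * (n * ∫ ω, f n (Z 0 ω) ^ 2 ∂μ) : ℝ) : ℂ)) atTop
        (𝓝 (-(t ^ 2 / 2 * v : ℝ) : ℂ)) := by
      have := (Complex.continuous_ofReal.tendsto _).comp (hvar.const_mul (t ^ 2 / 2))
      exact this.neg
    have htarget : (t : ℂ) * ((0 : ℝ) : ℂ) * Complex.I - (v.toNNReal : ℂ) * (t : ℂ) ^ 2 / 2 =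
        (-(t ^ 2 / 2 * v : ℝ) : ℂ) := by
      have : ((v.toNNReal : ℝ) : ℂ) = (v : ℂ) := by rw [Real.coe_toNNReal v hv]
      have h' : (v.toNNReal : ℂ) = (v : ℂ) := this
      rw [h']
      push_cast
      ring
    rw [htarget]
    refine (tendsto_iff_of_dist ?_).1 hlimC
    have hbound : ∀ᶠ n : ℕ in atTop, dist
        (-(t ^ 2 / 2 * (n * ∫ ω, f n (Z 0 ω) ^ 2 ∂μ) : ℝ) : ℂ)
        (n * ∫ ω, (Complex.exp (((t * f n (Z 0 ω) : ℝ) : ℂ) * Complex.I) - 1) ∂μ) ≤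
        |t| ^ 3 * |c n| * (n * ∫ ω, f n (Z 0 ω) ^ 2 ∂μ) := by
      have hsmall : Tendsto (fun n => |t| * |c n|) atTop (𝓝 0) := by
        simpa using hc.abs.const_mul |t|
      filter_upwards [hsmall.eventually_le_const one_pos] with n hn
      have hfm : Measurable fun ω => f n (Z 0 ω) := (hf n).comp (hmeas 0)
      have hfi : Integrable (fun ω => f n (Z 0 ω)) μ :=
        Integrable.of_bound hfm.aestronglyMeasurable (c n) (ae_of_all _ fun ω => hfc n _)
      have hf2i : Integrable (fun ω => f n (Z 0 ω) ^ 2) μ := by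
        refine Integrable.of_bound (hfm.pow_const 2).aestronglyMeasurable (c n ^ 2)
          (ae_of_all _ fun ω => ?_)
        rw [Real.norm_eq_abs, abs_pow]
        exact pow_le_pow_left₀ (abs_nonneg _) (hfc n _) 2
      set G : Ω → ℂ := fun ω => Complex.exp (((t * f n (Z 0 ω) : ℝ) : ℂ) * Complex.I) - 1 with hG
      have hGi : Integrable G μ := by
        refine Integrable.of_bound (C := 2) ?_ (ae_of_all _ fun ω => ?_)
        · have : Measurable G := by simp only [hG]; fun_prop
          exact this.aestronglyMeasurable
        · refine (norm_sub_le _ _).trans ?_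
          rw [Complex.norm_exp_ofReal_mul_I]
          norm_num
      have hlin : ∫ ω, (((t * f n (Z 0 ω) : ℝ) : ℂ) * Complex.I) ∂μ = 0 := by
        rw [integral_mul_const, integral_complex_ofReal, integral_const_mul, hmean n]
        simp
      have hquad : ∫ ω, (((t * f n (Z 0 ω) : ℝ) : ℂ) ^ 2 / 2) ∂μ =
          ((t ^ 2 / 2 * ∫ ω, f n (Z 0 ω) ^ 2 ∂μ : ℝ) : ℂ) := by
        rw [← integral_const_mul, ← integral_complex_ofReal]
        congr 1
        ext ω
        push_cast
        ring
      have hLi : Integrable (fun ω => ((t * f n (Z 0 ω) : ℝ) : ℂ) * Complex.I) μ :=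
        ((hfi.const_mul t).ofReal (𝕜 := ℂ)).mul_const _
      have hQi : Integrable (fun ω => ((t * f n (Z 0 ω) : ℝ) : ℂ) ^ 2 / 2) μ := by
        have := (hf2i.const_mul (t ^ 2 / 2)).ofReal (𝕜 := ℂ)
        refine this.congr (ae_of_all _ fun ω => ?_)
        simp only [Complex.coe_algebraMap, RCLike.ofReal_mul]
        push_cast
        ring
      -- In the expansion of the exponential, the linear term has mean zero and the quadratic term
      -- gives the variance. One factor of the cubic remainder is bounded by `c n`, which leaves
      -- `|t|³ |c n|` times the second moment.
      have hrem : ‖∫ ω, (G ω - ((t * f n (Z 0 ω) : ℝ) : ℂ) * Complex.I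
          + ((t * f n (Z 0 ω) : ℝ) : ℂ) ^ 2 / 2) ∂μ‖
          ≤ ∫ ω, |t| ^ 3 * |c n| * f n (Z 0 ω) ^ 2 ∂μ := by
        refine norm_integral_le_of_norm_le (hf2i.const_mul _) (ae_of_all _ fun ω => ?_)
        have hx : |t * f n (Z 0 ω)| ≤ 1 := by
          rw [abs_mul]
          exact (mul_le_mul_of_nonneg_left ((hfc n _).trans (le_abs_self _)) (abs_nonneg t)).trans hn
        have h3 := norm_exp_mul_I_sub_taylor_le hx
        have e : G ω - ((t * f n (Z 0 ω) : ℝ) : ℂ) * Complex.I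
            + ((t * f n (Z 0 ω) : ℝ) : ℂ) ^ 2 / 2 =
            Complex.exp (((t * f n (Z 0 ω) : ℝ) : ℂ) * Complex.I) -
            (1 + ((t * f n (Z 0 ω) : ℝ) : ℂ) * Complex.I - ((t * f n (Z 0 ω) : ℝ) : ℂ) ^ 2 / 2) := by
          simp only [hG]; ring
        rw [e]
        refine h3.trans ?_
        rw [abs_mul, mul_pow, pow_succ |f n (Z 0 ω)| 2, sq_abs]
        have := (hfc n (Z 0 ω)).trans (le_abs_self _)
        have h0 : 0 ≤ |t| ^ 3 * f n (Z 0 ω) ^ 2 := by positivity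
        nlinarith
      rw [integral_add (by exact hGi.sub hLi) hQi, integral_sub hGi hLi, hlin, hquad, integral_const_mul]
        at hrem
      rw [dist_eq_norm, norm_sub_rev]
      have e : (n : ℂ) * ∫ ω, G ω ∂μ - (-(t ^ 2 / 2 * (n * ∫ ω, f n (Z 0 ω) ^ 2 ∂μ) : ℝ) : ℂ) =
          n * (∫ ω, G ω ∂μ - 0 + ((t ^ 2 / 2 * ∫ ω, f n (Z 0 ω) ^ 2 ∂μ : ℝ) : ℂ)) := by
        push_cast; ring
      rw [e, norm_mul, Complex.norm_natCast]
      calc (n : ℝ) * _ ≤ n * (|t| ^ 3 * |c n| * ∫ ω, f n (Z 0 ω) ^ 2 ∂μ) := by gcongr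
        _ = _ := by ring
    have hz : Tendsto (fun n : ℕ => |t| ^ 3 * |c n| * (n * ∫ ω, f n (Z 0 ω) ^ 2 ∂μ)) atTop
        (𝓝 0) := by
      have := (hc.abs.const_mul (|t| ^ 3)).mul hvar
      simpa using this
    exact squeeze_zero' (Eventually.of_forall fun _ => dist_nonneg) hbound hz

end Toolbox

end UQPE

namespace UQPE

/-! ### Kernels: substitution, envelopes and bias -/

section Kernel

variable {K : ℝ → ℝ} {r : ℕ}

lemma lintegral_comp_sub_div (φ : ℝ → ENNReal) (hφ : Measurable φ) (q : ℝ) {h : ℝ} (hh : 0 < h) :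
    ∫⁻ y, φ ((y - q) / h) = ENNReal.ofReal h * ∫⁻ u, φ u := by
  rw [lintegral_sub_right_eq_self (fun y => φ (y / h)) q]
  have h1 := Real.map_volume_mul_left (a := h⁻¹) (by positivity)
  have h2 : ∫⁻ u, φ u ∂(Measure.map (fun x => h⁻¹ * x) volume) = ∫⁻ x, φ (h⁻¹ * x) :=
    lintegral_map hφ (by fun_prop)
  rw [h1, lintegral_smul_measure, inv_inv, abs_of_pos hh] at h2
  rw [smul_eq_mul] at h2
  rw [h2]
  simp_rw [div_eq_inv_mul]

lemma integral_comp_sub_div (φ : ℝ → ℝ) (q : ℝ) {h : ℝ} (hh : 0 < h) :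
    ∫ y, φ ((y - q) / h) = h * ∫ u, φ u := by
  rw [integral_sub_right_eq_self (fun y => φ (y / h)) q, Measure.integral_comp_div, abs_of_pos hh,
    smul_eq_mul]

/-- Substitution `y = q + h u`. -/
lemma integral_kernel_mul (φ m : ℝ → ℝ) (q : ℝ) {h : ℝ} (hh : 0 < h) :
    ∫ y, φ ((y - q) / h) * m y = h * ∫ u, φ u * m (q + h * u) := by
  rw [← integral_comp_sub_div (fun u => φ u * m (q + h * u)) q hh]
  congr 1
  ext y
  congr 2
  field_simp
  ring

/-- An increment of a continuously differentiable function is bounded by the integral of its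
derivative. -/
lemma enorm_sub_le_lintegral_deriv {φ φ' : ℝ → ℝ} (hφ : ∀ t, HasDerivAt φ (φ' t) t)
    (hφ' : Continuous φ') {b t : ℝ} (ht : |t| ≤ b) :
    ‖φ t - φ 0‖ₑ ≤ ∫⁻ s in Set.Icc (-b) b, ‖φ' s‖ₑ := by
  rw [← intervalIntegral.integral_eq_sub_of_hasDerivAt (a := 0) (b := t) (f := φ) (f' := φ')
    (fun x _ => hφ x) (hφ'.intervalIntegrable _ _)]
  have habs := abs_le.1 ht
  have hsub : Set.uIoc 0 t ⊆ Set.Icc (-b) b := by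
    intro s hs
    rw [Set.mem_uIoc] at hs
    constructor <;> rcases hs with hs | hs <;> linarith [hs.1, hs.2]
  calc ‖∫ s in (0)..t, φ' s‖ₑ = ‖∫ s in Set.uIoc 0 t, φ' s‖ₑ := by
        rw [← ofReal_norm, intervalIntegral.norm_intervalIntegral_eq, ofReal_norm]
    _ ≤ ∫⁻ s in Set.uIoc 0 t, ‖φ' s‖ₑ := enorm_integral_le_lintegral_enorm _
    _ ≤ _ := lintegral_mono_set hsub

lemma KernelAssumption.continuous (hK : KernelAssumption K r) : Continuous K :=
  hK.differentiable.continuous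

lemma KernelAssumption.continuous_deriv (hK : KernelAssumption K r) : Continuous (deriv K) :=
  hK.differentiable_deriv.continuous

/-- `K` differs from `K 0` by an integral of `K'`, and `K'` is integrable. -/
lemma KernelAssumption.bdd (hK : KernelAssumption K r) : ∃ C : ℝ, 0 ≤ C ∧ ∀ u, |K u| ≤ C := by
  refine ⟨|K 0| + ∫ u, |deriv K u|, by positivity, fun u => ?_⟩
  have h1 : ∫ s in (0)..u, deriv K s = K u - K 0 :=
    intervalIntegral.integral_eq_sub_of_hasDerivAt
      (fun x _ => (hK.differentiable x).hasDerivAt) (hK.continuous_deriv.intervalIntegrable _ _)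
  have h2 : |K u - K 0| ≤ ∫ u, |deriv K u| := by
    rw [← h1, ← Real.norm_eq_abs, intervalIntegral.norm_intervalIntegral_eq]
    refine (norm_integral_le_integral_norm _).trans ?_
    exact setIntegral_le_integral hK.integrable_deriv.norm (ae_of_all _ fun _ => norm_nonneg _)
  have h3 := abs_sub_abs_le_abs_sub (K u) (K 0)
  linarith

lemma KernelAssumption.integrable_sq (hK : KernelAssumption K r) :
    Integrable fun u => K u ^ 2 := by
  obtain ⟨C, hC0, hC⟩ := hK.bdd
  have := hK.integrable.bdd_mul (c := C) hK.continuous.aestronglyMeasurable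
    (ae_of_all _ fun u => hC u)
  simpa [sq] using this

/-- An integrable majorant of all translates of `K` by at most one. -/
noncomputable def kernelEnvelope (K : ℝ → ℝ) (u : ℝ) : ENNReal :=
  ‖K u‖ₑ + ∫⁻ s in Set.Icc (-1 : ℝ) 1, ‖deriv K (u + s)‖ₑ

/-- This removes the random evaluation point: once `Q̂` is within `h` of `q`, every kernel weight at
`Q̂` is dominated by a nonrandom function of `(y_i - q)/h`. -/
lemma enorm_kernel_add_le (hK : KernelAssumption K r) (u : ℝ) {δ : ℝ} (hδ : |δ| ≤ 1) :
    ‖K (u + δ)‖ₑ ≤ kernelEnvelope K u := by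
  have h := enorm_sub_le_lintegral_deriv (φ := fun s => K (u + s)) (φ' := fun s => deriv K (u + s))
    (fun t => by
      have := (hK.differentiable (u + t)).hasDerivAt.comp_const_add u t
      simpa using this) (by have := hK.continuous_deriv; fun_prop) hδ
  simp only [add_zero] at h
  calc ‖K (u + δ)‖ₑ = ‖K u + (K (u + δ) - K u)‖ₑ := by congr 1; ring
    _ ≤ ‖K u‖ₑ + ‖K (u + δ) - K u‖ₑ := enorm_add_le _ _
    _ ≤ _ := by unfold kernelEnvelope; gcongr

lemma measurable_kernelEnvelope (hK : KernelAssumption K r) : Measurable (kernelEnvelope K) := by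
  have h1 := hK.continuous.measurable
  have h2 := hK.continuous_deriv.measurable
  refine h1.enorm.add (Measurable.lintegral_prod_right' (f := fun p : ℝ × ℝ => ‖deriv K (p.1 + p.2)‖ₑ) ?_)
  fun_prop

/-- By Tonelli and translation invariance the total mass is `∫|K| + 2 ∫|K'|`. -/
lemma lintegral_kernelEnvelope_ne_top (hK : KernelAssumption K r) :
    ∫⁻ u, kernelEnvelope K u ≠ ⊤ := by
  have h1 := hK.continuous.measurable
  have h2 := hK.continuous_deriv.measurable
  unfold kernelEnvelope
  rw [lintegral_add_left h1.enorm]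
  refine ENNReal.add_ne_top.2 ⟨hK.integrable.2.ne, ?_⟩
  rw [lintegral_lintegral_swap (by
    have : Measurable (Function.uncurry fun u s : ℝ => ‖deriv K (u + s)‖ₑ) := by
      unfold Function.uncurry; fun_prop
    exact this.aemeasurable)]
  simp_rw [lintegral_add_right_eq_self (fun u => ‖deriv K u‖ₑ)]
  rw [setLIntegral_const]
  exact ENNReal.mul_ne_top hK.integrable_deriv.2.ne (by simp)

/-- Lower moments are controlled by `|u|^j ≤ 1 + |u|^r`. -/
lemma KernelAssumption.integrable_pow_mul (hK : KernelAssumption K r) {j : ℕ} (hj : j ≤ r) :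
    Integrable fun u => u ^ j * K u := by
  refine Integrable.mono' (hK.integrable.abs.add hK.moment_order.abs)
    (by have := hK.continuous; exact (by fun_prop : Continuous fun u => u ^ j * K u).aestronglyMeasurable)
    (ae_of_all _ fun u => ?_)
  have h0 := abs_nonneg (K u)
  simp only [Real.norm_eq_abs, abs_mul, abs_pow, Pi.add_apply, abs_abs]
  rcases le_total |u| 1 with hu | hu
  · have : |u| ^ j ≤ 1 := pow_le_one₀ (abs_nonneg u) hu
    have h3 : 0 ≤ |u| ^ r := by positivity
    nlinarith
  · have : |u| ^ j ≤ |u| ^ r := pow_le_pow_right₀ hu hj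
    nlinarith

/-- Taylor's theorem with a bound for the remainder on both sides of the base point. -/
lemma abs_sub_taylor_le {m : ℝ → ℝ} {k : ℕ} (hm : ContDiff ℝ (k + 1 : ℕ) m) {C : ℝ}
    (hC : ∀ y, |iteratedDeriv (k + 1) m y| ≤ C) (q z : ℝ) :
    |m (q + z) - ∑ j ∈ Finset.range (k + 1), iteratedDeriv j m q / j.factorial * z ^ j|
      ≤ C * |z| ^ (k + 1) := by
  have hC0 : 0 ≤ C := (abs_nonneg _).trans (hC 0)
  rcases eq_or_ne z 0 with rfl | hz
  · have : ∑ j ∈ Finset.range (k + 1), iteratedDeriv j m q / j.factorial * (0 : ℝ) ^ j = m q := by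
      rw [Finset.sum_range_succ']
      simp
    rw [this]
    simp
  · have hne : q ≠ q + z := by simpa using hz
    obtain ⟨x', -, hx'⟩ := taylor_mean_remainder_lagrange_iteratedDeriv (f := m) (n := k) hne
      (by exact_mod_cast hm.contDiffOn)
    rw [taylor_within_apply] at hx'
    have e : ∑ j ∈ Finset.range (k + 1), iteratedDeriv j m q / j.factorial * z ^ j =
        ∑ j ∈ Finset.range (k + 1), ((j.factorial : ℝ)⁻¹ * (q + z - q) ^ j) •
          iteratedDerivWithin j m (Set.uIcc q (q + z)) q := by
      refine Finset.sum_congr rfl fun j hj => ?_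
      rw [iteratedDerivWithin_eq_iteratedDeriv (uniqueDiffOn_uIcc hne)
        ((hm.of_le (by exact_mod_cast (Finset.mem_range.1 hj).le)).contDiffAt) Set.left_mem_uIcc]
      rw [add_sub_cancel_left, smul_eq_mul]
      ring
    rw [e, hx', add_sub_cancel_left, abs_div, abs_mul, abs_pow]
    have hf : (1 : ℝ) ≤ |((k + 1).factorial : ℝ)| := by
      rw [abs_of_nonneg (by positivity)]
      exact_mod_cast Nat.one_le_iff_ne_zero.2 (Nat.factorial_ne_zero _)
    refine (div_le_self (by positivity) hf).trans ?_
    gcongr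
    exact hC x'

/-- The bias of a kernel of order `r`. -/
lemma abs_integral_kernel_sub_le (hK : KernelAssumption K r) (hr : 1 ≤ r) {m : ℝ → ℝ}
    (hm : ContDiff ℝ r m) {C : ℝ} (hC : ∀ y, |iteratedDeriv r m y| ≤ C) (q : ℝ) {h : ℝ}
    (hh : 0 < h) (hint : Integrable fun u => K u * m (q + h * u)) :
    |(∫ u, K u * m (q + h * u)) - m q| ≤ C * (∫ u, |u| ^ r * |K u|) * h ^ r := by
  obtain ⟨k, rfl⟩ : ∃ k, r = k + 1 := ⟨r - 1, by omega⟩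
  set P : ℝ → ℝ := fun u => ∑ j ∈ Finset.range (k + 1),
    iteratedDeriv j m q / j.factorial * h ^ j * (u ^ j * K u) with hP
  have hPi : ∀ j ∈ Finset.range (k + 1), Integrable fun u =>
      iteratedDeriv j m q / j.factorial * h ^ j * (u ^ j * K u) := fun j hj =>
    (hK.integrable_pow_mul (Finset.mem_range.1 hj).le).const_mul _
  have hPint : ∫ u, P u = m q := by
    -- The moment conditions annihilate the Taylor terms of orders `1, …, r - 1`, so only the
    -- constant term `m q` survives.
    rw [hP, integral_finsetSum _ hPi, Finset.sum_eq_single_of_mem 0 (by simp)]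
    · simp [integral_const_mul, hK.integral_eq_one]
    · intro j hj hj0
      rw [integral_const_mul, hK.moments j (by omega) (by have := Finset.mem_range.1 hj; omega),
        mul_zero]
  rw [← hPint, ← integral_sub hint (integrable_finsetSum _ hPi), mul_assoc, mul_comm _ (h ^ _),
    ← integral_const_mul, ← integral_const_mul]
  have hmom : Integrable fun u => |u| ^ (k + 1) * |K u| := by
    simpa [abs_mul] using hK.moment_order.abs
  rw [← Real.norm_eq_abs]
  refine norm_integral_le_of_norm_le ((hmom.const_mul _).const_mul _) (ae_of_all _ fun u => ?_)
  have ht := abs_sub_taylor_le hm hC q (h * u)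
  have e : K u * m (q + h * u) - P u = K u * (m (q + h * u) -
      ∑ j ∈ Finset.range (k + 1), iteratedDeriv j m q / j.factorial * (h * u) ^ j) := by
    rw [hP, mul_sub, Finset.mul_sum]
    congr 1
    refine Finset.sum_congr rfl fun j _ => ?_
    rw [mul_pow]
    ring
  rw [e, Real.norm_eq_abs, abs_mul]
  calc |K u| * _ ≤ |K u| * (C * |h * u| ^ (k + 1)) := by gcongr
    _ = _ := by rw [abs_mul, abs_of_pos hh, mul_pow]; ring

/-- A shift of the evaluation point passes to `m`, whose Lipschitz constant gives a bound linear in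
`t` with no factor `1/h`. -/
lemma abs_integral_kernel_shift_le (hK : KernelAssumption K r) {m : ℝ → ℝ} {L : ℝ}
    (hm : ∀ y z, |m y - m z| ≤ L * |y - z|) (q t h : ℝ)
    (h1 : Integrable fun u => K u * m (q + t + h * u))
    (h2 : Integrable fun u => K u * m (q + h * u)) :
    |(∫ u, K u * m (q + t + h * u)) - ∫ u, K u * m (q + h * u)| ≤ L * |t| * ∫ u, |K u| := by
  rw [← integral_sub h1 h2, ← integral_const_mul, ← Real.norm_eq_abs]
  refine norm_integral_le_of_norm_le (hK.integrable.abs.const_mul _) (ae_of_all _ fun u => ?_)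
  rw [← mul_sub, Real.norm_eq_abs, abs_mul]
  have := hm (q + t + h * u) (q + h * u)
  have e : q + t + h * u - (q + h * u) = t := by ring
  rw [e] at this
  nlinarith [abs_nonneg (K u)]

end Kernel

/-! ### Oscillation of centred kernel sums in the evaluation point -/

section Fluctuation

variable {Ω E : Type*} [MeasurableSpace Ω] [MeasurableSpace E] {μ : Measure Ω}
  {Z : ℕ → Ω → E} {K : ℝ → ℝ} {r : ℕ}

/-- Second moments of kernel-weighted variables. -/
lemma integral_sq_kernel_le {φ : ℝ → ℝ} (hφ : Measurable φ) (hφ2 : Integrable fun u => φ u ^ 2)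
    {Y W : Ω → ℝ} (hY : Measurable Y) (hW : Measurable W) {M C : ℝ} (hC : 0 ≤ C)
    (hWM : ∀ ω, |W ω| ≤ M)
    (hdens : ∀ ψ : ℝ → ENNReal, Measurable ψ →
      ∫⁻ ω, ψ (Y ω) ∂μ ≤ ENNReal.ofReal C * ∫⁻ y, ψ y) (q : ℝ) {h : ℝ} (hh : 0 < h) :
    MemLp (fun ω => φ ((Y ω - q) / h) * W ω) 2 μ ∧
    ∫ ω, (φ ((Y ω - q) / h) * W ω) ^ 2 ∂μ ≤ M ^ 2 * C * h * ∫ u, φ u ^ 2 := by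
  have hmeas : Measurable fun ω => φ ((Y ω - q) / h) * W ω := by fun_prop
  have hlint : ∫⁻ ω, ENNReal.ofReal (φ ((Y ω - q) / h) ^ 2) ∂μ ≤
      ENNReal.ofReal (C * h * ∫ u, φ u ^ 2) := by
    refine (hdens (fun y => ENNReal.ofReal (φ ((y - q) / h) ^ 2)) (by fun_prop)).trans ?_
    rw [lintegral_comp_sub_div (fun u => ENNReal.ofReal (φ u ^ 2)) (by fun_prop) q hh,
      ← ofReal_integral_eq_lintegral_ofReal hφ2 (ae_of_all _ fun _ => sq_nonneg _),
      ENNReal.ofReal_mul (by positivity), ENNReal.ofReal_mul hC, mul_assoc]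
  have hle : ∫⁻ ω, ENNReal.ofReal ((φ ((Y ω - q) / h) * W ω) ^ 2) ∂μ ≤
      ENNReal.ofReal (M ^ 2 * C * h * ∫ u, φ u ^ 2) := by
    calc ∫⁻ ω, ENNReal.ofReal ((φ ((Y ω - q) / h) * W ω) ^ 2) ∂μ
        ≤ ∫⁻ ω, ENNReal.ofReal (M ^ 2) * ENNReal.ofReal (φ ((Y ω - q) / h) ^ 2) ∂μ := by
          refine lintegral_mono fun ω => ?_
          rw [← ENNReal.ofReal_mul (sq_nonneg M)]
          refine ENNReal.ofReal_le_ofReal ?_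
          rw [mul_pow, mul_comm]
          have : W ω ^ 2 ≤ M ^ 2 := sq_le_sq' (by linarith [abs_le.1 (hWM ω)]) (abs_le.1 (hWM ω)).2
          gcongr
      _ = ENNReal.ofReal (M ^ 2) * ∫⁻ ω, ENNReal.ofReal (φ ((Y ω - q) / h) ^ 2) ∂μ :=
          lintegral_const_mul _ (by fun_prop)
      _ ≤ ENNReal.ofReal (M ^ 2) * ENNReal.ofReal (C * h * ∫ u, φ u ^ 2) := by gcongr
      _ = _ := by rw [← ENNReal.ofReal_mul (sq_nonneg M)]; congr 1; ring
  have hnn : 0 ≤ M ^ 2 * C * h * ∫ u, φ u ^ 2 := by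
    have : 0 ≤ ∫ u, φ u ^ 2 := integral_nonneg fun _ => sq_nonneg _
    positivity
  constructor
  · rw [memLp_two_iff_integrable_sq hmeas.aestronglyMeasurable]
    refine ⟨(hmeas.pow_const 2).aestronglyMeasurable, ?_⟩
    rw [hasFiniteIntegral_iff_ofReal (ae_of_all _ fun _ => sq_nonneg _)]
    exact hle.trans_lt ENNReal.ofReal_lt_top
  · rw [integral_eq_lintegral_of_nonneg_ae (ae_of_all _ fun _ => sq_nonneg _)
      (hmeas.pow_const 2).aestronglyMeasurable]
    exact ENNReal.toReal_le_of_le_ofReal hnn hle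

/-- Stochastic equicontinuity of kernel sums in the evaluation point. -/
lemma exists_fluctuation_bound [IsProbabilityMeasure μ] (hmeas : ∀ i, Measurable (Z i)) (hindep : iIndepFun Z μ)
    (hident : ∀ i, IdentDistrib (Z i) (Z 0) μ μ) (hK : KernelAssumption K r)
    {y w : E → ℝ} (hy : Measurable y) (hw : Measurable w) {M C : ℝ} (hC : 0 ≤ C)
    (hwM : ∀ z, |w z| ≤ M)
    (hdens : ∀ ψ : ℝ → ENNReal, Measurable ψ →
      ∫⁻ ω, ψ (y (Z 0 ω)) ∂μ ≤ ENNReal.ofReal C * ∫⁻ y, ψ y)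
    (q : ℝ) {h : ℝ} (hh : 0 < h) (n : ℕ) (b : ℝ) :
    ∃ T : Ω → ENNReal, Measurable T ∧
      (∀ ω t, |t| ≤ b →
        ‖(∑ i ∈ Finset.range n, (K ((y (Z i ω) - (q + t)) / h) * w (Z i ω) -
            ∫ ω, K ((y (Z 0 ω) - (q + t)) / h) * w (Z 0 ω) ∂μ)) -
          ∑ i ∈ Finset.range n, (K ((y (Z i ω) - q) / h) * w (Z i ω) -
            ∫ ω, K ((y (Z 0 ω) - q) / h) * w (Z 0 ω) ∂μ)‖ₑ ≤ T ω) ∧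
      ∫⁻ ω, T ω ∂μ ≤ ENNReal.ofReal (2 * b) *
        ENNReal.ofReal √(n * (M ^ 2 * C * h⁻¹ * ∫ u, deriv K u ^ 2)) := by
  obtain ⟨CK, hCK0, hCK⟩ := hK.bdd
  obtain ⟨CD, hCD⟩ := hK.deriv_bdd
  have hKm := hK.continuous.measurable
  have hDc := hK.continuous_deriv
  have hDm := hDc.measurable
  have hZ0 := hmeas 0
  have hM : 0 ≤ M := by
    obtain ⟨ω⟩ : Nonempty Ω := nonempty_of_isProbabilityMeasure μ
    exact (abs_nonneg _).trans (hwM (Z 0 ω))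
  set k : ℝ → E → ℝ := fun t z => K ((y z - (q + t)) / h) * w z with hk
  set k' : ℝ → E → ℝ := fun t z => -h⁻¹ * deriv K ((y z - (q + t)) / h) * w z with hk'
  have hderiv : ∀ t z, HasDerivAt (fun t => k t z) (k' t z) t := by
    intro t z
    have h1 : HasDerivAt (fun t => (y z - (q + t)) / h) (-h⁻¹) t := by
      have := (((hasDerivAt_id t).const_add q).const_sub (y z)).div_const h
      simpa [neg_div, one_div] using this
    have h2 := ((hK.differentiable ((y z - (q + t)) / h)).hasDerivAt.comp t h1).mul_const (w z)
    refine h2.congr_deriv ?_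
    simp only [hk']
    ring
  have hk'c : ∀ z, Continuous fun t => k' t z := fun z => by simp only [hk']; fun_prop
  have hkm : Measurable (Function.uncurry k) := by
    simp only [hk, Function.uncurry_def]; fun_prop
  have hk'm : Measurable (Function.uncurry k') := by
    simp only [hk', Function.uncurry_def]; fun_prop
  have hkb : ∀ t z, |k t z| ≤ CK * M := fun t z => by
    simp only [hk, abs_mul]
    exact mul_le_mul (hCK _) (hwM z) (abs_nonneg _) hCK0
  have hCD0 : 0 ≤ CD := (abs_nonneg _).trans (hCD 0)
  have hk'b : ∀ t z, |k' t z| ≤ h⁻¹ * CD * M := fun t z => by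
    simp only [hk', abs_mul, abs_neg, abs_inv, abs_of_pos hh]
    have := hCD ((y z - (q + t)) / h)
    have := hwM z
    gcongr
  have hkt : ∀ t, Measurable (k t) := fun t => hkm.comp (measurable_const.prodMk measurable_id)
  have hk't : ∀ t, Measurable (k' t) := fun t => hk'm.comp (measurable_const.prodMk measurable_id)
  set a : ℝ → ℝ := fun t => ∫ ω, k t (Z 0 ω) ∂μ with ha
  set a' : ℝ → ℝ := fun t => ∫ ω, k' t (Z 0 ω) ∂μ with ha'
  have haderiv : ∀ t, HasDerivAt a (a' t) t := by
    intro t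
    refine (hasDerivAt_integral_of_dominated_loc_of_deriv_le (s := Set.univ)
      (bound := fun _ => h⁻¹ * CD * M) univ_mem
      (Eventually.of_forall fun t => ((hkt t).comp hZ0).aestronglyMeasurable)
      (Integrable.of_bound ((hkt t).comp hZ0).aestronglyMeasurable (CK * M)
        (ae_of_all _ fun ω => hkb _ _)) ((hk't t).comp hZ0).aestronglyMeasurable
      (ae_of_all _ fun ω t _ => hk'b t _) (integrable_const _)
      (ae_of_all _ fun ω t _ => hderiv t _)).2
  have ha'c : Continuous a' :=
    continuous_of_dominated (bound := fun _ => h⁻¹ * CD * M)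
      (fun t => ((hk't t).comp hZ0).aestronglyMeasurable)
      (fun t => ae_of_all _ fun ω => hk'b t _) (integrable_const _)
      (ae_of_all _ fun ω => hk'c _)
  have hjoint : Measurable (fun p : Ω × ℝ =>
      ∑ i ∈ Finset.range n, (k' p.2 (Z i p.1) - a' p.2)) := by
    refine Finset.measurable_sum _ fun i _ => Measurable.sub ?_ (ha'c.measurable.comp measurable_snd)
    exact hk'm.comp (measurable_snd.prodMk ((hmeas i).comp measurable_fst))
  -- The dominating variable is the integral over the window of the absolute derivative of the
  -- centred sum. It bounds all increments at once, and Tonelli reduces its mean to a second-moment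
  -- bound at each fixed `s`.
  refine ⟨fun ω => ∫⁻ s in Set.Icc (-b) b, ‖∑ i ∈ Finset.range n, (k' s (Z i ω) - a' s)‖ₑ,
    Measurable.lintegral_prod_right' (f := fun p : Ω × ℝ =>
      ‖∑ i ∈ Finset.range n, (k' p.2 (Z i p.1) - a' p.2)‖ₑ) hjoint.enorm, ?_, ?_⟩
  · intro ω t ht
    have := enorm_sub_le_lintegral_deriv
      (φ := fun t => ∑ i ∈ Finset.range n, (k t (Z i ω) - a t))
      (φ' := fun t => ∑ i ∈ Finset.range n, (k' t (Z i ω) - a' t))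
      (fun t => HasDerivAt.fun_sum fun i _ => (hderiv t _).sub (haderiv t))
      (continuous_finsetSum _ fun i _ => (hk'c _).sub ha'c) ht
    simpa [hk, ha] using this
  · rw [lintegral_lintegral_swap hjoint.enorm.aemeasurable]
    have hs : ∀ s, ∫⁻ ω, ‖∑ i ∈ Finset.range n, (k' s (Z i ω) - a' s)‖ₑ ∂μ ≤
        ENNReal.ofReal √(n * (M ^ 2 * C * h⁻¹ * ∫ u, deriv K u ^ 2)) := by
      intro s
      -- Differentiation gives the factor `h⁻¹`, hence `h⁻²` in the second moment; the kernel window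
      -- returns one factor `h`.
      have hsq := integral_sq_kernel_le (μ := μ) hDm hK.deriv_sq (hy.comp hZ0)
        (W := fun ω => -h⁻¹ * w (Z 0 ω)) (by fun_prop) hC (M := h⁻¹ * M)
        (fun ω => by
          rw [abs_mul, abs_neg, abs_inv, abs_of_pos hh]
          have := hwM (Z 0 ω)
          gcongr) hdens (q + s) hh
      have e : (fun ω => deriv K (((y ∘ Z 0) ω - (q + s)) / h) * (-h⁻¹ * w (Z 0 ω))) =
          fun ω => k' s (Z 0 ω) := by
        ext ω
        simp only [hk', Function.comp]
        ring
      have e2 : ∫ ω, (deriv K (((y ∘ Z 0) ω - (q + s)) / h) * (-h⁻¹ * w (Z 0 ω))) ^ 2 ∂μ =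
          ∫ ω, k' s (Z 0 ω) ^ 2 ∂μ := by
        congr 1
        ext ω
        rw [← congrFun e ω]
      rw [e, e2] at hsq
      refine (lintegral_enorm_sum_sub_le hindep hident (hk't s) hsq.1 n).trans ?_
      refine ENNReal.ofReal_le_ofReal (Real.sqrt_le_sqrt ?_)
      refine mul_le_mul_of_nonneg_left (hsq.2.trans_eq ?_) (by positivity)
      field_simp
    refine (lintegral_mono fun s => hs s).trans ?_
    rw [setLIntegral_const, Real.volume_Icc, mul_comm]
    gcongr
    linarith

end Fluctuation

end UQPE

namespace UQPE

/-! ### Quantiles of atomless laws -/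

section Quantile

variable (ρ : Measure ℝ) [IsProbabilityMeasure ρ]

lemma quantile_set_nonempty {η : ℝ} (hη : η < 1) : {y : ℝ | η ≤ ρ.real (Set.Iic y)}.Nonempty := by
  have h := (tendsto_cdf_atTop ρ).eventually_const_le hη
  obtain ⟨y, hy⟩ := h.exists
  exact ⟨y, by simpa [cdf_eq_real] using hy⟩

lemma quantile_set_bddBelow {η : ℝ} (hη : 0 < η) :
    BddBelow {y : ℝ | η ≤ ρ.real (Set.Iic y)} := by
  have h := (tendsto_cdf_atBot ρ).eventually_lt_const hη
  obtain ⟨y, hy⟩ := h.exists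
  refine ⟨y, fun z hz => ?_⟩
  by_contra hlt
  have := monotone_cdf ρ (not_le.1 hlt).le
  have hz' : η ≤ cdf ρ z := by rw [cdf_eq_real]; exact hz
  linarith

lemma quantile_mono {η η' : ℝ} (h0 : 0 < η) (h : η ≤ η') (h1 : η' < 1) :
    quantile ρ η ≤ quantile ρ η' :=
  csInf_le_csInf (quantile_set_bddBelow ρ h0) (quantile_set_nonempty ρ h1)
    fun _ hy => h.trans hy

/-- A distribution function without jumps takes the value `η` at the `η`-quantile. -/
lemma measureReal_Iic_quantile [NullSingletonClass ρ] {η : ℝ} (h0 : 0 < η) (h1 : η < 1) :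
    ρ.real (Set.Iic (quantile ρ η)) = η := by
  set q := quantile ρ η with hq
  rw [← cdf_eq_real]
  have hlt : ∀ y < q, cdf ρ y < η := by
    intro y hy
    by_contra hge
    have : η ≤ ρ.real (Set.Iic y) := by rw [← cdf_eq_real]; exact not_lt.1 hge
    exact absurd (csInf_le (quantile_set_bddBelow ρ h0) this) (not_le.2 hy)
  have hgt : ∀ y > q, η ≤ cdf ρ y := by
    intro y hy
    obtain ⟨z, hz, hzy⟩ := exists_lt_of_csInf_lt (quantile_set_nonempty ρ h1) hy
    have hz' : η ≤ cdf ρ z := by rw [cdf_eq_real]; exact hz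
    exact hz'.trans (monotone_cdf ρ hzy.le)
  apply le_antisymm
  · have hs : (cdf ρ).measure {q} = 0 := by rw [measure_cdf]; exact measure_singleton q
    -- Without an atom at `q` the distribution function does not exceed its left limit there, and
    -- that limit is at most `η`.
    rw [StieltjesFunction.measure_singleton, ENNReal.ofReal_eq_zero] at hs
    have hl : Function.leftLim (cdf ρ) q ≤ η :=
      le_of_tendsto ((monotone_cdf ρ).tendsto_leftLim q)
        (eventually_nhdsWithin_of_forall fun y hy => (hlt y hy).le)
    linarith
  · have hc : Tendsto (cdf ρ) (𝓝[>] q) (𝓝 (cdf ρ q)) :=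
      ((cdf ρ).right_continuous q).tendsto.mono_left (nhdsWithin_mono _ Set.Ioi_subset_Ici_self)
    exact ge_of_tendsto hc (eventually_nhdsWithin_of_forall fun y hy => hgt y hy)

end Quantile

/-! ### The matching function as a conditional distribution function -/

section Matching

variable {d : ℕ} {fYX : ℝ → (Fin (d + 1) → ℝ) → ℝ} {x : Fin (d + 1) → ℝ}

instance nullSingletonClass_withDensity_volume (f : ℝ → ENNReal) : NullSingletonClass (volume.withDensity f) :=
  ⟨fun y => withDensity_absolutelyContinuous _ _ (measure_singleton y)⟩

instance nullSingletonClass_condLaw : NullSingletonClass (condLaw fYX x) := nullSingletonClass_withDensity_volume _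

/-- The conditional law has a density, hence no atoms, so its distribution function recovers the
level of any quantile. In particular the match is unique whenever it exists. -/
lemma eq_of_mem_matchingSet [IsProbabilityMeasure (condLaw fYX x)] {q η : ℝ}
    (hη : η ∈ matchingSet fYX q x) : η = (condLaw fYX x).real (Set.Iic q) := by
  obtain ⟨⟨h0, h1⟩, rfl⟩ := hη
  exact (measureReal_Iic_quantile _ h0 h1).symm

lemma matching_eq_of_mem [IsProbabilityMeasure (condLaw fYX x)] {q η : ℝ}
    (hη : η ∈ matchingSet fYX q x) : matching fYX q x = η := by
  have : matchingSet fYX q x = {η} := by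
    ext η'
    constructor
    · intro h
      rw [Set.mem_singleton_iff, eq_of_mem_matchingSet h, eq_of_mem_matchingSet hη]
    · rintro rfl
      exact hη
  rw [matching, this, csInf_singleton]

end Matching

/-! ### Consequences of the density assumptions -/

section Densities

lemma setLIntegral_eq_lintegral_mul_indicator {s : Set ℝ} (hs : MeasurableSet s)
    (φ : ℝ → ENNReal) : ∫⁻ y in s, φ y = ∫⁻ y, φ y * s.indicator (fun _ => 1) y := by
  rw [← lintegral_indicator hs]
  refine lintegral_congr fun y => ?_
  by_cases hy : y ∈ s <;> simp [hy]

variable {Ω : Type*} [MeasurableSpace Ω] {μ : Measure Ω} {d : ℕ}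
  {X : Ω → Fin (d + 1) → ℝ} {Y : Ω → ℝ} {ν : Measure (Fin (d + 1) → ℝ)}
  {fYX : ℝ → (Fin (d + 1) → ℝ) → ℝ} {fX : (Fin (d + 1) → ℝ) → ℝ} {fY : ℝ → ℝ}

lemma ae_mem_support (hX : Measurable X) : ∀ᵐ ω ∂μ, X ω ∈ (μ.map X).support :=
  ae_of_ae_map hX.aemeasurable Measure.support_mem_ae

lemma AreDensities.lintegral_fY_eq (hd : AreDensities μ X Y ν fYX fX fY) (hY : Measurable Y)
    {φ : ℝ → ENNReal} (hφ : Measurable φ) :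
    ∫⁻ ω, φ (Y ω) ∂μ = ∫⁻ y, ENNReal.ofReal (fY y) * φ y := by
  rw [← lintegral_map hφ hY, hd.law_Y,
    lintegral_withDensity_eq_lintegral_mul _ (by have := hd.measurable_fY; fun_prop) hφ]
  rfl

lemma AreDensities.integral_fY_eq (hd : AreDensities μ X Y ν fYX fX fY) (hY : Measurable Y)
    {φ : ℝ → ℝ} (hφ : Measurable φ) :
    ∫ ω, φ (Y ω) ∂μ = ∫ y, φ y * fY y := by
  rw [← integral_map hY.aemeasurable hφ.aestronglyMeasurable, hd.law_Y,
    integral_withDensity_eq_integral_toReal_smul (by have := hd.measurable_fY; fun_prop)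
      (ae_of_all _ fun _ => ENNReal.ofReal_lt_top)]
  congr 1
  ext y
  rw [ENNReal.toReal_ofReal (hd.fY_nonneg y), smul_eq_mul, mul_comm]

variable [IsProbabilityMeasure μ]

lemma AreDensities.lintegral_joint (hd : AreDensities μ X Y ν fYX fX fY) (hX : Measurable X)
    (hY : Measurable Y) {F : ℝ → (Fin (d + 1) → ℝ) → ENNReal}
    (hF : Measurable (Function.uncurry F)) :
    ∫⁻ ω, F (Y ω) (X ω) ∂μ =
      ∫⁻ x, ∫⁻ y, ENNReal.ofReal (fYX y x) * F y x ∂(volume : Measure ℝ) ∂(μ.map X) := by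
  have : IsProbabilityMeasure (μ.map X) := Measure.isProbabilityMeasure_map hX.aemeasurable
  have hf := hd.measurable_fYX
  have h1 : ∫⁻ p, Function.uncurry F p ∂(μ.map fun ω => (Y ω, X ω)) = ∫⁻ ω, F (Y ω) (X ω) ∂μ :=
    lintegral_map hF (hY.prodMk hX)
  have hf' : Measurable fun p : ℝ × (Fin (d + 1) → ℝ) => ENNReal.ofReal (fYX p.1 p.2) :=
    ENNReal.measurable_ofReal.comp hf
  rw [← h1, hd.joint, lintegral_withDensity_eq_lintegral_mul _ hf' hF,
    lintegral_prod_symm _ (hf'.mul hF).aemeasurable]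
  rfl

/-- Given `X = x`, the event has probability `η`, because `x ⬝ᵥ b` is the conditional `η`-quantile
of an atomless law. This centres the quantile regression score against every weight in `X`. -/
lemma AreDensities.lintegral_indicator_quantile (hd : AreDensities μ X Y ν fYX fX fY)
    (hX : Measurable X) (hY : Measurable Y) {φ : (Fin (d + 1) → ℝ) → ENNReal} (hφ : Measurable φ)
    {η : ℝ} (h0 : 0 < η) (h1 : η < 1) {b : Fin (d + 1) → ℝ}
    (hb : ∀ x ∈ (μ.map X).support, quantile (condLaw fYX x) η = x ⬝ᵥ b) :
    ∫⁻ ω, (if Y ω ≤ X ω ⬝ᵥ b then 1 else 0) * φ (X ω) ∂μ =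
      ENNReal.ofReal η * ∫⁻ ω, φ (X ω) ∂μ := by
  have hdot : Measurable fun x : Fin (d + 1) → ℝ => x ⬝ᵥ b := by
    unfold dotProduct; fun_prop
  have hset : MeasurableSet {p : ℝ × (Fin (d + 1) → ℝ) | p.1 ≤ p.2 ⬝ᵥ b} :=
    measurableSet_le measurable_fst (hdot.comp measurable_snd)
  have hF : Measurable (Function.uncurry fun (y : ℝ) (x : Fin (d + 1) → ℝ) =>
      (if y ≤ x ⬝ᵥ b then (1 : ENNReal) else 0) * φ x) :=
    (Measurable.ite hset measurable_const measurable_const).mul (hφ.comp measurable_snd)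
  rw [hd.lintegral_joint hX hY hF]
  have hφX : ∫⁻ ω, φ (X ω) ∂μ = ∫⁻ x, φ x ∂(μ.map X) := (lintegral_map hφ hX).symm
  rw [hφX, ← lintegral_const_mul _ hφ]
  refine lintegral_congr_ae ?_
  filter_upwards [Measure.support_mem_ae (μ := μ.map X)] with x hx
  have hp := hd.fYX_prob x hx
  have hfx : Measurable fun y => fYX y x := hd.measurable_fYX.comp (measurable_id.prodMk measurable_const)
  have h2 : condLaw fYX x (Set.Iic (x ⬝ᵥ b)) = ENNReal.ofReal η := by
    rw [← hb x hx, ← ofReal_measureReal, measureReal_Iic_quantile _ h0 h1]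
  rw [← h2, condLaw, withDensity_apply _ measurableSet_Iic, ← lintegral_indicator measurableSet_Iic,
    ← lintegral_mul_const _ (by
      exact (Measurable.indicator (by fun_prop) measurableSet_Iic))]
  refine lintegral_congr fun y => ?_
  by_cases hy : y ≤ x ⬝ᵥ b
  · simp [hy]
  · simp [hy]

/-- Expectations of products are dominated through a bound for the conditional density. -/
lemma AreDensities.lintegral_mul_le (hd : AreDensities μ X Y ν fYX fX fY) (hX : Measurable X)
    (hY : Measurable Y) {C : ℝ} (hC : ∀ x ∈ (μ.map X).support, ∀ y, fYX y x ≤ C)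
    {φ : ℝ → ENNReal} (hφ : Measurable φ) {ψ : (Fin (d + 1) → ℝ) → ENNReal} (hψ : Measurable ψ) :
    ∫⁻ ω, φ (Y ω) * ψ (X ω) ∂μ ≤ ENNReal.ofReal C * (∫⁻ y, φ y) * ∫⁻ ω, ψ (X ω) ∂μ := by
  rw [hd.lintegral_joint hX hY (F := fun y x => φ y * ψ x)
    ((hφ.comp measurable_fst).mul (hψ.comp measurable_snd)), ← lintegral_map hψ hX,
    ← lintegral_const_mul _ hψ]
  refine lintegral_mono_ae ?_
  filter_upwards [Measure.support_mem_ae (μ := μ.map X)] with x hx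
  calc ∫⁻ y, ENNReal.ofReal (fYX y x) * (φ y * ψ x)
      ≤ ∫⁻ y, ENNReal.ofReal C * φ y * ψ x := by
        refine lintegral_mono fun y => ?_
        rw [← mul_assoc]
        gcongr
        exact hC x hx y
    _ = _ := by
        rw [lintegral_mul_const _ (by fun_prop), lintegral_const_mul _ hφ]

lemma AreDensities.lintegral_le (hd : AreDensities μ X Y ν fYX fX fY) (hX : Measurable X)
    (hY : Measurable Y) {C : ℝ} (hC : ∀ x ∈ (μ.map X).support, ∀ y, fYX y x ≤ C)
    {φ : ℝ → ENNReal} (hφ : Measurable φ) :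
    ∫⁻ ω, φ (Y ω) ∂μ ≤ ENNReal.ofReal C * ∫⁻ y, φ y := by
  have := hd.lintegral_mul_le hX hY hC hφ (ψ := fun _ => 1) measurable_const
  simpa using this

/-- Integration over measurable sets gives the bound almost everywhere. Continuity extends it to
every point, since a nonempty open set has positive Lebesgue measure. -/
lemma AreDensities.fY_le (hd : AreDensities μ X Y ν fYX fX fY) (hX : Measurable X)
    (hY : Measurable Y) {C : ℝ} (hC0 : 0 ≤ C) (hC : ∀ x ∈ (μ.map X).support, ∀ y, fYX y x ≤ C)
    (hc : Continuous fY) (y : ℝ) : fY y ≤ C := by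
  have hm := hd.measurable_fY
  have hae : (fun y => ENNReal.ofReal (fY y)) ≤ᵐ[volume] fun _ => ENNReal.ofReal C := by
    refine ae_le_of_forall_setLIntegral_le_of_sigmaFinite (by fun_prop) fun s hs _ => ?_
    have h1 := hd.lintegral_le hX hY hC (φ := s.indicator fun _ => 1)
      (measurable_const.indicator hs)
    rw [hd.lintegral_fY_eq hY (measurable_const.indicator hs), lintegral_indicator hs] at h1
    rw [setLIntegral_eq_lintegral_mul_indicator hs]
    refine h1.trans_eq ?_
    simp
  by_contra hlt
  have hopen : IsOpen {y | C < fY y} := isOpen_lt continuous_const hc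
  have hnull : volume {y | C < fY y} = 0 := by
    refine measure_mono_null (fun z hz => ?_) hae
    simp only [Set.mem_compl_iff, Set.mem_ofPred_eq, not_le]
    exact (ENNReal.ofReal_lt_ofReal_iff_of_nonneg hC0).2 hz
  rw [hopen.measure_eq_zero_iff volume] at hnull
  exact (hnull ▸ (show y ∈ {y | C < fY y} from not_le.1 hlt) : y ∈ (∅ : Set ℝ))

/-- The density of `Y` is positive where almost every conditional density is positive and
continuous. -/
lemma AreDensities.fY_pos (hd : AreDensities μ X Y ν fYX fX fY) (hX : Measurable X)
    (hY : Measurable Y) (hc : Continuous fY)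
    (hcx : ∀ x ∈ (μ.map X).support, Continuous fun y => fYX y x * fX x) {q : ℝ}
    (hpos : ∀ x ∈ (μ.map X).support, 0 < fYX q x) : 0 < fY q := by
  have hP : IsProbabilityMeasure (μ.map X) := Measure.isProbabilityMeasure_map hX.aemeasurable
  have hm := hd.measurable_fY
  have hf' : Measurable fun p : ℝ × (Fin (d + 1) → ℝ) => ENNReal.ofReal (fYX p.1 p.2) :=
    ENNReal.measurable_ofReal.comp hd.measurable_fYX
  have hfX : ∀ᵐ x ∂(μ.map X), 0 < fX x := by
    rw [hd.law_X, ae_withDensity_iff (by have := hd.measurable_fX; fun_prop)]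
    refine ae_of_all _ fun x hx => ?_
    by_contra hle
    exact hx (ENNReal.ofReal_of_nonpos (not_lt.1 hle))
  have hae : (fun y => ENNReal.ofReal (fY y)) =ᵐ[volume]
      fun y => ∫⁻ x, ENNReal.ofReal (fYX y x) ∂(μ.map X) := by
    refine ae_eq_of_forall_setLIntegral_eq_of_sigmaFinite (by fun_prop) ?_ fun s hs _ => ?_
    · exact Measurable.lintegral_prod_right' hf'
    · have h1 := hd.lintegral_joint hX hY (F := fun y _ => s.indicator (fun _ => 1) y)
        ((measurable_const.indicator hs).comp measurable_fst)
      rw [hd.lintegral_fY_eq hY (measurable_const.indicator hs)] at h1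
      rw [setLIntegral_eq_lintegral_mul_indicator hs, h1,
        lintegral_lintegral_swap (μ := volume.restrict s) hf'.aemeasurable]
      simp_rw [setLIntegral_eq_lintegral_mul_indicator hs]
  -- The mixture formula for `fY` holds only almost everywhere, so `q` is approached through points
  -- where it is valid. Fatou's lemma then bounds `∫ fYX q x` over the law of `X` by `fY q`.
  have hdense := Measure.dense_of_ae hae
  obtain ⟨u, hu, hulim⟩ := mem_closure_iff_seq_limit.1 (hdense q)
  have hfu : ∀ k, Measurable fun x => ENNReal.ofReal (fYX (u k) x) :=
    fun k => hf'.comp (measurable_const.prodMk measurable_id)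
  have hfatou := lintegral_liminf_le (μ := μ.map X) (u := atTop)
    (f := fun k x => ENNReal.ofReal (fYX (u k) x))
    hfu
  have hlim : Tendsto (fun k => ENNReal.ofReal (fY (u k))) atTop (𝓝 (ENNReal.ofReal (fY q))) :=
    (ENNReal.continuous_ofReal.tendsto _).comp ((hc.tendsto q).comp hulim)
  have hlim' : liminf (fun k => ∫⁻ x, ENNReal.ofReal (fYX (u k) x) ∂(μ.map X)) atTop =
      ENNReal.ofReal (fY q) := by
    rw [← hlim.liminf_eq]
    congr 1
    ext k
    exact (hu k).symm
  rw [hlim'] at hfatou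
  by_contra hle
  rw [ENNReal.ofReal_of_nonpos (not_lt.1 hle), nonpos_iff_eq_zero, lintegral_eq_zero_iff
    (Measurable.liminf hfu)] at hfatou
  have hfalse : ∀ᵐ x ∂(μ.map X), False := by
    filter_upwards [hfatou, hfX, Measure.support_mem_ae (μ := μ.map X)] with x h0 hx hs
    -- Smoothness is assumed for the joint density; dividing by `fX x`, positive for almost every
    -- `x`, transfers continuity to the conditional density.
    have hcont : Continuous fun y => fYX y x := by
      have := (hcx x hs).div_const (fX x)
      refine this.congr fun y => ?_
      field_simp
    have ht : Tendsto (fun k => ENNReal.ofReal (fYX (u k) x)) atTop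
        (𝓝 (ENNReal.ofReal (fYX q x))) :=
      (ENNReal.continuous_ofReal.tendsto _).comp ((hcont.tendsto q).comp hulim)
    rw [ht.liminf_eq, Pi.zero_apply, ENNReal.ofReal_eq_zero] at h0
    exact absurd (hpos x hs) (not_lt.2 h0)
  rw [eventually_false_iff_eq_bot, ae_eq_bot] at hfalse
  exact IsProbabilityMeasure.ne_zero _ hfalse

end Densities

end UQPE

namespace UQPE

/-! ### Dyadic chaining -/

section Chaining

/-- Dyadic chaining: values on a dyadic grid are controlled by the increments of all coarser
levels. -/
lemma abs_dyadic_le (H : ℝ → ℝ) (a c : ℝ) (k j : ℕ) (hj : j ≤ 2 ^ k) :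
    |H (a + c * (j / 2 ^ k))| ≤ |H a| + ∑ l ∈ Finset.range (k + 1),
      √(∑ i ∈ Finset.range (2 ^ l),
        (H (a + c * ((i + 1 : ℕ) / 2 ^ l)) - H (a + c * (i / 2 ^ l))) ^ 2) := by
  have hstep : ∀ k i : ℕ, i < 2 ^ k →
      |H (a + c * ((i + 1 : ℕ) / 2 ^ k))| ≤ |H (a + c * (i / 2 ^ k))| +
        √(∑ i ∈ Finset.range (2 ^ k),
          (H (a + c * ((i + 1 : ℕ) / 2 ^ k)) - H (a + c * (i / 2 ^ k))) ^ 2) := by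
    intro k i hi
    have h1 : |H (a + c * ((i + 1 : ℕ) / 2 ^ k)) - H (a + c * (i / 2 ^ k))| ≤
        √(∑ i ∈ Finset.range (2 ^ k),
          (H (a + c * ((i + 1 : ℕ) / 2 ^ k)) - H (a + c * (i / 2 ^ k))) ^ 2) := by
      refine Real.abs_le_sqrt ?_
      exact Finset.single_le_sum
        (f := fun i : ℕ => (H (a + c * ((i + 1 : ℕ) / 2 ^ k)) - H (a + c * (i / 2 ^ k))) ^ 2)
        (fun _ _ => sq_nonneg _) (Finset.mem_range.2 hi)
    have h2 := abs_sub_abs_le_abs_sub (H (a + c * ((i + 1 : ℕ) / 2 ^ k))) (H (a + c * (i / 2 ^ k)))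
    linarith
  induction k generalizing j with
  | zero =>
    have hj' : j = 0 ∨ j = 1 := by simp at hj; omega
    rcases hj' with rfl | rfl
    · simp only [Nat.cast_zero, zero_div, mul_zero, add_zero, le_add_iff_nonneg_right]
      exact Finset.sum_nonneg fun _ _ => Real.sqrt_nonneg _
    · have := hstep 0 0 (by norm_num)
      simpa using this
  | succ k ih =>
    rw [Finset.sum_range_succ, ← add_assoc]
    have hcoarse : ∀ i : ℕ, ((2 * i : ℕ) : ℝ) / 2 ^ (k + 1) = i / 2 ^ k := by
      intro i
      rw [pow_succ]
      push_cast
      field_simp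
    -- An even index already belongs to the coarser grid; an odd one costs a single increment of the
    -- new level.
    rcases Nat.even_or_odd' j with ⟨i, rfl | rfl⟩
    · rw [hcoarse]
      have := ih i (by rw [pow_succ] at hj; omega)
      have h0 := Real.sqrt_nonneg (∑ i ∈ Finset.range (2 ^ (k + 1)),
        (H (a + c * ((i + 1 : ℕ) / 2 ^ (k + 1))) - H (a + c * (i / 2 ^ (k + 1)))) ^ 2)
      linarith
    · have h1 := hstep (k + 1) (2 * i) (by omega)
      rw [hcoarse] at h1
      have := ih i (by rw [pow_succ] at hj; omega)
      linarith

lemma exists_dyadic_between {a c η : ℝ} (hc : 0 < c) (h : η ∈ Set.Icc a (a + c)) (k : ℕ) :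
    ∃ j : ℕ, j + 1 ≤ 2 ^ k ∧ a + c * (j / 2 ^ k) ≤ η ∧ η ≤ a + c * ((j + 1 : ℕ) / 2 ^ k) := by
  set t : ℝ := (η - a) / c * 2 ^ k with ht
  have hη : η = a + c * (t / 2 ^ k) := by rw [ht]; field_simp; ring
  have ht0 : 0 ≤ t := by
    have : 0 ≤ η - a := by linarith [h.1]
    positivity
  have ht1 : t ≤ 2 ^ k := by
    have : (η - a) / c ≤ 1 := by rw [div_le_one hc]; linarith [h.2]
    rw [ht]
    nlinarith [show (0 : ℝ) < 2 ^ k by positivity]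
  rcases ht1.lt_or_eq with hlt | heq
  · refine ⟨⌊t⌋₊, ?_, ?_, ?_⟩
    · have : ((⌊t⌋₊ : ℕ) : ℝ) < ((2 ^ k : ℕ) : ℝ) := by
        push_cast
        exact (Nat.floor_le ht0).trans_lt hlt
      exact_mod_cast this
    · rw [hη]
      have := Nat.floor_le ht0
      gcongr
    · rw [hη]
      have := (Nat.lt_floor_add_one t).le
      push_cast
      gcongr
  · have hpos : 1 ≤ 2 ^ k := Nat.one_le_two_pow
    have hsub : 2 ^ k - 1 + 1 = 2 ^ k := by omega
    -- At the right endpoint the floor would give `j = 2 ^ k`, which has no successor on the grid,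
    -- so the last cell is used.
    refine ⟨2 ^ k - 1, by omega, ?_, ?_⟩
    · rw [hη, heq]
      have : ((2 ^ k - 1 : ℕ) : ℝ) ≤ 2 ^ k := by
        have : (2 ^ k - 1 : ℕ) ≤ 2 ^ k := by omega
        exact_mod_cast this
      gcongr
    · rw [hη, heq, hsub]
      push_cast
      exact le_rfl

end Chaining

/-! ### A maximal inequality for the weighted empirical process -/

section WeightedEmpirical

variable {Ω E : Type*} [MeasurableSpace Ω] [MeasurableSpace E] {μ : Measure Ω}
  [IsProbabilityMeasure μ] {Z : ℕ → Ω → E}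

/-- Jensen's inequality for the square root; it turns the summed squared increments of one chaining
level into a first-moment bound. -/
lemma integral_sqrt_le {g : Ω → ℝ} (hg0 : ∀ ω, 0 ≤ g ω) (hg : Integrable g μ) :
    Integrable (fun ω => √(g ω)) μ ∧ ∫ ω, √(g ω) ∂μ ≤ √(∫ ω, g ω ∂μ) := by
  have hm : AEStronglyMeasurable (fun ω => √(g ω)) μ :=
    Real.continuous_sqrt.comp_aestronglyMeasurable hg.1
  have h2 : MemLp (fun ω => √(g ω)) 2 μ := by
    rw [memLp_two_iff_integrable_sq hm]
    simpa [Real.sq_sqrt (hg0 _)] using hg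
  refine ⟨h2.integrable (by norm_num), ?_⟩
  have := integral_abs_le_sqrt h2
  simpa [Real.sq_sqrt (hg0 _), abs_of_nonneg (Real.sqrt_nonneg _)] using this

/-- A maximal inequality for the weighted uniform empirical process
`η ↦ ∑ (η - 1{i ∈ A(η)}) w_i`, with nonnegative weights and a monotone family of events. -/
lemma exists_sup_weighted_empirical_le (hmeas : ∀ i, Measurable (Z i)) (hindep : iIndepFun Z μ)
    (hident : ∀ i, IdentDistrib (Z i) (Z 0) μ μ) {w : E → ℝ} (hw : Measurable w)
    (hw0 : ∀ z, 0 ≤ w z) (hw2 : MemLp (fun ω => w (Z 0 ω)) 2 μ) {a c : ℝ} (ha : 0 ≤ a)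
    (hc : 0 < c) (hac : a + c ≤ 1) {I : ℝ → E → ℝ} (hI : ∀ η, Measurable (I η))
    (hI01 : ∀ η z, I η z = 0 ∨ I η z = 1) {G : Set E} (hG : ∀ i, ∀ᵐ ω ∂μ, Z i ω ∈ G)
    (hmono : ∀ z ∈ G, ∀ η ∈ Set.Icc a (a + c), ∀ η' ∈ Set.Icc a (a + c), η ≤ η' → I η z ≤ I η' z)
    (h1 : ∀ η ∈ Set.Icc a (a + c),
      ∫ ω, I η (Z 0 ω) * w (Z 0 ω) ∂μ = η * ∫ ω, w (Z 0 ω) ∂μ)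
    (h2 : ∀ η ∈ Set.Icc a (a + c),
      ∫ ω, I η (Z 0 ω) * w (Z 0 ω) ^ 2 ∂μ = η * ∫ ω, w (Z 0 ω) ^ 2 ∂μ) (n k : ℕ) :
    ∃ T : Ω → ℝ, Integrable T μ ∧ (∀ ω, 0 ≤ T ω) ∧
      (∀ᵐ ω ∂μ, ∀ η ∈ Set.Icc a (a + c),
        |∑ i ∈ Finset.range n, (η - I η (Z i ω)) * w (Z i ω)| ≤ T ω) ∧
      ∫ ω, T ω ∂μ ≤ (k + 2) * √(n * ∫ ω, w (Z 0 ω) ^ 2 ∂μ) +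
        n / 2 ^ k * √(∫ ω, w (Z 0 ω) ^ 2 ∂μ) := by
  set B := ∫ ω, w (Z 0 ω) ^ 2 ∂μ with hB
  have hB0 : 0 ≤ B := integral_nonneg fun _ => sq_nonneg _
  have hwZ : ∀ i, MemLp (fun ω => w (Z i ω)) 2 μ := fun i => ((hident i).comp hw).memLp_iff.2 hw2
  have hwi : ∀ i, Integrable (fun ω => w (Z i ω)) μ := fun i => (hwZ i).integrable (by norm_num)
  have hwsq : Integrable (fun ω => w (Z 0 ω) ^ 2) μ := hw2.integrable_sq
  have hIabs : ∀ η z, |I η z| ≤ 1 := fun η z => by rcases hI01 η z with h | h <;> simp [h]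
  have hIw : ∀ η, Integrable (fun ω => I η (Z 0 ω) * w (Z 0 ω)) μ := fun η =>
    (hwi 0).bdd_mul (c := 1) ((hI η).comp (hmeas 0)).aestronglyMeasurable
      (ae_of_all _ fun ω => hIabs η _)
  have hIwsq : ∀ η, Integrable (fun ω => I η (Z 0 ω) * w (Z 0 ω) ^ 2) μ := fun η =>
    hwsq.bdd_mul (c := 1) ((hI η).comp (hmeas 0)).aestronglyMeasurable
      (ae_of_all _ fun ω => hIabs η _)
  -- moments of increments
  have hincr : ∀ η ∈ Set.Icc a (a + c), ∀ η' ∈ Set.Icc a (a + c), η ≤ η' →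
      Integrable (fun ω => (∑ i ∈ Finset.range n, (η' - I η' (Z i ω)) * w (Z i ω) -
        ∑ i ∈ Finset.range n, (η - I η (Z i ω)) * w (Z i ω)) ^ 2) μ ∧
      ∫ ω, (∑ i ∈ Finset.range n, (η' - I η' (Z i ω)) * w (Z i ω) -
        ∑ i ∈ Finset.range n, (η - I η (Z i ω)) * w (Z i ω)) ^ 2 ∂μ ≤ n * ((η' - η) * B) := by
    intro η hη η' hη' hle
    set f : E → ℝ := fun z => ((η' - η) - (I η' z - I η z)) * w z with hf
    have hfm : Measurable f := by have := hI η; have := hI η'; fun_prop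
    have hfL : MemLp (fun ω => f (Z 0 ω)) 2 μ := by
      refine hw2.of_le_mul (c := 3) (hfm.comp (hmeas 0)).aestronglyMeasurable
        (ae_of_all _ fun ω => ?_)
      simp only [hf, norm_mul, Real.norm_eq_abs]
      refine mul_le_mul_of_nonneg_right ?_ (abs_nonneg _)
      have e1 := abs_le.1 (hIabs η (Z 0 ω))
      have e2 := abs_le.1 (hIabs η' (Z 0 ω))
      rw [abs_le]
      constructor <;> linarith [hη.1, hη.2, hη'.1, hη'.2, e1.1, e1.2, e2.1, e2.2]
    have hmean : ∫ ω, f (Z 0 ω) ∂μ = 0 := by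
      have e : (fun ω => f (Z 0 ω)) = fun ω => (η' - η) * w (Z 0 ω) -
          (I η' (Z 0 ω) * w (Z 0 ω) - I η (Z 0 ω) * w (Z 0 ω)) := by
        ext ω; simp only [hf]; ring
      rw [e, integral_sub ((hwi 0).const_mul _) (by exact (hIw η').sub (hIw η)),
        integral_sub (hIw η') (hIw η),
        integral_const_mul, h1 η hη, h1 η' hη']
      ring
    -- By monotonicity the increment of the indicator is again zero or one, so it equals its square.
    -- With `Δ = η' - η` the second moment is `(Δ - Δ²) B`, linear in `Δ` to leading order.
    have hsq : ∫ ω, f (Z 0 ω) ^ 2 ∂μ ≤ (η' - η) * B := by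
      have e : (fun ω => f (Z 0 ω) ^ 2) =ᵐ[μ] fun ω => (η' - η) ^ 2 * w (Z 0 ω) ^ 2 +
          (1 - 2 * (η' - η)) * (I η' (Z 0 ω) * w (Z 0 ω) ^ 2 - I η (Z 0 ω) * w (Z 0 ω) ^ 2) := by
        filter_upwards [hG 0] with ω hω
        have hm := hmono _ hω η hη η' hη' hle
        have hD : (I η' (Z 0 ω) - I η (Z 0 ω)) ^ 2 = I η' (Z 0 ω) - I η (Z 0 ω) := by
          rcases hI01 η (Z 0 ω) with h | h <;> rcases hI01 η' (Z 0 ω) with h' | h' <;>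
            rw [h, h'] at hm ⊢ <;> linarith
        have : f (Z 0 ω) ^ 2 = ((η' - η) ^ 2 - 2 * (η' - η) * (I η' (Z 0 ω) - I η (Z 0 ω)) +
            (I η' (Z 0 ω) - I η (Z 0 ω)) ^ 2) * w (Z 0 ω) ^ 2 := by simp only [hf]; ring
        rw [this, hD]
        ring
      rw [integral_congr_ae e, integral_add (hwsq.const_mul _)
        (by exact ((hIwsq η').sub (hIwsq η)).const_mul _), integral_const_mul, integral_const_mul,
        integral_sub (hIwsq η') (hIwsq η), h2 η hη, h2 η' hη', ← hB]
      nlinarith [mul_nonneg (sq_nonneg (η' - η)) hB0]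
    have key := integral_sq_sum_sub_le hindep hident hfm hfL n
    rw [hmean] at key
    have e : (fun ω => ∑ i ∈ Finset.range n, (f (Z i ω) - 0)) = fun ω =>
        ∑ i ∈ Finset.range n, (η' - I η' (Z i ω)) * w (Z i ω) -
        ∑ i ∈ Finset.range n, (η - I η (Z i ω)) * w (Z i ω) := by
      ext ω
      rw [← Finset.sum_sub_distrib]
      refine Finset.sum_congr rfl fun i _ => ?_
      simp only [hf]; ring
    have e' : ∀ ω, ∑ i ∈ Finset.range n, (f (Z i ω) - 0) =
        ∑ i ∈ Finset.range n, (η' - I η' (Z i ω)) * w (Z i ω) -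
        ∑ i ∈ Finset.range n, (η - I η (Z i ω)) * w (Z i ω) := congrFun e
    rw [e] at key
    simp_rw [e'] at key
    refine ⟨key.1.integrable_sq, key.2.trans ?_⟩
    gcongr
  set H : Ω → ℝ → ℝ := fun ω η => ∑ i ∈ Finset.range n, (η - I η (Z i ω)) * w (Z i ω) with hH
  have hpt : ∀ l i : ℕ, i ≤ 2 ^ l → a + c * ((i : ℝ) / 2 ^ l) ∈ Set.Icc a (a + c) := by
    intro l i hi
    have h0 : (0 : ℝ) ≤ i / 2 ^ l := by positivity
    have h1 : (i : ℝ) / 2 ^ l ≤ 1 := by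
      rw [div_le_one (by positivity)]
      exact_mod_cast hi
    constructor <;> nlinarith
  set Q : ℕ → Ω → ℝ := fun l ω => √(∑ i ∈ Finset.range (2 ^ l),
    (H ω (a + c * ((i + 1 : ℕ) / 2 ^ l)) - H ω (a + c * (i / 2 ^ l))) ^ 2) with hQ
  -- The `2 ^ l` squared increments of level `l` have means at most `n c B / 2 ^ l`, so they add up
  -- to at most `n B` at every level, because `c ≤ 1`. Each level thus costs the same `√(n B)`.
  have hQint : ∀ l, Integrable (Q l) μ ∧ ∫ ω, Q l ω ∂μ ≤ √(n * B) := by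
    intro l
    have hi : ∀ i ∈ Finset.range (2 ^ l), Integrable (fun ω =>
        (H ω (a + c * ((i + 1 : ℕ) / 2 ^ l)) - H ω (a + c * (i / 2 ^ l))) ^ 2) μ ∧
        ∫ ω, (H ω (a + c * ((i + 1 : ℕ) / 2 ^ l)) - H ω (a + c * (i / 2 ^ l))) ^ 2 ∂μ ≤
          n * (c / 2 ^ l * B) := by
      intro i hi
      have hi' := Finset.mem_range.1 hi
      have := hincr _ (hpt l i hi'.le) _ (hpt l (i + 1) hi') (by push_cast; gcongr; linarith)
      refine ⟨this.1, this.2.trans_eq ?_⟩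
      push_cast
      ring
    have := integral_sqrt_le (μ := μ) (g := fun ω => ∑ i ∈ Finset.range (2 ^ l),
      (H ω (a + c * ((i + 1 : ℕ) / 2 ^ l)) - H ω (a + c * (i / 2 ^ l))) ^ 2)
      (fun ω => Finset.sum_nonneg fun _ _ => sq_nonneg _)
      (integrable_finsetSum _ fun i h => (hi i h).1)
    refine ⟨this.1, this.2.trans (Real.sqrt_le_sqrt ?_)⟩
    rw [integral_finsetSum _ fun i h => (hi i h).1]
    refine (Finset.sum_le_sum fun i h => (hi i h).2).trans ?_
    rw [Finset.sum_const, Finset.card_range, nsmul_eq_mul]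
    push_cast
    have : (2 : ℝ) ^ l * (n * (c / 2 ^ l * B)) = c * (n * B) := by field_simp
    rw [this]
    have h0 : 0 ≤ n * B := by positivity
    nlinarith
  have hHa : Integrable (fun ω => |H ω a|) μ ∧ ∫ ω, |H ω a| ∂μ ≤ √(n * B) := by
    have haI : a ∈ Set.Icc a (a + c) := ⟨le_rfl, by linarith⟩
    set f : E → ℝ := fun z => (a - I a z) * w z with hf
    have hfm : Measurable f := by have := hI a; fun_prop
    have hfb : ∀ z, |a - I a z| ≤ 1 := by
      intro z
      rw [abs_le]
      rcases hI01 a z with h | h <;> rw [h] <;> constructor <;> linarith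
    have hfL : MemLp (fun ω => f (Z 0 ω)) 2 μ := by
      refine hw2.of_le_mul (c := 1) (hfm.comp (hmeas 0)).aestronglyMeasurable
        (ae_of_all _ fun ω => ?_)
      simp only [hf, norm_mul, Real.norm_eq_abs]
      exact mul_le_mul_of_nonneg_right (hfb _) (abs_nonneg _)
    have hmean : ∫ ω, f (Z 0 ω) ∂μ = 0 := by
      simp only [hf, sub_mul]
      rw [integral_sub ((hwi 0).const_mul _) (hIw a), integral_const_mul, h1 a haI, sub_self]
    have key := integral_sq_sum_sub_le hindep hident hfm hfL n
    rw [hmean] at key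
    simp only [sub_zero] at key
    refine ⟨(key.1.integrable (by norm_num)).abs, (integral_abs_le_sqrt key.1).trans
      (Real.sqrt_le_sqrt (key.2.trans ?_))⟩
    refine mul_le_mul_of_nonneg_left (integral_mono hfL.integrable_sq hwsq fun ω => ?_)
      (by positivity)
    simp only [hf, mul_pow]
    have := (sq_le_one_iff_abs_le_one _).2 (hfb (Z 0 ω))
    nlinarith [sq_nonneg (w (Z 0 ω))]
  have hWi : Integrable (fun ω => ∑ i ∈ Finset.range n, w (Z i ω)) μ :=
    integrable_finsetSum _ fun i _ => hwi i
  have hWint : ∫ ω, ∑ i ∈ Finset.range n, w (Z i ω) ∂μ ≤ n * √B := by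
    rw [integral_finsetSum _ fun i _ => hwi i]
    have : ∀ i ∈ Finset.range n, ∫ ω, w (Z i ω) ∂μ ≤ √B := by
      intro i _
      have e : ∫ ω, w (Z i ω) ∂μ = ∫ ω, w (Z 0 ω) ∂μ := ((hident i).comp hw).integral_eq
      rw [e]
      refine le_trans (integral_mono (hwi 0) (hwi 0).abs fun ω => le_abs_self _)
        (integral_abs_le_sqrt hw2)
    simpa using Finset.sum_le_sum this
  -- The starting value and the `k + 1` levels each contribute `√(n B)`, which explains the factor
  -- `k + 2`; the last term bounds the oscillation inside a cell of the finest grid.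
  refine ⟨fun ω => |H ω a| + ∑ l ∈ Finset.range (k + 1), Q l ω +
    c / 2 ^ k * ∑ i ∈ Finset.range n, w (Z i ω), ?_, ?_, ?_, ?_⟩
  · exact (hHa.1.add (integrable_finsetSum _ fun l _ => (hQint l).1)).add (hWi.const_mul _)
  · intro ω
    have : 0 ≤ ∑ i ∈ Finset.range n, w (Z i ω) := Finset.sum_nonneg fun i _ => hw0 _
    have : 0 ≤ ∑ l ∈ Finset.range (k + 1), Q l ω := Finset.sum_nonneg fun i _ => Real.sqrt_nonneg _
    positivity
  · filter_upwards [ae_all_iff.2 hG] with ω hω η hη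
    obtain ⟨j, hj, hle, hge⟩ := exists_dyadic_between hc hη k
    have b1 := abs_le.1 (abs_dyadic_le (H ω) a c k j (by omega))
    have b2 := abs_le.1 (abs_dyadic_le (H ω) a c k (j + 1) hj)
    have hW : 0 ≤ ∑ i ∈ Finset.range n, w (Z i ω) := Finset.sum_nonneg fun i _ => hw0 _
    have m1 := hpt k j (by omega)
    have m2 := hpt k (j + 1) hj
    set p := a + c * ((j : ℝ) / 2 ^ k) with hp
    set p' := a + c * (((j + 1 : ℕ) : ℝ) / 2 ^ k) with hp'
    have hgap : p' - p = c / 2 ^ k := by rw [hp, hp']; push_cast; ring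
    -- Inside a cell only the drift `η ∑ w_i` can increase the process: the indicators enter with a
    -- negative sign, are monotone in `η`, and have nonnegative weights.
    have u1 : H ω η ≤ H ω p + (η - p) * ∑ i ∈ Finset.range n, w (Z i ω) := by
      simp only [hH]
      rw [Finset.mul_sum, ← Finset.sum_add_distrib]
      refine Finset.sum_le_sum fun i _ => ?_
      have := hmono _ (hω i) p m1 η hη hle
      nlinarith [hw0 (Z i ω)]
    have u2 : H ω p' - (p' - η) * ∑ i ∈ Finset.range n, w (Z i ω) ≤ H ω η := by
      simp only [hH]
      rw [Finset.mul_sum, ← Finset.sum_sub_distrib]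
      refine Finset.sum_le_sum fun i _ => ?_
      have := hmono _ (hω i) η hη p' m2 hge
      nlinarith [hw0 (Z i ω)]
    have g1 : (η - p) * ∑ i ∈ Finset.range n, w (Z i ω) ≤
        c / 2 ^ k * ∑ i ∈ Finset.range n, w (Z i ω) := by
      refine mul_le_mul_of_nonneg_right ?_ hW
      linarith
    have g2 : (p' - η) * ∑ i ∈ Finset.range n, w (Z i ω) ≤
        c / 2 ^ k * ∑ i ∈ Finset.range n, w (Z i ω) := by
      refine mul_le_mul_of_nonneg_right ?_ hW
      linarith
    rw [abs_le]
    constructor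
    · linarith [b2.1]
    · linarith [b1.2]
  · rw [integral_add (by exact hHa.1.add (integrable_finsetSum _ fun l _ => (hQint l).1))
      (hWi.const_mul _), integral_add hHa.1 (integrable_finsetSum _ fun l _ => (hQint l).1),
      integral_finsetSum _ fun l _ => (hQint l).1, integral_const_mul]
    have s1 : ∑ l ∈ Finset.range (k + 1), ∫ ω, Q l ω ∂μ ≤ (k + 1) * √(n * B) := by
      refine (Finset.sum_le_sum fun l _ => (hQint l).2).trans_eq ?_
      simp
    have s2 : c / 2 ^ k * ∫ ω, ∑ i ∈ Finset.range n, w (Z i ω) ∂μ ≤ n / 2 ^ k * √B := by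
      calc c / 2 ^ k * ∫ ω, ∑ i ∈ Finset.range n, w (Z i ω) ∂μ ≤ c / 2 ^ k * (n * √B) := by gcongr
        _ ≤ 1 / 2 ^ k * (n * √B) := by gcongr; linarith
        _ = _ := by ring
    linarith [hHa.2]

end WeightedEmpirical

end UQPE

namespace UQPE

/-! ### Smooth products with bounded derivatives -/

section Product

lemma exists_uniform_bound {α : Type*} {S : Set α} {p : ℕ → α → ℝ} {k : ℕ}
    (h : ∀ i ≤ k, ∃ C : ℝ, ∀ y ∈ S, |p i y| ≤ C) : ∃ C : ℝ, 0 ≤ C ∧ ∀ i ≤ k, ∀ y ∈ S, |p i y| ≤ C := by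
  choose! C hC using h
  refine ⟨∑ i ∈ Finset.range (k + 1), |C i|, Finset.sum_nonneg fun _ _ => abs_nonneg _,
    fun i hi y hy => ((hC i hi y hy).trans (le_abs_self _)).trans ?_⟩
  exact Finset.single_le_sum (f := fun i => |C i|) (fun _ _ => abs_nonneg _)
    (Finset.mem_range.2 (Nat.lt_succ_of_le hi))

/-- Derivatives of a product `u v` are bounded if those of the factors are, `v` is bounded and `u`
is bounded where `v` does not vanish. -/
lemma exists_bound_iteratedDeriv_mul {u v : ℝ → ℝ} {k : ℕ} (hu : SmoothBddDeriv k u)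
    (hv : SmoothBddDeriv k v) {M C : ℝ} (hvC : ∀ y, |v y| ≤ C) (huM : ∀ y, v y ≠ 0 → |u y| ≤ M)
    {j : ℕ} (hj : j ≤ k) : ∃ B : ℝ, ∀ y, |iteratedDeriv j (fun y => u y * v y) y| ≤ B := by
  -- The factor `u` need not be bounded on the line, since only its derivatives of positive order
  -- are. On `S` its bound extends by continuity and Leibniz' rule applies; off `S` the product
  -- vanishes locally.
  set S := closure {y | v y ≠ 0} with hS
  have huS : ∀ y ∈ S, |u y| ≤ M := by
    have hcl : IsClosed {y | |u y| ≤ M} := isClosed_le hu.1.continuous.abs continuous_const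
    exact fun y hy => closure_minimal (fun z hz => huM z hz) hcl hy
  obtain ⟨A, hA0, hA⟩ := exists_uniform_bound (S := S) (p := fun i => iteratedDeriv i u) (k := k) (by
    intro i hi
    rcases Nat.eq_zero_or_pos i with rfl | hpos
    · exact ⟨M, fun y hy => by simpa using huS y hy⟩
    · obtain ⟨C, hC⟩ := hu.2 i hpos hi
      exact ⟨C, fun y _ => hC y⟩)
  obtain ⟨B, hB0, hB⟩ := exists_uniform_bound (S := Set.univ) (p := fun i => iteratedDeriv i v)
    (k := k) (by
    intro i hi
    rcases Nat.eq_zero_or_pos i with rfl | hpos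
    · exact ⟨C, fun y _ => by simpa using hvC y⟩
    · obtain ⟨C, hC⟩ := hv.2 i hpos hi
      exact ⟨C, fun y _ => hC y⟩)
  refine ⟨∑ i ∈ Finset.range (j + 1), (j.choose i : ℝ) * A * B, fun y => ?_⟩
  by_cases hy : y ∈ S
  · have hj' : ((j : ℕ) : WithTop ℕ∞) ≤ k := by exact_mod_cast hj
    have e := iteratedDeriv_mul (n := j) (x := y) (hu.1.of_le hj').contDiffAt
      (hv.1.of_le hj').contDiffAt
    have e' : iteratedDeriv j (fun y => u y * v y) y = iteratedDeriv j (u * v) y := rfl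
    rw [e', e]
    refine (Finset.abs_sum_le_sum_abs _ _).trans (Finset.sum_le_sum fun i hi => ?_)
    have hi' := Finset.mem_range.1 hi
    rw [abs_mul, abs_mul, Nat.abs_cast]
    gcongr
    · exact hA i (by omega) y hy
    · exact hB _ (by omega) y trivial
  · have hz : (fun y => u y * v y) =ᶠ[𝓝 y] fun _ => 0 := by
      filter_upwards [isClosed_closure.isOpen_compl.mem_nhds hy] with z hz
      have : v z = 0 := by
        by_contra h
        exact hz (subset_closure h)
      simp [this]
    rw [hz.iteratedDeriv_eq]
    have : iteratedDeriv j (fun _ : ℝ => (0 : ℝ)) y = 0 := by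
      rw [iteratedDeriv_const]; simp
    rw [this, abs_zero]
    positivity

lemma abs_sub_le_of_deriv_bdd {m : ℝ → ℝ} (hm : ContDiff ℝ 1 m) {L : ℝ}
    (hL : ∀ y, |iteratedDeriv 1 m y| ≤ L) (y z : ℝ) : |m y - m z| ≤ L * |y - z| := by
  have := convex_univ.norm_image_sub_le_of_norm_deriv_le (f := m) (C := L) (x := z) (y := y)
    (fun x _ => hm.differentiable (by norm_num) x)
    (fun x _ => by simpa [iteratedDeriv_one] using hL x) trivial trivial
  simpa using this

end Product

/-! ### Regression functions and conditional second moments -/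

section Regression

variable {Ω : Type*} [MeasurableSpace Ω] {μ : Measure Ω} {d : ℕ}
  {X : Ω → Fin (d + 1) → ℝ} {Y V : Ω → ℝ} {ν : Measure (Fin (d + 1) → ℝ)}
  {fYX : ℝ → (Fin (d + 1) → ℝ) → ℝ} {fX : (Fin (d + 1) → ℝ) → ℝ} {fY g s : ℝ → ℝ}

lemma IsRegression.ae_abs_le (hg : IsRegression μ V Y g) {M : ℝ} (hV : ∀ᵐ ω ∂μ, |V ω| ≤ M) :
    ∀ᵐ ω ∂μ, |g (Y ω)| ≤ M := by
  filter_upwards [hg.2, ae_bdd_abs_condExp_of_ae_bdd_abs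
    (m := MeasurableSpace.comap Y inferInstance) hV] with ω h1 h2
  rw [h1]
  exact h2

/-- An almost sure bound for a continuous function of `Y` holds wherever the density of `Y` is
positive. -/
lemma AreDensities.le_of_ae_le (hd : AreDensities μ X Y ν fYX fX fY) (hY : Measurable Y)
    (hc : Continuous fY) {φ : ℝ → ℝ} (hφ : Continuous φ) {c : ℝ} (h : ∀ᵐ ω ∂μ, φ (Y ω) ≤ c)
    {y : ℝ} (hy : 0 < fY y) : φ y ≤ c := by
  have hset : MeasurableSet {y | φ y ≤ c} := measurableSet_le hφ.measurable measurable_const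
  have h1 : ∀ᵐ y ∂(μ.map Y), φ y ≤ c := (ae_map_iff hY.aemeasurable hset).2 h
  rw [hd.law_Y, ae_withDensity_iff (by have := hd.measurable_fY; fun_prop)] at h1
  by_contra hlt
  have hopen : IsOpen {y | 0 < fY y ∧ c < φ y} :=
    (isOpen_lt continuous_const hc).inter (isOpen_lt continuous_const hφ)
  have hnull : volume {y | 0 < fY y ∧ c < φ y} = 0 := by
    have h2 : ∀ᵐ y, ¬ (0 < fY y ∧ c < φ y) := by
      filter_upwards [h1] with z hz hz'
      exact absurd (hz (by simpa using hz'.1)) (not_le.2 hz'.2)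
    simpa [ae_iff] using h2
  rw [hopen.measure_eq_zero_iff volume] at hnull
  exact (hnull ▸ (show y ∈ {y | 0 < fY y ∧ c < φ y} from ⟨hy, not_le.1 hlt⟩) : y ∈ (∅ : Set ℝ))

variable [IsProbabilityMeasure μ]

/-- Pulling `ψ(Y)` out of the conditional expectation and taking expectations replaces `V` by its
regression function. -/
lemma IsRegression.integral_mul (hg : IsRegression μ V Y g) (hY : Measurable Y)
    (hV : Integrable V μ) {ψ : ℝ → ℝ} (hψ : Measurable ψ)
    (hi : Integrable (fun ω => ψ (Y ω) * V ω) μ) :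
    ∫ ω, ψ (Y ω) * V ω ∂μ = ∫ ω, ψ (Y ω) * g (Y ω) ∂μ := by
  have hle : MeasurableSpace.comap Y inferInstance ≤ (inferInstance : MeasurableSpace Ω) :=
    hY.comap_le
  have hψm : StronglyMeasurable[MeasurableSpace.comap Y inferInstance] fun ω => ψ (Y ω) :=
    (hψ.comp (comap_measurable Y)).stronglyMeasurable
  have h := condExp_mul_of_aestronglyMeasurable_left (m := MeasurableSpace.comap Y inferInstance)
    (f := fun ω => ψ (Y ω)) (g := V) hψm.aestronglyMeasurable hi hV
  calc ∫ ω, ψ (Y ω) * V ω ∂μ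
      = ∫ ω, (μ[(fun ω => ψ (Y ω)) * V | MeasurableSpace.comap Y inferInstance]) ω ∂μ :=
        (integral_condExp hle).symm
    _ = ∫ ω, ψ (Y ω) * g (Y ω) ∂μ := by
        refine integral_congr_ae ?_
        filter_upwards [h, hg.2] with ω h1 h2
        rw [h1, Pi.mul_apply, ← h2]

lemma integrable_comp_mul_of_bdd {Y V : Ω → ℝ} (hY : Measurable Y) (hVm : AEStronglyMeasurable V μ) {M : ℝ}
    (hV : ∀ᵐ ω ∂μ, |V ω| ≤ M) {φ : ℝ → ℝ} (hφ : Measurable φ) {B : ℝ}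
    (hB : ∀ᵐ ω ∂μ, |φ (Y ω)| ≤ B) : Integrable (fun ω => φ (Y ω) * V ω) μ :=
  (Integrable.of_bound hVm M hV).bdd_mul (c := B) (hφ.comp hY).aestronglyMeasurable hB

/-- This identifies the mean of a kernel term as a Lebesgue integral against `(g - c) fY`, to which
the bias expansion applies. -/
lemma IsRegression.integral_mul_sub (hd : AreDensities μ X Y ν fYX fX fY) (hY : Measurable Y)
    (hg : IsRegression μ V Y g) (hVm : AEStronglyMeasurable V μ) {M : ℝ}
    (hV : ∀ᵐ ω ∂μ, |V ω| ≤ M) (c : ℝ) {φ : ℝ → ℝ} (hφ : Measurable φ) {B : ℝ}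
    (hB : ∀ y, |φ y| ≤ B) :
    ∫ ω, φ (Y ω) * (V ω - c) ∂μ = ∫ y, φ y * ((g y - c) * fY y) := by
  have hi := integrable_comp_mul_of_bdd hY hVm hV hφ (ae_of_all _ fun ω => hB (Y ω))
  have hgi := integrable_comp_mul_of_bdd hY (V := fun ω => g (Y ω)) (hg.1.comp hY).aestronglyMeasurable (hg.ae_abs_le hV) hφ
    (ae_of_all _ fun ω => hB (Y ω))
  have hci : Integrable (fun ω => φ (Y ω) * c) μ :=
    (Integrable.of_bound (hφ.comp hY).aestronglyMeasurable B (ae_of_all _ fun ω => hB _)).mul_const c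
  have hgm := hg.1
  have e := hd.integral_fY_eq hY (φ := fun y => φ y * (g y - c)) (by fun_prop)
  simp_rw [← mul_assoc, ← e, mul_sub]
  rw [integral_sub hi hci, integral_sub hgi hci, hg.integral_mul hY (Integrable.of_bound hVm M hV) hφ hi]

/-- Decompose `V - c` as the residual plus `g(Y) - c`. The cross term vanishes because the residual
has conditional mean zero, so the conditional second moment is `s + (g - c)²`. -/
lemma IsRegression.integral_mul_sub_sq (hd : AreDensities μ X Y ν fYX fX fY) (hY : Measurable Y)
    (hg : IsRegression μ V Y g) (hs : IsRegression μ (fun ω => residual μ V Y ω ^ 2) Y s)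
    (hVm : AEStronglyMeasurable V μ) {M : ℝ} (hV : ∀ᵐ ω ∂μ, |V ω| ≤ M) (c : ℝ) {φ : ℝ → ℝ}
    (hφ : Measurable φ) {B : ℝ} (hB : ∀ y, |φ y| ≤ B) :
    (∀ᵐ ω ∂μ, |s (Y ω)| ≤ (2 * M) ^ 2) ∧
    ∫ ω, φ (Y ω) * (V ω - c) ^ 2 ∂μ = ∫ y, φ y * ((s y + (g y - c) ^ 2) * fY y) := by
  have hgM := hg.ae_abs_le hV
  have hres : residual μ V Y =ᵐ[μ] fun ω => V ω - g (Y ω) := by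
    filter_upwards [hg.2] with ω h
    rw [residual, ← h]
  have hU : ∀ᵐ ω ∂μ, |residual μ V Y ω ^ 2| ≤ (2 * M) ^ 2 := by
    filter_upwards [hres, hV, hgM] with ω h1 h2 h3
    rw [h1, abs_pow]
    refine pow_le_pow_left₀ (abs_nonneg _) ((abs_sub _ _).trans ?_) 2
    linarith
  have hUm : AEStronglyMeasurable (fun ω => residual μ V Y ω ^ 2) μ := by
    refine AEStronglyMeasurable.pow ?_ 2
    exact (hVm.sub (hg.1.comp hY).aestronglyMeasurable).congr hres.symm
  have hsM := hs.ae_abs_le hU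
  refine ⟨hsM, ?_⟩
  have hgm := hg.1
  have hsm := hs.1
  have hφae : ∀ᵐ ω ∂μ, |φ (Y ω)| ≤ B := ae_of_all _ fun ω => hB _
  have hB0 : 0 ≤ B := (abs_nonneg _).trans (hB 0)
  set ψ : ℝ → ℝ := fun y => φ y * (g y - c) with hψ
  have hψm : Measurable ψ := by fun_prop
  have hψB : ∀ᵐ ω ∂μ, |ψ (Y ω)| ≤ B * (M + |c|) := by
    filter_upwards [hgM] with ω h
    simp only [hψ, abs_mul]
    refine mul_le_mul (hB _) ((abs_sub _ _).trans ?_) (abs_nonneg _) hB0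
    linarith
  have hVi : Integrable V μ := Integrable.of_bound hVm M hV
  have i1 := integrable_comp_mul_of_bdd hY hUm hU hφ hφae
  have i2 := integrable_comp_mul_of_bdd hY hVm hV hψm hψB
  have i3 := integrable_comp_mul_of_bdd hY (V := fun ω => g (Y ω)) (hgm.comp hY).aestronglyMeasurable hgM hψm hψB
  have hgc : ∀ᵐ ω ∂μ, |g (Y ω) - c| ≤ M + |c| := by
    filter_upwards [hgM] with ω h
    refine (abs_sub _ _).trans ?_
    linarith
  have i4 := integrable_comp_mul_of_bdd hY (V := fun ω => g (Y ω) - c)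
    ((hgm.comp hY).sub_const c).aestronglyMeasurable hgc hψm hψB
  have i5 := integrable_comp_mul_of_bdd hY (V := fun ω => s (Y ω)) (hsm.comp hY).aestronglyMeasurable hsM hφ hφae
  have e := hd.integral_fY_eq hY (φ := fun y => φ y * (s y + (g y - c) ^ 2)) (by fun_prop)
  simp_rw [← mul_assoc, ← e]
  -- The middle term is the cross term, kept as a difference of two integrals that coincide by the
  -- regression property.
  have e1 : (fun ω => φ (Y ω) * (V ω - c) ^ 2) =ᵐ[μ] fun ω => φ (Y ω) * residual μ V Y ω ^ 2 +
      2 * (ψ (Y ω) * V ω - ψ (Y ω) * g (Y ω)) + ψ (Y ω) * (g (Y ω) - c) := by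
    filter_upwards [hres] with ω h
    rw [h]
    simp only [hψ]
    ring
  have e2 : (fun ω => φ (Y ω) * (s (Y ω) + (g (Y ω) - c) ^ 2)) = fun ω => φ (Y ω) * s (Y ω) +
      ψ (Y ω) * (g (Y ω) - c) := by
    ext ω
    simp only [hψ]
    ring
  rw [integral_congr_ae e1, e2, integral_add (by exact i1.add ((i2.sub i3).const_mul 2)) i4,
    integral_add i1 (by exact (i2.sub i3).const_mul 2), integral_const_mul, integral_sub i2 i3,
    integral_add i5 i4, hs.integral_mul hY (Integrable.of_bound hUm _ hU) hφ i1,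
    hg.integral_mul hY hVi hψm i2]
  simp

end Regression

end UQPE

namespace UQPE

/-! ### Bandwidth asymptotics -/

section Rates

variable {h : ℕ → ℝ} {a : ℝ} {r : ℕ}

lemma BandwidthAssumption.pos_exponent (hb : BandwidthAssumption h a r) : 0 < a :=
  lt_trans (by positivity) hb.lower

lemma tendsto_natCast_rpow_neg {e : ℝ} (he : e < 0) :
    Tendsto (fun n : ℕ => (n : ℝ) ^ e) atTop (𝓝 0) := by
  have := (tendsto_rpow_neg_atTop (y := -e) (by linarith)).comp tendsto_natCast_atTop_atTop
  simpa [Function.comp_def] using this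

/-- Since `h` is of order `n^(-a)`, the product is of order `n^(e - a p)`. All bandwidth limits
below are comparisons of exponents through this lemma. -/
lemma BandwidthAssumption.tendsto_rpow_mul_rpow (hb : BandwidthAssumption h a r) {p e : ℝ}
    (he : e < a * p) : Tendsto (fun n : ℕ => h n ^ p * (n : ℝ) ^ e) atTop (𝓝 0) := by
  obtain ⟨c, hc, hlim⟩ := hb.proportional
  have h1 : Tendsto (fun n : ℕ => (h n * (n : ℝ) ^ a) ^ p * (n : ℝ) ^ (e - a * p)) atTop
      (𝓝 (c ^ p * 0)) :=
    (hlim.rpow_const (Or.inl hc.ne')).mul (tendsto_natCast_rpow_neg (by linarith))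
  rw [mul_zero] at h1
  refine h1.congr' ?_
  filter_upwards [eventually_gt_atTop 0] with n hn
  have hn' : (0 : ℝ) < n := by exact_mod_cast hn
  rw [Real.mul_rpow (hb.pos n).le (by positivity), ← Real.rpow_mul hn'.le, mul_assoc,
    ← Real.rpow_add hn']
  congr 2
  ring

lemma BandwidthAssumption.tendsto_zero (hb : BandwidthAssumption h a r) :
    Tendsto h atTop (𝓝 0) := by
  have := hb.tendsto_rpow_mul_rpow (p := 1) (e := 0) (by linarith [hb.pos_exponent])
  simpa using this

lemma BandwidthAssumption.tendsto_inv_mul (hb : BandwidthAssumption h a r) :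
    Tendsto (fun n : ℕ => ((n : ℝ) * h n)⁻¹) atTop (𝓝 0) := by
  have := hb.tendsto_rpow_mul_rpow (p := -1) (e := -1) (by linarith [hb.upper])
  refine this.congr fun n => ?_
  rw [Real.rpow_neg_one, Real.rpow_neg_one, mul_inv, mul_comm]

/-- The exponent condition `1/2 < a (1/2 + r)` is exactly `a > 1/(1 + 2 r)`. -/
lemma BandwidthAssumption.tendsto_bias (hb : BandwidthAssumption h a r) :
    Tendsto (fun n : ℕ => √((n : ℝ) * h n) * h n ^ r) atTop (𝓝 0) := by
  have hl := hb.lower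
  rw [div_lt_iff₀ (by positivity)] at hl
  have := hb.tendsto_rpow_mul_rpow (p := 1 / 2 + r) (e := 1 / 2) (by linarith)
  refine this.congr fun n => ?_
  rw [Real.sqrt_eq_rpow, Real.mul_rpow (by positivity) (hb.pos n).le, Real.rpow_add (hb.pos n),
    Real.rpow_natCast]
  ring

/-- A slowly growing rate, dominated by powers of the bandwidth. -/
lemma BandwidthAssumption.exists_rate (hb : BandwidthAssumption h a r) : ∃ θ : ℝ, 0 < θ ∧
    Tendsto (fun n : ℕ => √(h n) * (n : ℝ) ^ θ) atTop (𝓝 0) ∧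
    Tendsto (fun n : ℕ => (n : ℝ) ^ θ / √(n : ℝ) / h n) atTop (𝓝 0) := by
  have ha := hb.pos_exponent
  have hu := hb.upper
  -- The two limits require `θ < a/2` and `θ < 1/2 - a`; half of each upper bound is taken.
  refine ⟨min (a / 4) ((1 / 2 - a) / 2), lt_min (by linarith) (by linarith), ?_, ?_⟩
  · have := hb.tendsto_rpow_mul_rpow (p := 1 / 2) (e := min (a / 4) ((1 / 2 - a) / 2))
      ((min_le_left _ _).trans_lt (by linarith))
    simpa [Real.sqrt_eq_rpow] using this
  · have := hb.tendsto_rpow_mul_rpow (p := -1) (e := min (a / 4) ((1 / 2 - a) / 2) - 1 / 2)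
      (by linarith [min_le_right (a / 4) ((1 / 2 - a) / 2)])
    refine this.congr' ?_
    filter_upwards [eventually_gt_atTop 0] with n hn
    have hn' : (0 : ℝ) < n := by exact_mod_cast hn
    rw [Real.rpow_neg_one, Real.rpow_sub hn', Real.sqrt_eq_rpow, div_eq_mul_inv _ (h n), mul_comm]

/-- The numerator is the number of terms produced by chaining to depth `log₂ n + 1`; any positive
power of `n` absorbs it. -/
lemma tendsto_log_div_rpow {θ : ℝ} (hθ : 0 < θ) :
    Tendsto (fun n : ℕ => ((Nat.log 2 n : ℝ) + 4) / (n : ℝ) ^ θ) atTop (𝓝 0) := by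
  have h1 : Tendsto (fun n : ℕ => Real.log n / (n : ℝ) ^ θ) atTop (𝓝 0) :=
    ((isLittleO_log_rpow_atTop hθ).tendsto_div_nhds_zero).comp tendsto_natCast_atTop_atTop
  have h2 : Tendsto (fun n : ℕ => 4 * (n : ℝ) ^ (-θ)) atTop (𝓝 0) := by
    simpa using (tendsto_natCast_rpow_neg (e := -θ) (by linarith)).const_mul 4
  have h3 := (h1.const_mul (Real.log 2)⁻¹).add h2
  rw [mul_zero, add_zero] at h3
  refine squeeze_zero (fun n => by positivity) (fun n => ?_) h3
  have hlog : (Nat.log 2 n : ℝ) ≤ Real.log n / Real.log 2 := by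
    have := Real.natLog_le_logb n 2
    simpa [Real.logb] using this
  rw [Real.rpow_neg (by positivity), add_div]
  have hp : 0 ≤ (n : ℝ) ^ θ := by positivity
  have : (Nat.log 2 n : ℝ) / (n : ℝ) ^ θ ≤ (Real.log 2)⁻¹ * (Real.log n / (n : ℝ) ^ θ) := by
    calc (Nat.log 2 n : ℝ) / (n : ℝ) ^ θ ≤ Real.log n / Real.log 2 / (n : ℝ) ^ θ := by gcongr
      _ = _ := by ring
  have e : (4 : ℝ) / (n : ℝ) ^ θ = 4 * ((n : ℝ) ^ θ)⁻¹ := div_eq_mul_inv _ _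
  linarith

end Rates

/-! ### Events of probability tending to one -/

section Whp

variable {Ω : Type*} [MeasurableSpace Ω] {μ : Measure Ω}

/-- `P n` holds with (inner) probability tending to one. -/
def Whp (μ : Measure Ω) (P : ℕ → Ω → Prop) : Prop :=
  Tendsto (fun n => μ {ω | ¬ P n ω}) atTop (𝓝 0)

lemma Whp.mono {P Q : ℕ → Ω → Prop} (hP : Whp μ P)
    (h : ∀ᶠ n in atTop, ∀ᵐ ω ∂μ, P n ω → Q n ω) : Whp μ Q := by
  refine tendsto_of_tendsto_of_tendsto_of_le_of_le' tendsto_const_nhds hP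
    (Eventually.of_forall fun _ => zero_le) ?_
  filter_upwards [h] with n hn
  refine measure_mono_ae ?_
  filter_upwards [hn] with ω hω hQ hP
  exact hQ (hω hP)

lemma Whp.and {P Q : ℕ → Ω → Prop} (hP : Whp μ P) (hQ : Whp μ Q) :
    Whp μ fun n ω => P n ω ∧ Q n ω := by
  have h := Tendsto.add hP hQ
  rw [add_zero] at h
  refine tendsto_of_tendsto_of_tendsto_of_le_of_le tendsto_const_nhds h
    (fun _ => zero_le) fun n => ?_
  refine (measure_mono fun ω hω => ?_).trans (measure_union_le _ _)
  by_cases h1 : P n ω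
  · exact Or.inr fun h2 => hω ⟨h1, h2⟩
  · exact Or.inl h1

lemma Whp.forall_finset {ι : Type*} [Fintype ι] {P : ι → ℕ → Ω → Prop} (h : ∀ i, Whp μ (P i)) :
    Whp μ fun n ω => ∀ i, P i n ω := by
  have hs : Tendsto (fun n => ∑ i, μ {ω | ¬ P i n ω}) atTop (𝓝 0) := by
    simpa using tendsto_finsetSum Finset.univ fun i _ => h i
  refine tendsto_of_tendsto_of_tendsto_of_le_of_le tendsto_const_nhds hs
    (fun _ => zero_le) fun n => ?_
  refine (measure_mono fun ω hω => ?_).trans (measure_iUnion_fintype_le μ fun i => {ω | ¬ P i n ω})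
  obtain ⟨i, hi⟩ := not_forall.1 hω
  exact Set.mem_iUnion.2 ⟨i, hi⟩

/-- Markov's inequality. -/
lemma whp_le_of_integral {T : ℕ → Ω → ℝ} {c : ℕ → ℝ} (hT : ∀ n, Integrable (T n) μ)
    (hT0 : ∀ n ω, 0 ≤ T n ω) (hc : ∀ᶠ n in atTop, 0 < c n)
    (hlim : Tendsto (fun n => (∫ ω, T n ω ∂μ) / c n) atTop (𝓝 0)) :
    Whp μ fun n ω => T n ω ≤ c n := by
  have h1 := (ENNReal.continuous_ofReal.tendsto _).comp hlim
  rw [ENNReal.ofReal_zero] at h1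
  refine tendsto_of_tendsto_of_tendsto_of_le_of_le' tendsto_const_nhds h1
    (Eventually.of_forall fun _ => zero_le) ?_
  filter_upwards [hc] with n hn
  have hm := meas_ge_le_lintegral_div (μ := μ) (f := fun ω => ENNReal.ofReal (T n ω))
    (hT n).1.aemeasurable.ennreal_ofReal (ε := ENNReal.ofReal (c n)) (by simpa using hn)
    ENNReal.ofReal_ne_top
  rw [← ofReal_integral_eq_lintegral_ofReal (hT n) (ae_of_all _ (hT0 n)),
    ← ENNReal.ofReal_div_of_pos hn] at hm
  refine (measure_mono fun ω hω => ?_).trans hm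
  exact ENNReal.ofReal_le_ofReal (not_le.1 hω).le

lemma whp_of_unifLittleOp {α : Type*} {S : Set α} {R : ℕ → Ω → α → ℝ} (h : UnifLittleOp μ S R)
    {δ : ℝ} (hδ : 0 < δ) : Whp μ fun n ω => ∀ x ∈ S, |R n ω x| < δ := by
  refine (h δ hδ).congr fun n => ?_
  congr 1
  ext ω
  simp

lemma whp_of_tendstoInMeasure {R : ℕ → Ω → ℝ} (h : TendstoInMeasure μ R atTop fun _ => 0)
    {δ : ℝ} (hδ : 0 < δ) : Whp μ fun n ω => |R n ω| < δ := by
  have := tendstoInMeasure_iff_norm.1 h δ hδ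
  refine this.congr fun n => ?_
  congr 1
  ext ω
  simp

end Whp

/-! ### Uniform rate of the quantile regression score -/

section FirstStep

variable {Ω : Type*} [MeasurableSpace Ω] {μ : Measure Ω}
    {d : ℕ} {X : ℕ → Ω → Fin (d + 1) → ℝ} {Y : ℕ → Ω → ℝ}
    {ν : Measure (Fin (d + 1) → ℝ)}
    {fYX : ℝ → (Fin (d + 1) → ℝ) → ℝ} {fX : (Fin (d + 1) → ℝ) → ℝ} {fY : ℝ → ℝ}
    {β : ℝ → Fin (d + 1) → ℝ} {ε τ : ℝ} {m : ℕ → ℕ} {grid : (n : ℕ) → Fin (m n + 1) → ℝ}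
    {βhat : ℕ → Ω → ℝ → Fin (d + 1) → ℝ} {Qhat : ℕ → Ω → ℝ}
    {ξhat : ℕ → Ω → (Fin (d + 1) → ℝ) → ℝ}

lemma IsIIDSample.ae_mem_support (hs : IsIIDSample μ X Y) (i : ℕ) :
    ∀ᵐ ω ∂μ, X i ω ∈ (μ.map (X 0)).support := by
  have h1 : μ.map (X i) = μ.map (X 0) := ((hs.ident i).comp measurable_fst).map_eq
  rw [← h1]
  exact UQPE.ae_mem_support (hs.measurable_X i)

lemma measurable_dotProduct_const (b : Fin (d + 1) → ℝ) :
    Measurable fun x : Fin (d + 1) → ℝ => x ⬝ᵥ b := by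
  unfold dotProduct; fun_prop

variable [IsProbabilityMeasure μ]

lemma AreDensities.integral_indicator_quantile
    (hd : AreDensities μ (X 0) (Y 0) ν fYX fX fY) (hX : Measurable (X 0)) (hY : Measurable (Y 0))
    {φ : (Fin (d + 1) → ℝ) → ℝ} (hφ : Measurable φ) (hφ0 : ∀ x, 0 ≤ φ x)
    {η : ℝ} (h0 : 0 < η) (h1 : η < 1) {b : Fin (d + 1) → ℝ}
    (hb : ∀ x ∈ (μ.map (X 0)).support, quantile (condLaw fYX x) η = x ⬝ᵥ b) :
    ∫ ω, (if Y 0 ω ≤ X 0 ω ⬝ᵥ b then 1 else 0) * φ (X 0 ω) ∂μ = η * ∫ ω, φ (X 0 ω) ∂μ := by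
  have hset : MeasurableSet {ω | Y 0 ω ≤ X 0 ω ⬝ᵥ b} :=
    measurableSet_le hY ((measurable_dotProduct_const b).comp hX)
  have hm : Measurable fun ω => (if Y 0 ω ≤ X 0 ω ⬝ᵥ b then (1 : ℝ) else 0) * φ (X 0 ω) :=
    (Measurable.ite hset measurable_const measurable_const).mul (hφ.comp hX)
  rw [integral_eq_lintegral_of_nonneg_ae (ae_of_all _ fun ω => by
      have := hφ0 (X 0 ω); positivity) hm.aestronglyMeasurable,
    integral_eq_lintegral_of_nonneg_ae (ae_of_all _ fun ω => hφ0 _)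
      (hφ.comp hX).aestronglyMeasurable]
  have := hd.lintegral_indicator_quantile hX hY (φ := fun x => ENNReal.ofReal (φ x))
    (by fun_prop) h0 h1 hb
  have e : ∀ ω, ENNReal.ofReal ((if Y 0 ω ≤ X 0 ω ⬝ᵥ b then 1 else 0) * φ (X 0 ω)) =
      (if Y 0 ω ≤ X 0 ω ⬝ᵥ b then 1 else 0) * ENNReal.ofReal (φ (X 0 ω)) := by
    intro ω
    split_ifs <;> simp
  simp_rw [e]
  rw [this, ENNReal.toReal_mul, ENNReal.toReal_ofReal h0.le]

/-- The rate of the quantile regression score with nonnegative weights. -/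
lemma whp_weighted_score (hs : IsIIDSample μ X Y)
    (hd : AreDensities μ (X 0) (Y 0) ν fYX fX fY) (hε : ε ∈ Set.Ioo (0 : ℝ) (1 / 2))
    (hlin : ∀ x ∈ (μ.map (X 0)).support, ∀ η ∈ Set.Icc ε (1 - ε),
      quantile (condLaw fYX x) η = x ⬝ᵥ β η) {w : (Fin (d + 1) → ℝ) → ℝ} (hw : Measurable w)
    (hw0 : ∀ x, 0 ≤ w x) (hw2 : MemLp (fun ω => w (X 0 ω)) 2 μ) {θ : ℝ} (hθ : 0 < θ) :
    Whp μ fun n ω => ∀ η ∈ Set.Icc ε (1 - ε),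
      |∑ i ∈ Finset.range n, (η - if Y i ω ≤ X i ω ⬝ᵥ β η then 1 else 0) * w (X i ω)| ≤
        √(n : ℝ) * (n : ℝ) ^ θ := by
  have hX := hs.measurable_X 0
  have hY := hs.measurable_Y 0
  have hc : ε + (1 - 2 * ε) = 1 - ε := by ring
  set I : ℝ → (Fin (d + 1) → ℝ) × ℝ → ℝ := fun η z => if z.2 ≤ z.1 ⬝ᵥ β η then 1 else 0 with hI
  have hIm : ∀ η, Measurable (I η) := fun η => Measurable.ite
    (measurableSet_le measurable_snd ((measurable_dotProduct_const _).comp measurable_fst))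
    measurable_const measurable_const
  have hI01 : ∀ η z, I η z = 0 ∨ I η z = 1 := by
    intro η z
    simp only [hI]
    split_ifs <;> simp
  -- On the support `x ⬝ᵥ β η` is a genuine conditional quantile and hence monotone in `η`. Off the
  -- support nothing is known, which is why the maximal inequality is restricted to a set of full
  -- measure.
  have hmono : ∀ z ∈ {z : (Fin (d + 1) → ℝ) × ℝ | z.1 ∈ (μ.map (X 0)).support},
      ∀ η ∈ Set.Icc ε (ε + (1 - 2 * ε)), ∀ η' ∈ Set.Icc ε (ε + (1 - 2 * ε)), η ≤ η' →
      I η z ≤ I η' z := by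
    intro z hz η hη η' hη' hle
    rw [hc] at hη hη'
    have hz' : z.1 ∈ (μ.map (X 0)).support := hz
    have := hd.fYX_prob z.1 hz'
    have hq := quantile_mono (condLaw fYX z.1) (hε.1.trans_le hη.1) hle
      (hη'.2.trans_lt (by linarith [hε.1]))
    rw [hlin _ hz' _ hη, hlin _ hz' _ hη'] at hq
    simp only [hI]
    split_ifs with h1 h2
    · exact le_rfl
    · exact absurd (h1.trans hq) h2
    · exact zero_le_one
    · exact le_rfl
  have hmom : ∀ {φ : (Fin (d + 1) → ℝ) → ℝ}, Measurable φ → (∀ x, 0 ≤ φ x) →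
      ∀ η ∈ Set.Icc ε (ε + (1 - 2 * ε)),
      ∫ ω, I η (X 0 ω, Y 0 ω) * φ (X 0 ω) ∂μ = η * ∫ ω, φ (X 0 ω) ∂μ := by
    intro φ hφ hφ0 η hη
    rw [hc] at hη
    exact hd.integral_indicator_quantile hX hY hφ hφ0 (hε.1.trans_le hη.1)
      (hη.2.trans_lt (by linarith [hε.1])) fun x hx => hlin x hx η hη
  set B := ∫ ω, w (X 0 ω) ^ 2 ∂μ with hB
  -- At depth `log₂ n + 1` the finest cell has length below `1/n`, so the interpolation term is at
  -- most one further `√(n B)`. Together with the other `log₂ n + 3` terms this gives `log₂ n + 4`.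
  have key := fun n : ℕ => exists_sup_weighted_empirical_le
    (Z := fun i ω => (X i ω, Y i ω)) (fun i => (hs.measurable_X i).prodMk (hs.measurable_Y i))
    hs.indep hs.ident (w := fun z => w z.1) (hw.comp measurable_fst) (fun z => hw0 _) hw2
    hε.1.le (c := 1 - 2 * ε) (by linarith [hε.2]) (by linarith [hε.1]) hIm hI01
    (fun i => hs.ae_mem_support i) hmono
    (hmom hw hw0) (hmom (hw.pow_const 2) fun x => sq_nonneg _) n (Nat.log 2 n + 1)
  choose T hTi hT0 hTle hTint using key
  have hwhp : Whp μ fun n ω => T n ω ≤ √(n : ℝ) * (n : ℝ) ^ θ := by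
    refine whp_le_of_integral hTi hT0 ?_ ?_
    · filter_upwards [eventually_gt_atTop 0] with n hn
      have hn' : (0 : ℝ) < n := by exact_mod_cast hn
      positivity
    · have hlim := (tendsto_log_div_rpow hθ).mul_const √B
      rw [zero_mul] at hlim
      refine squeeze_zero' (Eventually.of_forall fun n =>
        div_nonneg (integral_nonneg (hT0 n)) (by positivity)) ?_ hlim
      filter_upwards [eventually_gt_atTop 0] with n hn
      have hn' : (0 : ℝ) < n := by exact_mod_cast hn
      have h1 : (1 : ℝ) ≤ n := by exact_mod_cast hn
      rw [div_le_iff₀ (by positivity)]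
      refine (hTint n).trans ?_
      have hp : (n : ℝ) / 2 ^ (Nat.log 2 n + 1) ≤ √(n : ℝ) := by
        have h2 : (n : ℝ) ≤ 2 ^ (Nat.log 2 n + 1) := by
          exact_mod_cast (Nat.lt_pow_succ_log_self (by norm_num) n).le
        have h3 : (n : ℝ) / 2 ^ (Nat.log 2 n + 1) ≤ 1 := by
          rw [div_le_one (by positivity)]; exact h2
        exact h3.trans (Real.one_le_sqrt.2 h1)
      have e : ((Nat.log 2 n : ℝ) + 4) / (n : ℝ) ^ θ * √B * (√(n : ℝ) * (n : ℝ) ^ θ) =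
          ((Nat.log 2 n : ℝ) + 4) * (√(n : ℝ) * √B) := by
        have : (n : ℝ) ^ θ ≠ 0 := by positivity
        field_simp
      rw [e, Real.sqrt_mul hn'.le]
      have hsB := Real.sqrt_nonneg B
      have := mul_le_mul_of_nonneg_right hp hsB
      push_cast
      linarith
  refine hwhp.mono (Eventually.of_forall fun n => ?_)
  filter_upwards [hTle n] with ω hω hTω η hη
  rw [hc] at hω
  exact (hω η hη).trans hTω

/-- The rate of the quantile regression score. -/
lemma whp_qrScore (hs : IsIIDSample μ X Y)
    (hd : AreDensities μ (X 0) (Y 0) ν fYX fX fY) (hε : ε ∈ Set.Ioo (0 : ℝ) (1 / 2))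
    (hlin : ∀ x ∈ (μ.map (X 0)).support, ∀ η ∈ Set.Icc ε (1 - ε),
      quantile (condLaw fYX x) η = x ⬝ᵥ β η) (hX2 : MemLp (X 0) 2 μ) {θ : ℝ} (hθ : 0 < θ) :
    Whp μ fun n ω => ∀ η ∈ Set.Icc ε (1 - ε),
      ‖qrScore X Y β n ω η‖ ≤ 2 * ((n : ℝ) ^ θ / √(n : ℝ)) := by
  have hXj : ∀ j, MemLp (fun ω => X 0 ω j) 2 μ := fun j => by
    refine hX2.of_le ((measurable_pi_apply j).comp (hs.measurable_X 0)).aestronglyMeasurable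
      (ae_of_all _ fun ω => norm_le_pi_norm (X 0 ω) j)
  -- The maximal inequality needs nonnegative weights, so every coordinate of `X` is split into
  -- positive and negative parts.
  have hpos : ∀ j, Whp μ fun n ω => ∀ η ∈ Set.Icc ε (1 - ε),
      |∑ i ∈ Finset.range n, (η - if Y i ω ≤ X i ω ⬝ᵥ β η then 1 else 0) * max (X i ω j) 0| ≤
        √(n : ℝ) * (n : ℝ) ^ θ := fun j =>
    whp_weighted_score hs hd hε hlin (w := fun x => max (x j) 0) (by fun_prop)
      (fun x => le_max_right _ _) ((hXj j).pos_part) hθ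
  have hneg : ∀ j, Whp μ fun n ω => ∀ η ∈ Set.Icc ε (1 - ε),
      |∑ i ∈ Finset.range n, (η - if Y i ω ≤ X i ω ⬝ᵥ β η then 1 else 0) * max (-X i ω j) 0| ≤
        √(n : ℝ) * (n : ℝ) ^ θ := fun j =>
    whp_weighted_score hs hd hε hlin (w := fun x => max (-x j) 0) (by fun_prop)
      (fun x => le_max_right _ _) ((hXj j).neg.pos_part) hθ
  refine (Whp.forall_finset fun j => (hpos j).and (hneg j)).mono ?_
  filter_upwards [eventually_gt_atTop 0] with n hn
  refine ae_of_all _ fun ω hω η hη => ?_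
  have hn' : (0 : ℝ) < n := by exact_mod_cast hn
  rw [pi_norm_le_iff_of_nonneg (by positivity)]
  intro j
  have h1 := (hω j).1 η hη
  have h2 := (hω j).2 η hη
  have e : qrScore X Y β n ω η j = (n : ℝ)⁻¹ *
      (∑ i ∈ Finset.range n, (η - if Y i ω ≤ X i ω ⬝ᵥ β η then 1 else 0) * max (X i ω j) 0 -
       ∑ i ∈ Finset.range n, (η - if Y i ω ≤ X i ω ⬝ᵥ β η then 1 else 0) * max (-X i ω j) 0) := by
    simp only [qrScore, Pi.smul_apply, Finset.sum_apply, smul_eq_mul]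
    rw [← Finset.sum_sub_distrib]
    congr 1
    refine Finset.sum_congr rfl fun i _ => ?_
    rw [← mul_sub]
    congr 1
    rcases le_total 0 (X i ω j) with h | h
    · rw [max_eq_left h, max_eq_right (by linarith)]; ring
    · rw [max_eq_right h, max_eq_left (by linarith)]; ring
  rw [e, Real.norm_eq_abs, abs_mul, abs_of_pos (by positivity)]
  have hsq : √(n : ℝ) * √(n : ℝ) = n := Real.mul_self_sqrt hn'.le
  have hsp : 0 < √(n : ℝ) := Real.sqrt_pos.2 hn'
  calc (n : ℝ)⁻¹ * _ ≤ (n : ℝ)⁻¹ * (√(n : ℝ) * (n : ℝ) ^ θ + √(n : ℝ) * (n : ℝ) ^ θ) := by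
        gcongr
        exact (abs_sub _ _).trans (add_le_add h1 h2)
    _ = 2 * ((n : ℝ) ^ θ / √(n : ℝ)) := by
        have hinv : (n : ℝ)⁻¹ = (√(n : ℝ))⁻¹ * (√(n : ℝ))⁻¹ := by rw [← mul_inv, hsq]
        rw [hinv]
        field_simp
        ring

end FirstStep

end UQPE

namespace UQPE

/-! ### Rates of the first-step estimators -/

section FirstStepRates

/-- By Cramer's rule the entries of the inverse are the adjugate divided by a nonvanishing
determinant. They are continuous, hence bounded on a compact set. -/
lemma exists_bound_inv_mulVec {k : ℕ} {J : ℝ → Matrix (Fin k) (Fin k) ℝ} {S : Set ℝ}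
    (hS : IsCompact S) (hJ : ∀ i j, ContinuousOn (fun η => J η i j) S)
    (hinv : ∀ η ∈ S, IsUnit (J η)) :
    ∃ C : ℝ, 0 ≤ C ∧ ∀ η ∈ S, ∀ v : Fin k → ℝ, ‖(J η)⁻¹ *ᵥ v‖ ≤ C * ‖v‖ := by
  have hJc : ContinuousOn J S := continuousOn_pi.2 fun i => continuousOn_pi.2 fun j => hJ i j
  have hdet : ContinuousOn (fun η => (J η).det) S :=
    (continuous_id.matrix_det).comp_continuousOn hJc
  have hadj : ContinuousOn (fun η => (J η).adjugate) S :=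
    (continuous_id.matrix_adjugate).comp_continuousOn hJc
  have hne : ∀ η ∈ S, (J η).det ≠ 0 := fun η hη =>
    ((Matrix.isUnit_iff_isUnit_det _).1 (hinv η hη)).ne_zero
  have hent : ∀ i j, ContinuousOn (fun η => (J η)⁻¹ i j) S := by
    intro i j
    have h1 : ContinuousOn (fun η => (J η).det⁻¹ * (J η).adjugate i j) S :=
      (hdet.inv₀ hne).mul (continuousOn_pi.1 (continuousOn_pi.1 hadj i) j)
    refine h1.congr fun η _ => ?_
    rw [Matrix.inv_def, Matrix.smul_apply, Ring.inverse_eq_inv', smul_eq_mul]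
  have hb : ∀ i j, ∃ C : ℝ, ∀ η ∈ S, ‖(J η)⁻¹ i j‖ ≤ C := fun i j =>
    hS.exists_bound_of_continuousOn (hent i j)
  choose C hC using hb
  refine ⟨∑ i, ∑ j, |C i j|, by positivity, fun η hη v => ?_⟩
  rw [pi_norm_le_iff_of_nonneg (by positivity)]
  intro i
  calc ‖((J η)⁻¹ *ᵥ v) i‖ = ‖∑ j, (J η)⁻¹ i j * v j‖ := rfl
    _ ≤ ∑ j, ‖(J η)⁻¹ i j * v j‖ := norm_sum_le _ _
    _ ≤ ∑ j, |C i j| * ‖v‖ := by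
        refine Finset.sum_le_sum fun j _ => ?_
        rw [norm_mul]
        exact mul_le_mul ((hC i j η hη).trans (le_abs_self _)) (norm_le_pi_norm v j)
          (norm_nonneg _) (abs_nonneg _)
    _ = (∑ j, |C i j|) * ‖v‖ := by rw [Finset.sum_mul]
    _ ≤ (∑ i, ∑ j, |C i j|) * ‖v‖ := by
        refine mul_le_mul_of_nonneg_right ?_ (norm_nonneg v)
        exact Finset.single_le_sum (f := fun i => ∑ j, |C i j|)
          (fun i _ => Finset.sum_nonneg fun j _ => abs_nonneg _) (Finset.mem_univ i)

lemma abs_dotProduct_le {k : ℕ} (x v : Fin k → ℝ) : |x ⬝ᵥ v| ≤ k * ‖x‖ * ‖v‖ := by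
  calc |x ⬝ᵥ v| ≤ ∑ j, |x j * v j| := Finset.abs_sum_le_sum_abs _ _
    _ ≤ ∑ _j : Fin k, ‖x‖ * ‖v‖ := by
        refine Finset.sum_le_sum fun j _ => ?_
        rw [abs_mul]
        exact mul_le_mul (norm_le_pi_norm x j) (norm_le_pi_norm v j) (abs_nonneg _) (norm_nonneg _)
    _ = k * ‖x‖ * ‖v‖ := by simp [mul_assoc]

variable {Ω : Type*} [MeasurableSpace Ω] {μ : Measure Ω}
    {d : ℕ} {X : ℕ → Ω → Fin (d + 1) → ℝ} {Y : ℕ → Ω → ℝ}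
    {ν : Measure (Fin (d + 1) → ℝ)}
    {fYX : ℝ → (Fin (d + 1) → ℝ) → ℝ} {fX : (Fin (d + 1) → ℝ) → ℝ} {fY : ℝ → ℝ}
    {β : ℝ → Fin (d + 1) → ℝ} {ε τ : ℝ} {m : ℕ → ℕ} {grid : (n : ℕ) → Fin (m n + 1) → ℝ}
    {βhat : ℕ → Ω → ℝ → Fin (d + 1) → ℝ} {Qhat : ℕ → Ω → ℝ}
    {ξhat : ℕ → Ω → (Fin (d + 1) → ℝ) → ℝ}

lemma IsGrid.mem_Icc {k : ℕ} {g : Fin (k + 1) → ℝ} (hg : IsGrid ε g) (j : Fin (k + 1)) :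
    g j ∈ Set.Icc ε (1 - ε) := by
  constructor
  · rw [← hg.first]
    exact hg.strictMono.monotone (Fin.zero_le j)
  · rw [← hg.last]
    exact hg.strictMono.monotone (Fin.le_last j)

/-- Every estimated match is a grid point, so it lies in `[ε, 1 - ε]` and takes only finitely many
values. The first fact permits uniform rates at a random level, the second gives measurability. -/
lemma IsEstimatedMatch.exists_eq {k : ℕ} {g : Fin (k + 1) → ℝ} (hg : IsGrid ε g)
    {b : ℝ → Fin (d + 1) → ℝ} {q e : ℝ} {x : Fin (d + 1) → ℝ}
    (h : IsEstimatedMatch ε g b q x e) : ∃ j, e = g j := by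
  rcases h with ⟨-, rfl⟩ | ⟨j, -, -, rfl⟩ | ⟨-, rfl⟩
  · exact ⟨0, hg.first.symm⟩
  · exact ⟨_, rfl⟩
  · exact ⟨_, rfl⟩

/-- On the support, the matching function is the conditional distribution function at `q`. -/
lemma MatchingAssumption.matching_mem
    (hm : MatchingAssumption μ X Y fYX fY β ε τ m grid βhat Qhat)
    (hd : AreDensities μ (X 0) (Y 0) ν fYX fX fY) (hε : ε ∈ Set.Ioo (0 : ℝ) (1 / 2))
    {x : Fin (d + 1) → ℝ} (hx : x ∈ (μ.map (X 0)).support) :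
    matching fYX (quantile (μ.map (Y 0)) τ) x ∈ Set.Icc ε (1 - ε) ∧
    matching fYX (quantile (μ.map (Y 0)) τ) x =
      (condLaw fYX x).real (Set.Iic (quantile (μ.map (Y 0)) τ)) ∧
    quantile (μ.map (Y 0)) τ ∈ Set.Icc (x ⬝ᵥ β ε) (x ⬝ᵥ β (1 - ε)) := by
  have := hd.fYX_prob x hx
  obtain ⟨η, hη, hmem⟩ := hm.match_exists x hx
  have e := matching_eq_of_mem hmem
  refine ⟨by rwa [e], by rw [e]; exact eq_of_mem_matchingSet hmem, ?_⟩
  obtain ⟨⟨h0, h1⟩, hq⟩ := hmem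
  have hle : ε ≤ 1 - ε := hη.1.trans hη.2
  rw [← hq, ← hm.linear x hx ε ⟨le_rfl, hle⟩, ← hm.linear x hx (1 - ε) ⟨hle, le_rfl⟩]
  exact ⟨quantile_mono _ hε.1 hη.1 h1, quantile_mono _ h0 hη.2 (by linarith [hε.1])⟩

lemma ApproxAssumption.lipschitz (ha : ApproxAssumption μ X Y fYX β ε τ βhat Qhat ξhat) :
    ∃ L : ℝ, 0 ≤ L ∧ ∀ η ∈ Set.Icc ε (1 - ε), ∀ η' ∈ Set.Icc ε (1 - ε),
      |β η 0 - β η' 0| ≤ L * |η - η'| := by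
  obtain ⟨C, hC⟩ := ha.slope_deriv_bdd
  refine ⟨|C|, abs_nonneg C, fun η hη η' hη' => ?_⟩
  have := (convex_Icc ε (1 - ε)).norm_image_sub_le_of_norm_derivWithin_le
    (f := fun η => β η 0) (C := |C|) ha.slope_differentiable
    (fun x hx => (hC x hx).trans (le_abs_self C)) hη' hη
  simpa using this

variable [IsProbabilityMeasure μ]

/-- The rate of the sample quantile. -/
lemma whp_Qhat (hs : IsIIDSample μ X Y) (hd : AreDensities μ (X 0) (Y 0) ν fYX fX fY)
    (hτ : τ ∈ Set.Ioo (0 : ℝ) 1) (hm : MatchingAssumption μ X Y fYX fY β ε τ m grid βhat Qhat)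
    {θ : ℝ} (hθ : 0 < θ) :
    Whp μ fun n ω => |Qhat n ω - quantile (μ.map (Y 0)) τ| ≤
      (1 + |(fY (quantile (μ.map (Y 0)) τ))⁻¹|) * ((n : ℝ) ^ θ / √(n : ℝ)) := by
  set q := quantile (μ.map (Y 0)) τ with hq
  have hY := hs.measurable_Y 0
  set u : (Fin (d + 1) → ℝ) × ℝ → ℝ := fun z => τ - if z.2 ≤ q then 1 else 0 with hu
  have hum : Measurable u := measurable_const.sub (Measurable.ite
    (measurableSet_le measurable_snd measurable_const) measurable_const measurable_const)
  have hub : ∀ z, |u z| ≤ 1 := by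
    intro z
    simp only [hu]
    rw [abs_le]
    split_ifs <;> constructor <;> linarith [hτ.1, hτ.2]
  have hZ : ∀ i, Measurable fun ω => (X i ω, Y i ω) := fun i =>
    (hs.measurable_X i).prodMk (hs.measurable_Y i)
  have huL : MemLp (fun ω => u (X 0 ω, Y 0 ω)) 2 μ :=
    MemLp.of_bound (hum.comp (hZ 0)).aestronglyMeasurable 1 (ae_of_all _ fun ω => hub _)
  -- The law of `Y` has no atoms, so its distribution function equals `τ` at the `τ`-quantile and
  -- the score is centred.
  have hmean : ∫ ω, u (X 0 ω, Y 0 ω) ∂μ = 0 := by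
    have hP : IsProbabilityMeasure (μ.map (Y 0)) := Measure.isProbabilityMeasure_map hY.aemeasurable
    have hN : NullSingletonClass (μ.map (Y 0)) := by rw [hd.law_Y]; infer_instance
    have hF := measureReal_Iic_quantile (μ.map (Y 0)) hτ.1 hτ.2
    rw [← hq, map_measureReal_apply hY measurableSet_Iic] at hF
    have e : (fun ω => if Y 0 ω ≤ q then (1 : ℝ) else 0) =
        (Y 0 ⁻¹' Set.Iic q).indicator fun _ => 1 := by
      ext ω
      by_cases h : Y 0 ω ≤ q <;> simp [h]
    simp only [hu]
    have hi : Integrable (fun ω => if Y 0 ω ≤ q then (1 : ℝ) else 0) μ := by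
      rw [e]
      exact (integrable_const _).indicator (hY measurableSet_Iic)
    rw [integral_sub (integrable_const _) hi, e, integral_indicator (hY measurableSet_Iic)]
    simp [hF]
  have key := fun n => integral_sq_sum_sub_le (Z := fun i ω => (X i ω, Y i ω)) hs.indep hs.ident
    hum huL n
  simp only [hmean, sub_zero] at key
  have hw1 : Whp μ fun n ω => |∑ i ∈ Finset.range n, u (X i ω, Y i ω)| ≤ √(n : ℝ) * (n : ℝ) ^ θ := by
    refine whp_le_of_integral (fun n => ((key n).1.integrable (by norm_num)).abs)
      (fun n ω => abs_nonneg _) ?_ ?_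
    · filter_upwards [eventually_gt_atTop 0] with n hn
      have hn' : (0 : ℝ) < n := by exact_mod_cast hn
      positivity
    · refine squeeze_zero' (Eventually.of_forall fun n =>
        div_nonneg (integral_nonneg fun _ => abs_nonneg _) (by positivity)) ?_
        (tendsto_natCast_rpow_neg (e := -θ) (by linarith))
      filter_upwards [eventually_gt_atTop 0] with n hn
      have hn' : (0 : ℝ) < n := by exact_mod_cast hn
      rw [div_le_iff₀ (by positivity), Real.rpow_neg hn'.le]
      have h1 : ∫ ω, u (X 0 ω, Y 0 ω) ^ 2 ∂μ ≤ 1 := by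
        have := integral_mono huL.integrable_sq (integrable_const (1 : ℝ)) fun ω =>
          (sq_le_one_iff_abs_le_one _).2 (hub (X 0 ω, Y 0 ω))
        simpa using this
      refine (integral_abs_le_sqrt (key n).1).trans ?_
      have e : ((n : ℝ) ^ θ)⁻¹ * (√(n : ℝ) * (n : ℝ) ^ θ) = √(n : ℝ) := by
        have : (n : ℝ) ^ θ ≠ 0 := by positivity
        field_simp
      rw [e]
      refine Real.sqrt_le_sqrt ((key n).2.trans ?_)
      nlinarith
  refine (hw1.and (whp_of_tendstoInMeasure hm.bahadur_uncond one_pos)).mono ?_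
  filter_upwards [eventually_gt_atTop 0] with n hn
  refine ae_of_all _ fun ω ⟨h1, h2⟩ => ?_
  have hn' : (0 : ℝ) < n := by exact_mod_cast hn
  have hn1 : (1 : ℝ) ≤ n := by exact_mod_cast hn
  have hsp : 0 < √(n : ℝ) := Real.sqrt_pos.2 hn'
  have hl1 : 1 ≤ (n : ℝ) ^ θ := Real.one_le_rpow hn1 hθ.le
  rw [abs_mul, abs_of_pos hsp] at h2
  set A := (n : ℝ)⁻¹ * ∑ i ∈ Finset.range n, (τ - if Y i ω ≤ q then 1 else 0) with hA
  have hAle : |A| ≤ (n : ℝ) ^ θ / √(n : ℝ) := by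
    rw [hA, abs_mul, abs_of_pos (by positivity)]
    refine (mul_le_mul_of_nonneg_left h1 (by positivity)).trans_eq ?_
    have hinv : (n : ℝ)⁻¹ = (√(n : ℝ))⁻¹ * (√(n : ℝ))⁻¹ := by
      rw [← mul_inv, Real.mul_self_sqrt hn'.le]
    rw [hinv]
    field_simp
  have h3 : |Qhat n ω - q - (fY q)⁻¹ * A| ≤ (n : ℝ) ^ θ / √(n : ℝ) := by
    rw [le_div_iff₀ hsp, mul_comm]
    linarith
  calc |Qhat n ω - q| = |(Qhat n ω - q - (fY q)⁻¹ * A) + (fY q)⁻¹ * A| := by congr 1; ring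
    _ ≤ |Qhat n ω - q - (fY q)⁻¹ * A| + |(fY q)⁻¹ * A| := abs_add_le _ _
    _ ≤ _ := by
        rw [abs_mul, add_mul, one_mul]
        gcongr

/-- The rate of the estimated coefficients. -/
lemma whp_βhat (hs : IsIIDSample μ X Y) (hd : AreDensities μ (X 0) (Y 0) ν fYX fX fY)
    (hε : ε ∈ Set.Ioo (0 : ℝ) (1 / 2))
    (hm : MatchingAssumption μ X Y fYX fY β ε τ m grid βhat Qhat) {θ : ℝ} (hθ : 0 < θ) :
    ∃ C : ℝ, 0 ≤ C ∧ Whp μ fun n ω => ∀ η ∈ Set.Icc ε (1 - ε),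
      ‖βhat n ω η - β η‖ ≤ C * ((n : ℝ) ^ θ / √(n : ℝ)) := by
  -- The inverse of `J` is uniformly bounded, so the Bahadur representation passes the score rate on
  -- to the coefficients.
  obtain ⟨C, hC0, hC⟩ := exists_bound_inv_mulVec (J := qrMatrix μ (X 0) fYX β)
    (isCompact_Icc (a := ε) (b := 1 - ε)) (fun i j => (hm.J_deriv i j).1.continuousOn)
    hm.J_invertible
  refine ⟨1 + C * 2, by positivity, ?_⟩
  refine ((whp_qrScore hs hd hε hm.linear hm.moment hθ).and
    (whp_of_unifLittleOp hm.bahadur one_pos)).mono ?_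
  filter_upwards [eventually_gt_atTop 0] with n hn
  refine ae_of_all _ fun ω ⟨h1, h2⟩ η hη => ?_
  have hn' : (0 : ℝ) < n := by exact_mod_cast hn
  have hn1 : (1 : ℝ) ≤ n := by exact_mod_cast hn
  have hsp : 0 < √(n : ℝ) := Real.sqrt_pos.2 hn'
  have hl1 : 1 ≤ (n : ℝ) ^ θ := Real.one_le_rpow hn1 hθ.le
  have h3 := h2 η hη
  rw [abs_mul, abs_of_pos hsp, abs_norm] at h3
  set s := (qrMatrix μ (X 0) fYX β η)⁻¹ *ᵥ qrScore X Y β n ω η with hs'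
  have h4 : ‖βhat n ω η - β η - s‖ ≤ (n : ℝ) ^ θ / √(n : ℝ) := by
    rw [le_div_iff₀ hsp, mul_comm]
    linarith
  have h5 : ‖s‖ ≤ C * (2 * ((n : ℝ) ^ θ / √(n : ℝ))) :=
    (hC η hη _).trans (mul_le_mul_of_nonneg_left (h1 η hη) hC0)
  calc ‖βhat n ω η - β η‖ = ‖(βhat n ω η - β η - s) + s‖ := by congr 1; abel
    _ ≤ ‖βhat n ω η - β η - s‖ + ‖s‖ := norm_add_le _ _
    _ ≤ _ := by linarith

/-- The rate of the first step, uniformly over the support of the covariates. -/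
lemma whp_firstStep (hs : IsIIDSample μ X Y) (hd : AreDensities μ (X 0) (Y 0) ν fYX fX fY)
    (hε : ε ∈ Set.Ioo (0 : ℝ) (1 / 2)) (hτ : τ ∈ Set.Ioo (0 : ℝ) 1)
    (hf : IsFirstStep μ X Y ε τ m grid βhat Qhat ξhat)
    (hm : MatchingAssumption μ X Y fYX fY β ε τ m grid βhat Qhat)
    (ha : ApproxAssumption μ X Y fYX β ε τ βhat Qhat ξhat) {θ : ℝ} (hθ : 0 < θ) :
    ∃ C : ℝ, 0 ≤ C ∧ Whp μ fun n ω =>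
      |Qhat n ω - quantile (μ.map (Y 0)) τ| ≤ C * ((n : ℝ) ^ θ / √(n : ℝ)) ∧
      ∀ x ∈ (μ.map (X 0)).support,
        |βhat n ω (ξhat n ω x) 0 - β (matching fYX (quantile (μ.map (Y 0)) τ) x) 0| ≤
          C * ((n : ℝ) ^ θ / √(n : ℝ)) * (1 + ‖x‖) := by
  obtain ⟨Cβ, hCβ0, hβ⟩ := whp_βhat hs hd hε hm hθ
  obtain ⟨L, hL0, hL⟩ := ha.lipschitz
  obtain ⟨Cf', hCf'⟩ := ha.density_bdd
  set Cf := |Cf'| with hCf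
  have hQ := whp_Qhat hs hd hτ hm hθ
  set q := quantile (μ.map (Y 0)) τ with hq
  set CQ := 1 + |(fY q)⁻¹| with hCQ
  set C := CQ + Cβ + L * (1 + Cf * ((d + 1) * Cβ + CQ)) with hC
  have hCQ0 : 0 ≤ CQ := by positivity
  refine ⟨C, by positivity, ?_⟩
  -- The scaled `o_p(1)` remainder is needed only in the form `< 1`: divided by `√n`, it is below
  -- `n^θ/√n`.
  refine ((hβ.and hQ).and (whp_of_unifLittleOp ha.remainder one_pos)).mono ?_
  filter_upwards [eventually_gt_atTop 0] with n hn
  refine ae_of_all _ fun ω ⟨⟨h1, h2⟩, h3⟩ => ?_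
  have hn' : (0 : ℝ) < n := by exact_mod_cast hn
  have hn1 : (1 : ℝ) ≤ n := by exact_mod_cast hn
  have hsp : 0 < √(n : ℝ) := Real.sqrt_pos.2 hn'
  have hl1 : 1 ≤ (n : ℝ) ^ θ := Real.one_le_rpow hn1 hθ.le
  set ρ := (n : ℝ) ^ θ / √(n : ℝ) with hρ
  have hρ0 : 0 ≤ ρ := by positivity
  constructor
  · refine h2.trans (mul_le_mul_of_nonneg_right ?_ hρ0)
    rw [hC]
    have : 0 ≤ Cβ + L * (1 + Cf * ((d + 1) * Cβ + CQ)) := by positivity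
    linarith
  · intro x hx
    obtain ⟨hξ, -, -⟩ := hm.matching_mem hd hε hx
    obtain ⟨j, hj⟩ := (hf.ξhat_match n ω x hx).exists_eq (hm.isGrid n)
    have hξh : ξhat n ω x ∈ Set.Icc ε (1 - ε) := by rw [hj]; exact (hm.isGrid n).mem_Icc j
    have h4 := h3 x hx
    simp only at h4
    rw [← hq] at hξ
    set ξ := matching fYX q x with hξdef
    set ξ' := ξhat n ω x with hξ'
    rw [abs_mul, abs_of_pos hsp] at h4
    set D := fYX (x ⬝ᵥ β ξ) x * (-(x ⬝ᵥ (βhat n ω ξ - β ξ)) + (Qhat n ω - q)) with hD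
    have h5 : |ξ' - ξ - D| ≤ ρ := by
      rw [hρ, le_div_iff₀ hsp, mul_comm]
      linarith
    have hx0 := norm_nonneg x
    have h6 : |D| ≤ Cf * ((d + 1) * ‖x‖ * (Cβ * ρ) + CQ * ρ) := by
      rw [hD, abs_mul]
      have e1 : |fYX (x ⬝ᵥ β ξ) x| ≤ Cf := by
        rw [abs_of_nonneg (hd.fYX_nonneg _ _)]
        exact (hCf' x hx _).trans (le_abs_self _)
      have e2 : |-(x ⬝ᵥ (βhat n ω ξ - β ξ)) + (Qhat n ω - q)| ≤
          (d + 1) * ‖x‖ * (Cβ * ρ) + CQ * ρ := by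
        refine (abs_add_le _ _).trans (add_le_add ?_ h2)
        rw [abs_neg]
        refine (abs_dotProduct_le _ _).trans ?_
        push_cast
        gcongr
        exact h1 ξ hξ
      exact mul_le_mul e1 e2 (abs_nonneg _) (abs_nonneg _)
    have h7 : |ξ' - ξ| ≤ ρ + Cf * ((d + 1) * ‖x‖ * (Cβ * ρ) + CQ * ρ) := by
      calc |ξ' - ξ| = |(ξ' - ξ - D) + D| := by congr 1; ring
        _ ≤ |ξ' - ξ - D| + |D| := abs_add_le _ _
        _ ≤ _ := add_le_add h5 h6
    -- The rate of `βhat` is uniform in the level, so it may be evaluated at the random level `ξ'`.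
    -- The rest is the Lipschitz property of `β₁` applied to the error of the match.
    have h8 : |βhat n ω ξ' 0 - β ξ' 0| ≤ Cβ * ρ :=
      (norm_le_pi_norm (βhat n ω ξ' - β ξ') 0).trans (h1 ξ' hξh)
    calc |βhat n ω ξ' 0 - β ξ 0| = |(βhat n ω ξ' 0 - β ξ' 0) + (β ξ' 0 - β ξ 0)| := by
          congr 1; ring
      _ ≤ |βhat n ω ξ' 0 - β ξ' 0| + |β ξ' 0 - β ξ 0| := abs_add_le _ _
      _ ≤ Cβ * ρ + L * (ρ + Cf * ((d + 1) * ‖x‖ * (Cβ * ρ) + CQ * ρ)) := by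
          refine add_le_add h8 ((hL _ hξh _ hξ).trans ?_)
          gcongr
      _ ≤ (Cβ * ρ + L * (ρ + Cf * ((d + 1) * (Cβ * ρ) + CQ * ρ))) * (1 + ‖x‖) := by
          have t1 : 0 ≤ Cβ * ρ * ‖x‖ := by positivity
          have t2 : 0 ≤ L * ρ * ‖x‖ := by positivity
          have t3 : 0 ≤ L * (Cf * ((d + 1) * (Cβ * ρ))) := by positivity
          have t4 : 0 ≤ L * (Cf * (CQ * ρ)) * ‖x‖ := by positivity
          nlinarith
      _ ≤ C * ρ * (1 + ‖x‖) := by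
          refine mul_le_mul_of_nonneg_right ?_ (by positivity)
          rw [hC]
          have : 0 ≤ CQ * ρ := by positivity
          nlinarith

end FirstStepRates

end UQPE

namespace UQPE

/-! ### Limit theory for kernel sums -/

section KernelAsymptotics

variable {Ω E : Type*} [MeasurableSpace Ω] {μ : Measure Ω}

lemma tendstoInMeasure_zero_iff_whp {R : ℕ → Ω → ℝ} :
    TendstoInMeasure μ R atTop (fun _ => 0) ↔ ∀ δ > 0, Whp μ fun n ω => |R n ω| < δ := by
  refine ⟨fun h δ hδ => whp_of_tendstoInMeasure h hδ, fun h => ?_⟩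
  rw [tendstoInMeasure_iff_norm]
  intro δ hδ
  refine (h δ hδ).congr fun n => ?_
  congr 1
  ext ω
  simp

lemma tendstoInMeasure_zero_add {R S : ℕ → Ω → ℝ} (hR : TendstoInMeasure μ R atTop fun _ => 0)
    (hS : TendstoInMeasure μ S atTop fun _ => 0) :
    TendstoInMeasure μ (fun n ω => R n ω + S n ω) atTop fun _ => 0 := by
  rw [tendstoInMeasure_zero_iff_whp] at *
  intro δ hδ
  refine ((hR (δ / 2) (by linarith)).and (hS (δ / 2) (by linarith))).mono
    (Eventually.of_forall fun n => ae_of_all _ fun ω h => ?_)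
  exact (abs_add_le _ _).trans_lt (by linarith [h.1, h.2])

lemma tendstoInMeasure_zero_const_mul (c : ℝ) {R : ℕ → Ω → ℝ}
    (hR : TendstoInMeasure μ R atTop fun _ => 0) :
    TendstoInMeasure μ (fun n ω => c * R n ω) atTop fun _ => 0 := by
  rw [tendstoInMeasure_zero_iff_whp] at *
  intro δ hδ
  have hc : 0 < |c| + 1 := by positivity
  refine (hR (δ / (|c| + 1)) (by positivity)).mono
    (Eventually.of_forall fun n => ae_of_all _ fun ω h => ?_)
  rw [abs_mul]
  rw [lt_div_iff₀ hc] at h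
  nlinarith [abs_nonneg (R n ω)]

lemma tendstoInMeasure_zero_of_tendsto {c : ℕ → ℝ} (hc : Tendsto c atTop (𝓝 0)) :
    TendstoInMeasure μ (fun n (_ : Ω) => c n) atTop fun _ => 0 := by
  rw [tendstoInMeasure_zero_iff_whp]
  intro δ hδ
  have h0 := hc.abs
  rw [abs_zero] at h0
  refine tendsto_const_nhds.congr' ?_
  filter_upwards [h0.eventually_lt_const hδ] with n hn
  simp [hn]

lemma tendstoInMeasure_zero_mono {R S : ℕ → Ω → ℝ} (hR : TendstoInMeasure μ R atTop fun _ => 0)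
    (h : ∀ᶠ n in atTop, ∀ᵐ ω ∂μ, |S n ω| ≤ |R n ω|) :
    TendstoInMeasure μ S atTop fun _ => 0 := by
  rw [tendstoInMeasure_zero_iff_whp] at *
  intro δ hδ
  refine (hR δ hδ).mono ?_
  filter_upwards [h] with n hn
  filter_upwards [hn] with ω hω h1
  exact hω.trans_lt h1

variable {Z : ℕ → Ω → E} {K : ℝ → ℝ} {h : ℕ → ℝ} {a θ q : ℝ} {r : ℕ}
  {y w : E → ℝ} {M C : ℝ} {m : ℝ → ℝ}

lemma integral_kernel_eq (hK : KernelAssumption K r)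
    (hm : ∀ φ : ℝ → ℝ, Measurable φ → (∃ B, ∀ u, |φ u| ≤ B) →
      ∫ ω, φ (y (Z 0 ω)) * w (Z 0 ω) ∂μ = ∫ u, φ u * m u) (t : ℝ) {b : ℝ} (hb : 0 < b) :
    ∫ ω, K ((y (Z 0 ω) - t) / b) * w (Z 0 ω) ∂μ = b * ∫ u, K u * m (t + b * u) := by
  obtain ⟨B, -, hB⟩ := hK.bdd
  have hKm := hK.continuous.measurable
  rw [hm (fun u => K ((u - t) / b)) (by fun_prop) ⟨B, fun u => hB _⟩, integral_kernel_mul K m t hb]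

lemma integrable_kernel_mul_shift (hK : KernelAssumption K r) (hmc : Continuous m)
    {B : ℝ} (hB : ∀ u, |m u| ≤ B) (t b : ℝ) : Integrable fun u => K u * m (t + b * u) :=
  hK.integrable.mul_bdd (c := B)
    (by exact (by fun_prop : Continuous fun u => m (t + b * u)).aestronglyMeasurable)
    (ae_of_all _ fun u => hB _)

variable [MeasurableSpace E] [IsProbabilityMeasure μ]

/-- Replacing the evaluation point `q` by an estimator does not matter asymptotically. -/
lemma tendstoInMeasure_kernel_sub (hmeas : ∀ i, Measurable (Z i)) (hindep : iIndepFun Z μ)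
    (hident : ∀ i, IdentDistrib (Z i) (Z 0) μ μ) (hK : KernelAssumption K r)
    (hb : BandwidthAssumption h a r)
    (hy : Measurable y) (hw : Measurable w) (hC : 0 ≤ C) (hwM : ∀ z, |w z| ≤ M)
    (hdens : ∀ ψ : ℝ → ENNReal, Measurable ψ →
      ∫⁻ ω, ψ (y (Z 0 ω)) ∂μ ≤ ENNReal.ofReal C * ∫⁻ y, ψ y)
    (hm : ∀ φ : ℝ → ℝ, Measurable φ → (∃ B, ∀ u, |φ u| ≤ B) →
      ∫ ω, φ (y (Z 0 ω)) * w (Z 0 ω) ∂μ = ∫ u, φ u * m u)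
    (hmc : Continuous m) (hmB : ∃ B, ∀ u, |m u| ≤ B)
    (hmL : ∃ L, ∀ u v, |m u - m v| ≤ L * |u - v|)
    (hR1 : Tendsto (fun n : ℕ => √(h n) * (n : ℝ) ^ θ) atTop (𝓝 0))
    (hR2 : Tendsto (fun n : ℕ => (n : ℝ) ^ θ / √(n : ℝ) / h n) atTop (𝓝 0))
    {Qhat : ℕ → Ω → ℝ} {CQ : ℝ} (hCQ : 0 ≤ CQ)
    (hQ : Whp μ fun (n : ℕ) ω => |Qhat n ω - q| ≤ CQ * ((n : ℝ) ^ θ / √(n : ℝ))) :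
    TendstoInMeasure μ (fun (n : ℕ) ω => (√((n : ℝ) * h n))⁻¹ *
      (∑ i ∈ Finset.range n, K ((y (Z i ω) - Qhat n ω) / h n) * w (Z i ω) -
        ∑ i ∈ Finset.range n, K ((y (Z i ω) - q) / h n) * w (Z i ω))) atTop fun _ => 0 := by
  obtain ⟨B, hB⟩ := hmB
  obtain ⟨L', hL'⟩ := hmL
  have hL0 : 0 ≤ L' := by
    have := (abs_nonneg _).trans (hL' 1 0)
    simpa using this
  set b : ℕ → ℝ := fun n => CQ * ((n : ℝ) ^ θ / √(n : ℝ)) with hbdef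
  have hb0 : ∀ n, 0 ≤ b n := fun n => by positivity
  set κ := M ^ 2 * C * ∫ u, deriv K u ^ 2 with hκ
  have hκ0 : 0 ≤ κ := by
    have : 0 ≤ ∫ u, deriv K u ^ 2 := integral_nonneg fun _ => sq_nonneg _
    positivity
  have key := fun n => exists_fluctuation_bound hmeas hindep hident hK hy hw hC hwM hdens q
    (hb.pos n) n (b n)
  choose T hTm hTle hTint using key
  set D : ℕ → ℝ := fun n => √((n : ℝ) * h n) * (L' * b n * ∫ u, |K u|) with hD
  have hKI : 0 ≤ ∫ u, |K u| := integral_nonneg fun _ => abs_nonneg _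
  refine tendstoInMeasure_zero_of_le
    (T := fun n ω => ENNReal.ofReal (√((n : ℝ) * h n))⁻¹ * T n ω + ENNReal.ofReal (D n))
    (fun n => (((hTm n).const_mul _).add_const _).aemeasurable) hQ ?_ ?_
  · filter_upwards [eventually_gt_atTop 0] with n hn
    refine ae_of_all _ fun ω hω => ?_
    have hn' : (0 : ℝ) < n := by exact_mod_cast hn
    have hnh : 0 < (n : ℝ) * h n := mul_pos hn' (hb.pos n)
    have hω' : |Qhat n ω - q| ≤ b n := not_not.1 hω
    have h1 := hTle n ω (Qhat n ω - q) hω'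
    rw [add_sub_cancel] at h1
    set S1 := ∑ i ∈ Finset.range n, K ((y (Z i ω) - Qhat n ω) / h n) * w (Z i ω) with hS1
    set S0 := ∑ i ∈ Finset.range n, K ((y (Z i ω) - q) / h n) * w (Z i ω) with hS0
    rw [Finset.sum_sub_distrib, Finset.sum_sub_distrib, ← hS1, ← hS0] at h1
    simp only [Finset.sum_const, Finset.card_range, nsmul_eq_mul] at h1
    rw [integral_kernel_eq hK hm _ (hb.pos n), integral_kernel_eq hK hm _ (hb.pos n)] at h1
    have h2 := abs_integral_kernel_shift_le hK hL' q (Qhat n ω - q) (h n)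
      (integrable_kernel_mul_shift hK hmc hB _ _) (integrable_kernel_mul_shift hK hmc hB _ _)
    rw [add_sub_cancel] at h2
    set i1 := ∫ u, K u * m (Qhat n ω + h n * u) with hi1
    set i0 := ∫ u, K u * m (q + h n * u) with hi0
    -- The increment splits into a centred part, controlled by the uniform fluctuation bound, and
    -- the movement of the mean, in which `n h` over `√(n h)` leaves `√(n h)`.
    have e : (√((n : ℝ) * h n))⁻¹ * (S1 - S0) =
        (√((n : ℝ) * h n))⁻¹ * (S1 - n * (h n * i1) - (S0 - n * (h n * i0))) +
          √((n : ℝ) * h n) * (i1 - i0) := by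
      have hsq : √((n : ℝ) * h n) * √((n : ℝ) * h n) = n * h n := Real.mul_self_sqrt hnh.le
      have hsp : √((n : ℝ) * h n) ≠ 0 := (Real.sqrt_pos.2 hnh).ne'
      have : √((n : ℝ) * h n) * (i1 - i0) = (√((n : ℝ) * h n))⁻¹ *
          (√((n : ℝ) * h n) * √((n : ℝ) * h n) * (i1 - i0)) := by
        field_simp
      rw [this, hsq]
      ring
    rw [e]
    refine (enorm_add_le _ _).trans (add_le_add ?_ ?_)
    · rw [enorm_mul]
      refine mul_le_mul' ?_ h1
      rw [Real.enorm_of_nonneg (by positivity)]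
    · rw [Real.enorm_eq_ofReal_abs]
      refine ENNReal.ofReal_le_ofReal ?_
      rw [abs_mul, abs_of_nonneg (Real.sqrt_nonneg _)]
      refine mul_le_mul_of_nonneg_left (h2.trans ?_) (Real.sqrt_nonneg _)
      gcongr
  · have hDlim : Tendsto D atTop (𝓝 0) := by
      have := hR1.mul_const (L' * CQ * ∫ u, |K u|)
      rw [zero_mul] at this
      refine this.congr' ?_
      filter_upwards [eventually_gt_atTop 0] with n hn
      have hn' : (0 : ℝ) < n := by exact_mod_cast hn
      have hsp : √(n : ℝ) ≠ 0 := (Real.sqrt_pos.2 hn').ne'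
      simp only [hD, hbdef]
      rw [Real.sqrt_mul hn'.le]
      field_simp
    -- For the centred part, the width `2 b` times `√(n κ / h)` divided by `√(n h)` is `2 b √κ / h`.
    have hFlim : Tendsto (fun n : ℕ => 2 * CQ * √κ * ((n : ℝ) ^ θ / √(n : ℝ) / h n)) atTop (𝓝 0) := by
      simpa using hR2.const_mul (2 * CQ * √κ)
    have hsum := ((ENNReal.continuous_ofReal.tendsto _).comp hFlim).add
      ((ENNReal.continuous_ofReal.tendsto _).comp hDlim)
    simp only [ENNReal.ofReal_zero, add_zero] at hsum
    refine tendsto_of_tendsto_of_tendsto_of_le_of_le' tendsto_const_nhds hsum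
      (Eventually.of_forall fun _ => zero_le) ?_
    filter_upwards [eventually_gt_atTop 0] with n hn
    have hn' : (0 : ℝ) < n := by exact_mod_cast hn
    have hhn := hb.pos n
    rw [lintegral_add_right _ measurable_const, lintegral_const_mul _ (hTm n)]
    simp only [lintegral_const, measure_univ, mul_one, Function.comp]
    refine add_le_add ?_ le_rfl
    refine (mul_le_mul' le_rfl (hTint n)).trans ?_
    rw [← ENNReal.ofReal_mul (by have := hb0 n; positivity), ← ENNReal.ofReal_mul (by positivity)]
    refine ENNReal.ofReal_le_ofReal (le_of_eq ?_)
    have e1 : (n : ℝ) * (M ^ 2 * C * (h n)⁻¹ * ∫ u, deriv K u ^ 2) = n * (h n)⁻¹ * κ := by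
      rw [hκ]; ring
    rw [e1, Real.sqrt_mul' _ hκ0, Real.sqrt_mul hn'.le, Real.sqrt_mul hn'.le, Real.sqrt_inv]
    have hsp : √(n : ℝ) ≠ 0 := (Real.sqrt_pos.2 hn').ne'
    have hsh : √(h n) ≠ 0 := (Real.sqrt_pos.2 hhn).ne'
    have hhh : (h n)⁻¹ = (√(h n))⁻¹ * (√(h n))⁻¹ := by rw [← mul_inv, Real.mul_self_sqrt hhn.le]
    simp only [hbdef]
    rw [div_eq_mul_inv _ (h n), hhh]
    field_simp

/-- Central limit theorem for kernel sums at a fixed evaluation point. -/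
lemma tendstoInDistribution_kernel_sum (hmeas : ∀ i, Measurable (Z i)) (hindep : iIndepFun Z μ)
    (hident : ∀ i, IdentDistrib (Z i) (Z 0) μ μ) (hK : KernelAssumption K r)
    (hb : BandwidthAssumption h a r)
    (hy : Measurable y) (hw : Measurable w) (hwM : ∀ z, |w z| ≤ M)
    (hm : ∀ φ : ℝ → ℝ, Measurable φ → (∃ B, ∀ u, |φ u| ≤ B) →
      ∫ ω, φ (y (Z 0 ω)) * w (Z 0 ω) ∂μ = ∫ u, φ u * m u)
    (hmB : ∃ B, ∀ u, |m u| ≤ B) {m₂ : ℝ → ℝ}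
    (hm₂ : ∀ φ : ℝ → ℝ, Measurable φ → (∃ B, ∀ u, |φ u| ≤ B) →
      ∫ ω, φ (y (Z 0 ω)) * w (Z 0 ω) ^ 2 ∂μ = ∫ u, φ u * m₂ u) (hm₂c : Continuous m₂)
    (hm₂B : ∃ B, ∀ u, |m₂ u| ≤ B) (f₀ : ℝ) :
    TendstoInDistribution (fun (n : ℕ) ω => ∑ i ∈ Finset.range n,
        (f₀ * √((n : ℝ) * h n))⁻¹ * (K ((y (Z i ω) - q) / h n) * w (Z i ω) -
          ∫ ω, K ((y (Z 0 ω) - q) / h n) * w (Z 0 ω) ∂μ)) atTop id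
      (fun _ => μ) (gaussianReal 0 (f₀⁻¹ ^ 2 * (m₂ q * ∫ u, K u ^ 2)).toNNReal) := by
  obtain ⟨CK, hCK0, hCK⟩ := hK.bdd
  obtain ⟨B, hB⟩ := hmB
  obtain ⟨B₂, hB₂⟩ := hm₂B
  have hKm := hK.continuous.measurable
  have hZ0 := hmeas 0
  have hM : 0 ≤ M := by
    obtain ⟨ω⟩ : Nonempty Ω := nonempty_of_isProbabilityMeasure μ
    exact (abs_nonneg _).trans (hwM (Z 0 ω))
  set A : ℕ → ℝ := fun n => ∫ ω, K ((y (Z 0 ω) - q) / h n) * w (Z 0 ω) ∂μ with hA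
  have hkb : ∀ n z, |K ((y z - q) / h n) * w z| ≤ CK * M := fun n z => by
    rw [abs_mul]
    exact mul_le_mul (hCK _) (hwM z) (abs_nonneg _) hCK0
  have hkm : ∀ n, Measurable fun z => K ((y z - q) / h n) * w z := fun n => by fun_prop
  have hki : ∀ n, Integrable (fun ω => K ((y (Z 0 ω) - q) / h n) * w (Z 0 ω)) μ := fun n =>
    Integrable.of_bound ((hkm n).comp hZ0).aestronglyMeasurable (CK * M)
      (ae_of_all _ fun ω => hkb n _)
  have hki2 : ∀ n, Integrable (fun ω => (K ((y (Z 0 ω) - q) / h n) * w (Z 0 ω)) ^ 2) μ := fun n =>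
    Integrable.of_bound (((hkm n).comp hZ0).pow_const 2).aestronglyMeasurable ((CK * M) ^ 2)
      (ae_of_all _ fun ω => by
        rw [Real.norm_eq_abs, abs_pow]
        exact pow_le_pow_left₀ (abs_nonneg _) (hkb n _) 2)
  have hAb : ∀ n, |A n| ≤ CK * M := fun n => by
    have := norm_integral_le_of_norm_le (μ := μ)
      (f := fun ω => K ((y (Z 0 ω) - q) / h n) * w (Z 0 ω)) (integrable_const (CK * M))
      (ae_of_all _ fun ω => hkb n (Z 0 ω))
    simpa [hA] using this
  refine tendstoInDistribution_triangular_array hmeas hindep hident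
    (f := fun n z => (f₀ * √((n : ℝ) * h n))⁻¹ * (K ((y z - q) / h n) * w z - A n))
    (fun n => by have := hkm n; fun_prop)
    (c := fun n => |f₀⁻¹| * √(((n : ℝ) * h n)⁻¹) * (2 * (CK * M))) ?_ ?_ ?_ ?_
  · have h1 := (Real.continuous_sqrt.tendsto _).comp hb.tendsto_inv_mul
    rw [Real.sqrt_zero] at h1
    have := (h1.const_mul |f₀⁻¹|).mul_const (2 * (CK * M))
    simpa using this
  · intro n z
    rw [mul_inv, ← Real.sqrt_inv, abs_mul, abs_mul, abs_of_nonneg (Real.sqrt_nonneg _)]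
    gcongr
    refine (abs_sub _ _).trans ?_
    linarith [hkb n z, hAb n]
  · intro n
    rw [integral_const_mul, integral_sub (hki n) (integrable_const _)]
    simp [hA]
  -- After substitution the raw second moment of a kernel term is of order `h` and the squared mean
  -- of order `h²`. Division by `h` therefore keeps only the former in the limit.
  · have hkey : ∀ n : ℕ, ∫ ω, ((f₀ * √((n : ℝ) * h n))⁻¹ *
        (K ((y (Z 0 ω) - q) / h n) * w (Z 0 ω) - A n)) ^ 2 ∂μ =
        (f₀⁻¹ ^ 2 * ((n : ℝ) * h n)⁻¹) * (h n * (∫ u, K u ^ 2 * m₂ (q + h n * u)) -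
          (h n * ∫ u, K u * m (q + h n * u)) ^ 2) := by
      intro n
      have hhn := hb.pos n
      have e1 : ∀ ω, ((f₀ * √((n : ℝ) * h n))⁻¹ *
          (K ((y (Z 0 ω) - q) / h n) * w (Z 0 ω) - A n)) ^ 2 =
          (f₀⁻¹ ^ 2 * ((n : ℝ) * h n)⁻¹) * ((K ((y (Z 0 ω) - q) / h n) * w (Z 0 ω)) ^ 2 -
            2 * A n * (K ((y (Z 0 ω) - q) / h n) * w (Z 0 ω)) + A n ^ 2) := by
        intro ω
        rw [mul_pow, mul_inv, mul_pow, inv_pow (√((n : ℝ) * h n)), Real.sq_sqrt (by positivity)]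
        ring
      simp_rw [e1]
      rw [integral_const_mul, integral_add (by exact (hki2 n).sub ((hki n).const_mul _))
        (integrable_const _), integral_sub (hki2 n) ((hki n).const_mul _), integral_const_mul]
      have e2 : ∫ ω, (K ((y (Z 0 ω) - q) / h n) * w (Z 0 ω)) ^ 2 ∂μ =
          h n * ∫ u, K u ^ 2 * m₂ (q + h n * u) := by
        simp_rw [mul_pow]
        rw [hm₂ (fun u => K ((u - q) / h n) ^ 2) (by fun_prop) ⟨CK ^ 2, fun u => by
          rw [abs_pow]; exact pow_le_pow_left₀ (abs_nonneg _) (hCK _) 2⟩]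
        exact integral_kernel_mul (fun u => K u ^ 2) m₂ q hhn
      have e3 : A n = h n * ∫ u, K u * m (q + h n * u) := integral_kernel_eq hK hm q hhn
      rw [e2]
      have e4 : ∫ ω, K ((y (Z 0 ω) - q) / h n) * w (Z 0 ω) ∂μ = A n := rfl
      rw [e4, ← e3]
      simp only [integral_const, probReal_univ, one_smul]
      ring
    simp_rw [hkey]
    have hlimm₂ : Tendsto (fun n => ∫ u, K u ^ 2 * m₂ (q + h n * u)) atTop
        (𝓝 (∫ u, K u ^ 2 * m₂ q)) := by
      refine tendsto_integral_filter_of_dominated_convergence (fun u => K u ^ 2 * B₂)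
        (Eventually.of_forall fun n => ?_) (Eventually.of_forall fun n => ae_of_all _ fun u => ?_)
        (hK.integrable_sq.mul_const _) (ae_of_all _ fun u => ?_)
      · have := hK.continuous
        exact (by fun_prop : Continuous fun u => K u ^ 2 * m₂ (q + h n * u)).aestronglyMeasurable
      · rw [norm_mul, Real.norm_of_nonneg (sq_nonneg _)]
        exact mul_le_mul_of_nonneg_left (hB₂ _) (sq_nonneg _)
      · refine Tendsto.const_mul _ ((hm₂c.tendsto q).comp ?_)
        have := (hb.tendsto_zero.mul_const u).const_add q
        simpa using this
    rw [integral_mul_const, mul_comm _ (m₂ q)] at hlimm₂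
    have hbd : ∀ n, |∫ u, K u * m (q + h n * u)| ≤ ∫ u, |K u| * B := fun n => by
      rw [← Real.norm_eq_abs]
      refine norm_integral_le_of_norm_le (hK.integrable.abs.mul_const _) (ae_of_all _ fun u => ?_)
      rw [Real.norm_eq_abs, abs_mul]
      exact mul_le_mul_of_nonneg_left (hB _) (abs_nonneg _)
    have hsqlim : Tendsto (fun n => h n * (∫ u, K u * m (q + h n * u)) ^ 2) atTop (𝓝 0) := by
      have h1 := hb.tendsto_zero.mul_const ((∫ u, |K u| * B) ^ 2)
      rw [zero_mul] at h1
      refine squeeze_zero (fun n => mul_nonneg (hb.pos n).le (sq_nonneg _)) (fun n => ?_) h1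
      refine mul_le_mul_of_nonneg_left ?_ (hb.pos n).le
      rw [← sq_abs]
      exact pow_le_pow_left₀ (abs_nonneg _) (hbd n) 2
    have hlim := (hlimm₂.sub hsqlim).const_mul (f₀⁻¹ ^ 2)
    rw [sub_zero] at hlim
    refine hlim.congr' ?_
    filter_upwards [eventually_gt_atTop 0] with n hn
    have hn' : (n : ℝ) ≠ 0 := by exact_mod_cast hn.ne'
    have hhn := (hb.pos n).ne'
    rw [mul_inv]
    field_simp

/-- Consistency of the kernel density estimator. -/
lemma tendstoInMeasure_kernel_density (hmeas : ∀ i, Measurable (Z i)) (hindep : iIndepFun Z μ)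
    (hident : ∀ i, IdentDistrib (Z i) (Z 0) μ μ) (hK : KernelAssumption K r)
    (hb : BandwidthAssumption h a r) (hr : 1 ≤ r)
    (hy : Measurable y) (hC : 0 ≤ C)
    (hdens : ∀ ψ : ℝ → ENNReal, Measurable ψ →
      ∫⁻ ω, ψ (y (Z 0 ω)) ∂μ ≤ ENNReal.ofReal C * ∫⁻ y, ψ y)
    (hm : ∀ φ : ℝ → ℝ, Measurable φ → (∃ B, ∀ u, |φ u| ≤ B) →
      ∫ ω, φ (y (Z 0 ω)) * 1 ∂μ = ∫ u, φ u * m u)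
    (hmB : ∃ B, ∀ u, |m u| ≤ B) (hmr : ContDiff ℝ r m)
    (hmD : ∃ B, ∀ u, |iteratedDeriv r m u| ≤ B) :
    TendstoInMeasure μ (fun (n : ℕ) ω => ((n : ℝ) * h n)⁻¹ *
      (∑ i ∈ Finset.range n, K ((y (Z i ω) - q) / h n)) - m q) atTop fun _ => 0 := by
  obtain ⟨B, hB⟩ := hmB
  obtain ⟨D, hD⟩ := hmD
  have hKm := hK.continuous.measurable
  have hZ0 := hmeas 0
  set A : ℕ → ℝ := fun n => ∫ ω, K ((y (Z 0 ω) - q) / h n) ∂μ with hA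
  have hAe : ∀ n, A n = h n * ∫ u, K u * m (q + h n * u) := fun n => by
    have := integral_kernel_eq (Z := Z) (w := fun _ => 1) hK hm q (hb.pos n)
    simpa [hA] using this
  have hbias : Tendsto (fun n => (∫ u, K u * m (q + h n * u)) - m q) atTop (𝓝 0) := by
    have h1 : Tendsto (fun n => D * (∫ u, |u| ^ r * |K u|) * h n ^ r) atTop (𝓝 0) := by
      have := (hb.tendsto_zero.pow r).const_mul (D * (∫ u, |u| ^ r * |K u|))
      rwa [zero_pow (by omega), mul_zero] at this
    refine squeeze_zero_norm (fun n => ?_) h1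
    exact abs_integral_kernel_sub_le hK hr hmr hD q (hb.pos n)
      (integrable_kernel_mul_shift hK hmr.continuous hB _ _)
  have hfl : TendstoInMeasure μ (fun (n : ℕ) ω => ((n : ℝ) * h n)⁻¹ *
      ∑ i ∈ Finset.range n, (K ((y (Z i ω) - q) / h n) - A n)) atTop fun _ => 0 := by
    refine tendstoInMeasure_zero_of_le (bad := fun _ => ∅)
      (T := fun n ω => ENNReal.ofReal ((n : ℝ) * h n)⁻¹ *
        ‖∑ i ∈ Finset.range n, (K ((y (Z i ω) - q) / h n) - A n)‖ₑ)
      (fun n => ?_) (by simp) (Eventually.of_forall fun n => ae_of_all _ fun ω _ => ?_) ?_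
    · refine (Measurable.const_mul (Measurable.enorm (Finset.measurable_sum _ fun i _ => ?_)) _).aemeasurable
      have := hmeas i
      fun_prop
    · have := (hb.pos n).le
      rw [enorm_mul, Real.enorm_of_nonneg (by positivity)]
    · have hlim : Tendsto (fun n : ℕ => √(C * ∫ u, K u ^ 2) * √(((n : ℝ) * h n)⁻¹)) atTop (𝓝 0) := by
        have h1 := (Real.continuous_sqrt.tendsto _).comp hb.tendsto_inv_mul
        rw [Real.sqrt_zero] at h1
        simpa using h1.const_mul √(C * ∫ u, K u ^ 2)
      have hlim' := (ENNReal.continuous_ofReal.tendsto _).comp hlim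
      rw [ENNReal.ofReal_zero] at hlim'
      refine tendsto_of_tendsto_of_tendsto_of_le_of_le' tendsto_const_nhds hlim'
        (Eventually.of_forall fun _ => zero_le) ?_
      filter_upwards [eventually_gt_atTop 0] with n hn
      have hn' : (0 : ℝ) < n := by exact_mod_cast hn
      have hhn := hb.pos n
      have hsq := integral_sq_kernel_le (μ := μ) hKm hK.integrable_sq (hy.comp hZ0)
        (W := fun _ => 1) measurable_const hC (M := 1) (fun ω => by simp) hdens q hhn
      simp only [mul_one, Function.comp, one_pow, one_mul] at hsq
      have hfl := lintegral_enorm_sum_sub_le hindep hident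
        (f := fun z => K ((y z - q) / h n)) (by fun_prop) hsq.1 n
      rw [lintegral_const_mul _ (Measurable.enorm (Finset.measurable_sum _ fun i _ => by
        have := hmeas i
        fun_prop))]
      refine (mul_le_mul' le_rfl hfl).trans ?_
      rw [← ENNReal.ofReal_mul (by positivity)]
      refine ENNReal.ofReal_le_ofReal ?_
      have hnh : 0 < (n : ℝ) * h n := by positivity
      -- The standard deviation of the unnormalized sum is `O(√(n h))`, so the density estimator
      -- fluctuates at order `(n h)^(-1/2)`.
      calc ((n : ℝ) * h n)⁻¹ * √(n * ∫ ω, K ((y (Z 0 ω) - q) / h n) ^ 2 ∂μ)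
          ≤ ((n : ℝ) * h n)⁻¹ * √((C * ∫ u, K u ^ 2) * (n * h n)) := by
            refine mul_le_mul_of_nonneg_left (Real.sqrt_le_sqrt ?_) (by positivity)
            calc (n : ℝ) * ∫ ω, K ((y (Z 0 ω) - q) / h n) ^ 2 ∂μ
                ≤ n * (C * h n * ∫ u, K u ^ 2) := mul_le_mul_of_nonneg_left hsq.2 hn'.le
              _ = _ := by ring
        _ = √(C * ∫ u, K u ^ 2) * √(((n : ℝ) * h n)⁻¹) := by
            rw [Real.sqrt_mul' _ hnh.le, Real.sqrt_inv]
            have e : ((n : ℝ) * h n)⁻¹ = (√((n : ℝ) * h n))⁻¹ * (√((n : ℝ) * h n))⁻¹ := by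
              rw [← mul_inv, Real.mul_self_sqrt hnh.le]
            have hsp : √((n : ℝ) * h n) ≠ 0 := (Real.sqrt_pos.2 hnh).ne'
            rw [e]
            field_simp
  refine tendstoInMeasure_zero_mono
    (tendstoInMeasure_zero_add hfl (tendstoInMeasure_zero_of_tendsto hbias)) ?_
  filter_upwards [eventually_gt_atTop 0] with n hn
  refine ae_of_all _ fun ω => le_of_eq ?_
  have hn' : (n : ℝ) ≠ 0 := by exact_mod_cast hn.ne'
  have hhn := (hb.pos n).ne'
  congr 1
  rw [Finset.sum_sub_distrib, Finset.sum_const, Finset.card_range, nsmul_eq_mul, hAe]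
  field_simp
  ring

end KernelAsymptotics

end UQPE

namespace UQPE

/-! ### A Slutsky theorem for ratios -/

section Slutsky

variable {Ω : Type*} [MeasurableSpace Ω] {μ : Measure Ω}

lemma tendstoInMeasure_const_iff {D : ℕ → Ω → ℝ} {c : ℝ} :
    TendstoInMeasure μ D atTop (fun _ => c) ↔
      TendstoInMeasure μ (fun n ω => D n ω - c) atTop fun _ => 0 := by
  simp only [tendstoInMeasure_iff_norm, sub_zero]

/-- Slutsky's theorem for quotients whose denominator converges to a positive constant. -/
lemma tendstoInDistribution_ratio [IsProbabilityMeasure μ] {N D T : ℕ → Ω → ℝ} {f₀ : ℝ}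
    {P : Measure ℝ} [IsProbabilityMeasure P] (hf₀ : 0 < f₀)
    (hN : TendstoInDistribution N atTop id (fun _ => μ) P)
    (hD : TendstoInMeasure μ D atTop fun _ => f₀) (hDm : ∀ n, AEMeasurable (D n) μ)
    (hTm : ∀ n, AEMeasurable (T n) μ)
    (hT : ∀ᶠ n in atTop, ∀ᵐ ω ∂μ, D n ω ≠ 0 → T n ω = N n ω * f₀ / D n ω) :
    TendstoInDistribution T atTop id (fun _ => μ) P := by
  have hmax : ∀ t : ℝ, max t (f₀ / 2) ≠ 0 := fun t =>
    ((by linarith : 0 < f₀ / 2).trans_le (le_max_right _ _)).ne'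
  -- Truncating the denominator at `f₀ / 2` makes the quotient continuous on the whole plane. The
  -- truncation is inactive with probability tending to one.
  have hcont : Continuous fun p : ℝ × ℝ => p.1 * f₀ / max p.2 (f₀ / 2) :=
    Continuous.div (by fun_prop) (by fun_prop) fun p => hmax _
  have h1 := hN.continuous_comp_prodMk_of_tendstoInMeasure_const hcont hD hDm
  have h2 : (fun t : ℝ => id t * f₀ / max f₀ (f₀ / 2)) = id := by
    funext t
    rw [max_eq_left (by linarith), mul_div_cancel_right₀ _ hf₀.ne']
  have h3 : TendstoInDistribution (fun n ω => N n ω * f₀ / max (D n ω) (f₀ / 2)) atTop id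
      (fun _ => μ) P := by
    rw [← h2]
    exact h1
  refine tendstoInDistribution_of_tendstoInMeasure_sub T id h3 ?_ hTm
  refine tendstoInMeasure_zero_iff_whp.2 fun δ hδ => ?_
  refine (whp_of_tendstoInMeasure (tendstoInMeasure_const_iff.1 hD)
    (by linarith : 0 < f₀ / 2)).mono ?_
  filter_upwards [hT] with n hn
  filter_upwards [hn] with ω hω h
  have hD' : f₀ / 2 < D n ω := by
    have := (abs_lt.1 h).1
    linarith
  rw [Pi.sub_apply, Pi.sub_apply, hω (by linarith), max_eq_left hD'.le, sub_self, abs_zero]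
  exact hδ

end Slutsky

/-! ### Measurability and the first-step error in the numerator -/

section Assembly

variable {Ω : Type*} [MeasurableSpace Ω] {μ : Measure Ω} {d : ℕ}
  {X : ℕ → Ω → Fin (d + 1) → ℝ} {Y : ℕ → Ω → ℝ} {ν : Measure (Fin (d + 1) → ℝ)}
  {fYX : ℝ → (Fin (d + 1) → ℝ) → ℝ} {fX : (Fin (d + 1) → ℝ) → ℝ} {fY : ℝ → ℝ}
  {β : ℝ → Fin (d + 1) → ℝ} {ε τ : ℝ} {m : ℕ → ℕ} {grid : (n : ℕ) → Fin (m n + 1) → ℝ}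
  {βhat : ℕ → Ω → ℝ → Fin (d + 1) → ℝ} {Qhat : ℕ → Ω → ℝ}
  {ξhat : ℕ → Ω → (Fin (d + 1) → ℝ) → ℝ} {K : ℝ → ℝ} {h : ℕ → ℝ} {r : ℕ} {a : ℝ}

/-- On the support of `X`, the matched slope agrees with a bounded measurable function. -/
lemma exists_measurable_slope (hd : AreDensities μ (X 0) (Y 0) ν fYX fX fY)
    (hε : ε ∈ Set.Ioo (0 : ℝ) (1 / 2))
    (hm : MatchingAssumption μ X Y fYX fY β ε τ m grid βhat Qhat)
    (ha : ApproxAssumption μ X Y fYX β ε τ βhat Qhat ξhat) :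
    ∃ v : (Fin (d + 1) → ℝ) → ℝ, Measurable v ∧ (∃ M, ∀ x, |v x| ≤ M) ∧
      ∀ x ∈ (μ.map (X 0)).support, β (matching fYX (quantile (μ.map (Y 0)) τ) x) 0 = v x := by
  set q := quantile (μ.map (Y 0)) τ with hq
  have hεε : ε ≤ 1 - ε := by linarith [hε.2]
  have hc : ContinuousOn (fun η => β η 0) (Set.Icc ε (1 - ε)) :=
    ha.slope_differentiable.continuousOn
  -- The slope is continuous only on `[ε, 1 - ε]`. Extending it by constants and composing with the
  -- conditional distribution function at `q`, measurable in `x`, gives a function defined and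
  -- bounded everywhere.
  set b : ℝ → ℝ := Set.IccExtend hεε ((Set.Icc ε (1 - ε)).domRestrict fun η => β η 0) with hb
  have hbc : Continuous b := Continuous.Icc_extend' (continuousOn_iff_continuous_domRestrict.1 hc)
  obtain ⟨M, hM⟩ := isCompact_Icc.exists_bound_of_continuousOn hc
  have hp : Measurable fun x => (condLaw fYX x).real (Set.Iic q) := by
    have e : (fun x => (condLaw fYX x).real (Set.Iic q)) =
        fun x => (∫⁻ y in Set.Iic q, ENNReal.ofReal (fYX y x)).toReal := by
      funext x
      rw [measureReal_def, condLaw, withDensity_apply _ measurableSet_Iic]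
    rw [e]
    refine Measurable.ennreal_toReal ?_
    exact Measurable.lintegral_prod_left' (f := fun p : ℝ × (Fin (d + 1) → ℝ) =>
      ENNReal.ofReal (fYX p.1 p.2)) hd.measurable_fYX.ennreal_ofReal
  refine ⟨fun x => b ((condLaw fYX x).real (Set.Iic q)), hbc.measurable.comp hp,
    ⟨M, fun x => hM _ (Set.projIcc ε (1 - ε) hεε _).2⟩, fun x hx => ?_⟩
  obtain ⟨h1, h2, -⟩ := hm.matching_mem hd hε hx
  rw [← hq] at h1 h2
  change _ = b ((condLaw fYX x).real (Set.Iic q))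
  rw [← h2, hb, Set.IccExtend_of_mem _ _ h1]
  rfl

/-- Measurability of `βhat` is assumed at fixed levels only. As the estimated match takes finitely
many grid values, the composition is almost surely a finite sum of measurable pieces. -/
lemma aemeasurable_slopeHat (hs : IsIIDSample μ X Y)
    (hf : IsFirstStep μ X Y ε τ m grid βhat Qhat ξhat) (hg : ∀ n, IsGrid ε (grid n)) (n i : ℕ) :
    AEMeasurable (fun ω => βhat n ω (ξhat n ω (X i ω)) 0) μ := by
  classical
  refine ⟨fun ω => ∑ j, {ω | ξhat n ω (X i ω) = grid n j}.indicator
    (fun ω => βhat n ω (grid n j) 0) ω, ?_, ?_⟩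
  · refine Finset.measurable_sum _ fun j _ => Measurable.indicator ?_ ?_
    · exact (measurable_pi_apply 0).comp (hf.βhat_measurable n _ ((hg n).mem_Icc j))
    · exact hf.ξhat_measurable n i (measurableSet_singleton (grid n j))
  · filter_upwards [hs.ae_mem_support i] with ω hω
    obtain ⟨j, hj⟩ := (hf.ξhat_match n ω _ hω).exists_eq (hg n)
    rw [Finset.sum_eq_single j]
    · rw [Set.indicator_of_mem (by exact hj), hj]
    · intro k _ hk
      refine Set.indicator_of_notMem ?_ _
      intro hk'
      have hk'' : ξhat n ω (X i ω) = grid n k := hk'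
      exact hk ((hg n).strictMono.injective (hk''.symm.trans hj))
    · simp

lemma aemeasurable_kernel_sum (hs : IsIIDSample μ X Y) (hK : KernelAssumption K r)
    (hf : IsFirstStep μ X Y ε τ m grid βhat Qhat ξhat) (n : ℕ) {W : ℕ → Ω → ℝ}
    (hW : ∀ i, AEMeasurable (W i) μ) :
    AEMeasurable (fun ω => ∑ i ∈ Finset.range n, K ((Y i ω - Qhat n ω) / h n) * W i ω) μ := by
  have hKm := hK.continuous.measurable
  refine Finset.aemeasurable_fun_sum _ fun i _ => AEMeasurable.mul ?_ (hW i)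
  have h1 := hs.measurable_Y i
  have h2 := hf.Qhat_measurable n
  exact (by fun_prop : Measurable fun ω => K ((Y i ω - Qhat n ω) / h n)).aemeasurable

lemma aemeasurable_uqpeHat (hs : IsIIDSample μ X Y) (hK : KernelAssumption K r)
    (hf : IsFirstStep μ X Y ε τ m grid βhat Qhat ξhat) (hg : ∀ n, IsGrid ε (grid n)) (n : ℕ) :
    AEMeasurable (uqpeHat X Y K h βhat Qhat ξhat n) μ := by
  have h1 := (aemeasurable_kernel_sum (h := h) hs hK hf n
    (aemeasurable_slopeHat hs hf hg n)).const_mul (h n)⁻¹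
  have h2 := (aemeasurable_kernel_sum (h := h) hs hK hf n
    (W := fun _ _ => 1) fun _ => aemeasurable_const).const_mul (h n)⁻¹
  refine (h1.div h2).congr (ae_of_all _ fun ω => ?_)
  simp only [uqpeHat, Finset.mul_sum, Pi.div_apply, mul_one, mul_assoc]

variable [IsProbabilityMeasure μ]

/-- Weights that are of smaller order than `(n h)^{-1/2}` times `1 + ‖X‖` do not contribute to the
limit of normalized kernel sums. -/
lemma tendstoInMeasure_kernel_error (hs : IsIIDSample μ X Y)
    (hd : AreDensities μ (X 0) (Y 0) ν fYX fX fY) (hX : Integrable (X 0) μ)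
    (hK : KernelAssumption K r) (hb : BandwidthAssumption h a r) {C₁ : ℝ} (hC₁ : 0 ≤ C₁)
    (hdb : ∀ x ∈ (μ.map (X 0)).support, ∀ y, fYX y x ≤ C₁) {θ q C : ℝ} (hC : 0 ≤ C)
    (hR1 : Tendsto (fun n : ℕ => √(h n) * (n : ℝ) ^ θ) atTop (𝓝 0))
    (hR2 : Tendsto (fun n : ℕ => (n : ℝ) ^ θ / √(n : ℝ) / h n) atTop (𝓝 0))
    {R : ℕ → Ω → (Fin (d + 1) → ℝ) → ℝ}
    (hR : Whp μ fun (n : ℕ) ω => |Qhat n ω - q| ≤ C * ((n : ℝ) ^ θ / √(n : ℝ)) ∧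
      ∀ x ∈ (μ.map (X 0)).support, |R n ω x| ≤ C * ((n : ℝ) ^ θ / √(n : ℝ)) * (1 + ‖x‖)) :
    TendstoInMeasure μ (fun (n : ℕ) ω => (√((n : ℝ) * h n))⁻¹ *
      ∑ i ∈ Finset.range n, K ((Y i ω - Qhat n ω) / h n) * R n ω (X i ω)) atTop fun _ => 0 := by
  have henv := measurable_kernelEnvelope hK
  have hY0 := hs.measurable_Y 0
  have hX0 := hs.measurable_X 0
  set I := ∫⁻ u, kernelEnvelope K u with hI
  have hIt : I ≠ ⊤ := lintegral_kernelEnvelope_ne_top hK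
  set A := ∫⁻ ω, ENNReal.ofReal (1 + ‖X 0 ω‖) ∂μ with hA
  have hAt : A ≠ ⊤ := ((integrable_const (1 : ℝ)).add hX.norm).lintegral_lt_top.ne
  have hterm : ∀ (n i : ℕ), Measurable fun ω =>
      kernelEnvelope K ((Y i ω - q) / h n) * ENNReal.ofReal (1 + ‖X i ω‖) := fun n i => by
    have := hs.measurable_Y i
    have := hs.measurable_X i
    fun_prop
  refine tendstoInMeasure_zero_of_le (T := fun (n : ℕ) ω =>
    ENNReal.ofReal ((√((n : ℝ) * h n))⁻¹ * (C * ((n : ℝ) ^ θ / √(n : ℝ)))) *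
      ∑ i ∈ Finset.range n,
        kernelEnvelope K ((Y i ω - q) / h n) * ENNReal.ofReal (1 + ‖X i ω‖))
    (fun n => ((Finset.measurable_sum _ fun i _ => hterm n i).const_mul _).aemeasurable) hR ?_ ?_
  · have hsmall := hR2.const_mul C
    rw [mul_zero] at hsmall
    filter_upwards [hsmall.eventually_le_const one_pos] with n hn
    filter_upwards [ae_all_iff.2 hs.ae_mem_support] with ω hω hgood
    obtain ⟨hQ, hRω⟩ := not_not.1 hgood
    have hhn := hb.pos n
    rw [enorm_mul, Real.enorm_of_nonneg (by positivity), ENNReal.ofReal_mul (by positivity),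
      mul_assoc, Finset.mul_sum]
    refine mul_le_mul' le_rfl ((enorm_sum_le _ _).trans (Finset.sum_le_sum fun i _ => ?_))
    have e : (Y i ω - Qhat n ω) / h n = (Y i ω - q) / h n + (q - Qhat n ω) / h n := by ring
    have hδ : |(q - Qhat n ω) / h n| ≤ 1 := by
      rw [abs_div, abs_of_pos hhn, abs_sub_comm]
      refine le_trans ?_ hn
      rw [← mul_div_assoc]
      gcongr
    rw [enorm_mul, e, mul_left_comm, ← ENNReal.ofReal_mul (by positivity)]
    refine mul_le_mul' (enorm_kernel_add_le hK _ hδ) ?_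
    rw [Real.enorm_eq_ofReal_abs]
    exact ENNReal.ofReal_le_ofReal (hRω _ (hω i))
  · have hlim : Tendsto (fun n : ℕ => C * C₁ * I.toReal * A.toReal * (√(h n) * (n : ℝ) ^ θ))
        atTop (𝓝 0) := by simpa using hR1.const_mul (C * C₁ * I.toReal * A.toReal)
    have hlim' := (ENNReal.continuous_ofReal.tendsto _).comp hlim
    rw [ENNReal.ofReal_zero] at hlim'
    refine tendsto_of_tendsto_of_tendsto_of_le_of_le' tendsto_const_nhds hlim'
      (Eventually.of_forall fun _ => zero_le) ?_
    filter_upwards [eventually_gt_atTop 0] with n hn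
    have hn' : (0 : ℝ) < n := by exact_mod_cast hn
    have hhn := hb.pos n
    -- The bound on the conditional density decouples the kernel window in `Y` from the weight `1 +
    -- ‖X‖`, leaving one factor `h`.
    have hone : ∀ i, ∫⁻ ω, kernelEnvelope K ((Y i ω - q) / h n) *
        ENNReal.ofReal (1 + ‖X i ω‖) ∂μ ≤ ENNReal.ofReal (C₁ * (h n * I.toReal) * A.toReal) := by
      intro i
      have h1 : ∫⁻ ω, kernelEnvelope K ((Y i ω - q) / h n) * ENNReal.ofReal (1 + ‖X i ω‖) ∂μ =
          ∫⁻ ω, kernelEnvelope K ((Y 0 ω - q) / h n) * ENNReal.ofReal (1 + ‖X 0 ω‖) ∂μ :=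
        ((hs.ident i).comp (u := fun z : (Fin (d + 1) → ℝ) × ℝ =>
          kernelEnvelope K ((z.2 - q) / h n) * ENNReal.ofReal (1 + ‖z.1‖))
            (by fun_prop)).lintegral_eq
      rw [h1]
      refine (hd.lintegral_mul_le hX0 hY0 hdb (φ := fun y => kernelEnvelope K ((y - q) / h n))
        (by fun_prop) (ψ := fun x => ENNReal.ofReal (1 + ‖x‖)) (by fun_prop)).trans ?_
      rw [lintegral_comp_sub_div _ henv q hhn, ENNReal.ofReal_mul (by positivity),
        ENNReal.ofReal_mul hC₁, ENNReal.ofReal_mul hhn.le, ENNReal.ofReal_toReal hIt,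
        ENNReal.ofReal_toReal hAt]
    rw [lintegral_const_mul _ (Finset.measurable_sum _ fun i _ => hterm n i),
      lintegral_finsetSum _ fun i _ => hterm n i]
    refine (mul_le_mul' le_rfl (Finset.sum_le_sum fun i _ => hone i)).trans ?_
    rw [Finset.sum_const, Finset.card_range, nsmul_eq_mul, ← ENNReal.ofReal_natCast,
      ← ENNReal.ofReal_mul hn'.le, ← ENNReal.ofReal_mul (by positivity)]
    refine ENNReal.ofReal_le_ofReal (le_of_eq ?_)
    have hsp : √(n : ℝ) ≠ 0 := (Real.sqrt_pos.2 hn').ne'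
    have hsh : √(h n) ≠ 0 := (Real.sqrt_pos.2 hhn).ne'
    have e1 : (n : ℝ) * (C₁ * (h n * I.toReal) * A.toReal) =
        (√(n : ℝ) * √(n : ℝ)) * (√(h n) * √(h n)) * (C₁ * I.toReal * A.toReal) := by
      rw [Real.mul_self_sqrt hn'.le, Real.mul_self_sqrt hhn.le]
      ring
    rw [e1, Real.sqrt_mul hn'.le]
    field_simp

end Assembly

end UQPE

namespace UQPE

/-! ### Limits of the denominator and the numerator -/

section Limits

lemma SmoothBddDeriv.sub_const {k : ℕ} {g : ℝ → ℝ} (hg : SmoothBddDeriv k g) (c : ℝ) :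
    SmoothBddDeriv k fun y => g y - c := by
  refine ⟨hg.1.sub contDiff_const, fun j hj hjk => ?_⟩
  obtain ⟨C, hC⟩ := hg.2 j hj hjk
  refine ⟨C, fun y => ?_⟩
  obtain ⟨i, rfl⟩ : ∃ i, j = i + 1 := ⟨j - 1, by omega⟩
  have e : iteratedDeriv (i + 1) (fun y => g y - c) = iteratedDeriv (i + 1) g := by
    rw [iteratedDeriv_succ', iteratedDeriv_succ']
    congr 1
    funext z
    exact deriv_sub_const _
  rw [e]
  exact hC y

variable {Ω : Type*} [MeasurableSpace Ω] {μ : Measure Ω} [IsProbabilityMeasure μ] {d : ℕ}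
  {X : ℕ → Ω → Fin (d + 1) → ℝ} {Y : ℕ → Ω → ℝ} {ν : Measure (Fin (d + 1) → ℝ)}
  {fYX : ℝ → (Fin (d + 1) → ℝ) → ℝ} {fX : (Fin (d + 1) → ℝ) → ℝ} {fY : ℝ → ℝ}
  {β : ℝ → Fin (d + 1) → ℝ} {ε τ : ℝ} {m : ℕ → ℕ} {grid : (n : ℕ) → Fin (m n + 1) → ℝ}
  {βhat : ℕ → Ω → ℝ → Fin (d + 1) → ℝ} {Qhat : ℕ → Ω → ℝ}
  {ξhat : ℕ → Ω → (Fin (d + 1) → ℝ) → ℝ} {K : ℝ → ℝ} {h : ℕ → ℝ} {r : ℕ} {a : ℝ}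

/-- The existence of a match places `q` between the outermost conditional quantiles at every support
point, where the conditional density is bounded away from zero. -/
lemma fY_quantile_pos (hs : IsIIDSample μ X Y) (hd : AreDensities μ (X 0) (Y 0) ν fYX fX fY)
    (hε : ε ∈ Set.Ioo (0 : ℝ) (1 / 2))
    (hm : MatchingAssumption μ X Y fYX fY β ε τ m grid βhat Qhat)
    (hdd : DensityAssumption μ (X 0) fYX fX fY r) : 0 < fY (quantile (μ.map (Y 0)) τ) := by
  refine hd.fY_pos (hs.measurable_X 0) (hs.measurable_Y 0) hdd.smooth_fY.1.continuous
    (fun x hx => (hdd.smooth_joint x hx).1.continuous) fun x hx => ?_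
  obtain ⟨c, hc, hcx⟩ := hm.density_pos x hx
  exact hc.trans_le (hcx _ (hm.matching_mem hd hε hx).2.2)

/-- Consistency of the kernel density estimator at an estimated evaluation point. -/
lemma tendstoInMeasure_density_estimator (hs : IsIIDSample μ X Y)
    (hd : AreDensities μ (X 0) (Y 0) ν fYX fX fY) (hK : KernelAssumption K r)
    (hb : BandwidthAssumption h a r) (hr : 1 ≤ r) {C₁ : ℝ} (hC₁ : 0 ≤ C₁)
    (hdb : ∀ x ∈ (μ.map (X 0)).support, ∀ y, fYX y x ≤ C₁)
    (hfY : SmoothBddDeriv (r + 1) fY) {θ q C : ℝ} (hC : 0 ≤ C)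
    (hR1 : Tendsto (fun n : ℕ => √(h n) * (n : ℝ) ^ θ) atTop (𝓝 0))
    (hR2 : Tendsto (fun n : ℕ => (n : ℝ) ^ θ / √(n : ℝ) / h n) atTop (𝓝 0))
    (hQ : Whp μ fun (n : ℕ) ω => |Qhat n ω - q| ≤ C * ((n : ℝ) ^ θ / √(n : ℝ))) :
    TendstoInMeasure μ (fun (n : ℕ) ω => ((n : ℝ) * h n)⁻¹ *
      ∑ i ∈ Finset.range n, K ((Y i ω - Qhat n ω) / h n)) atTop fun _ => fY q := by
  have hY0 := hs.measurable_Y 0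
  have hmeas : ∀ i, Measurable fun ω => (X i ω, Y i ω) := fun i =>
    (hs.measurable_X i).prodMk (hs.measurable_Y i)
  have hdens : ∀ ψ : ℝ → ENNReal, Measurable ψ →
      ∫⁻ ω, ψ (Y 0 ω) ∂μ ≤ ENNReal.ofReal C₁ * ∫⁻ y, ψ y := fun ψ hψ =>
    hd.lintegral_le (hs.measurable_X 0) hY0 hdb hψ
  have hmom : ∀ φ : ℝ → ℝ, Measurable φ → (∃ B, ∀ u, |φ u| ≤ B) →
      ∫ ω, φ (Y 0 ω) * 1 ∂μ = ∫ u, φ u * fY u := fun φ hφ _ => by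
    simp_rw [mul_one]
    exact hd.integral_fY_eq hY0 hφ
  have hB : ∃ B, ∀ u, |fY u| ≤ B := ⟨C₁, fun u => by
    rw [abs_of_nonneg (hd.fY_nonneg u)]
    exact hd.fY_le (hs.measurable_X 0) hY0 hC₁ hdb hfY.1.continuous u⟩
  have hL : ∃ L, ∀ u v, |fY u - fY v| ≤ L * |u - v| := by
    obtain ⟨L, hL⟩ := hfY.2 1 le_rfl (by omega)
    exact ⟨L, abs_sub_le_of_deriv_bdd (hfY.1.of_le (by exact_mod_cast (by omega : 1 ≤ r + 1))) hL⟩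
  have h1 := tendstoInMeasure_kernel_density (q := q) hmeas hs.indep hs.ident hK hb hr
    measurable_snd hC₁ hdens hmom hB (hfY.1.of_le (by exact_mod_cast (by omega : r ≤ r + 1)))
    (hfY.2 r hr (by omega))
  have h2 := tendstoInMeasure_kernel_sub (w := fun _ => 1) (M := 1) hmeas hs.indep hs.ident hK hb
    measurable_snd measurable_const hC₁ (fun _ => by simp) hdens hmom hfY.1.continuous hB hL
    hR1 hR2 hC hQ
  rw [tendstoInMeasure_const_iff]
  simp only [mul_one] at h1 h2
  have h3 : TendstoInMeasure μ (fun (n : ℕ) ω => ((n : ℝ) * h n)⁻¹ *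
      (∑ i ∈ Finset.range n, K ((Y i ω - Qhat n ω) / h n) -
        ∑ i ∈ Finset.range n, K ((Y i ω - q) / h n))) atTop fun _ => 0 := by
    -- Eventually `n h ≥ 1`, so `(n h)⁻¹ ≤ (n h)^(-1/2)` and the stronger normalization of the shift
    -- lemma suffices.
    refine tendstoInMeasure_zero_mono h2 ?_
    filter_upwards [hb.tendsto_inv_mul.eventually_le_const one_pos,
      eventually_gt_atTop 0] with n hn hn0
    have hn' : (0 : ℝ) < n := by exact_mod_cast hn0
    have hnh : 0 < (n : ℝ) * h n := mul_pos hn' (hb.pos n)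
    refine ae_of_all _ fun ω => ?_
    rw [abs_mul, abs_mul]
    refine mul_le_mul_of_nonneg_right ?_ (abs_nonneg _)
    rw [abs_of_pos (by positivity), abs_of_nonneg (by positivity)]
    refine inv_anti₀ (Real.sqrt_pos.2 hnh) ?_
    rw [Real.sqrt_le_left hnh.le]
    have : 1 ≤ (n : ℝ) * h n := by
      rwa [inv_le_one₀ hnh] at hn
    nlinarith
  refine tendstoInMeasure_zero_mono (tendstoInMeasure_zero_add h3 h1)
    (Eventually.of_forall fun n => ae_of_all _ fun ω => le_of_eq ?_)
  congr 1
  ring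

/-- Asymptotic normality of the normalized numerator. -/
lemma tendstoInDistribution_numerator {γ : ℝ} {g s : ℝ → ℝ}
    (hs : IsIIDSample μ X Y) (hd : AreDensities μ (X 0) (Y 0) ν fYX fX fY)
    (hε : ε ∈ Set.Ioo (0 : ℝ) (1 / 2)) (hr : 1 ≤ r)
    (hf : IsFirstStep μ X Y ε τ m grid βhat Qhat ξhat)
    (hm : MatchingAssumption μ X Y fYX fY β ε τ m grid βhat Qhat)
    (hK : KernelAssumption K r) (hdd : DensityAssumption μ (X 0) fYX fX fY r)
    (hb : BandwidthAssumption h a r) (ha : ApproxAssumption μ X Y fYX β ε τ βhat Qhat ξhat)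
    {q : ℝ} (hq : q = quantile (μ.map (Y 0)) τ)
    (hclt : CLTAssumption μ (fun ω => β (matching fYX q (X 0 ω)) 0) (Y 0) K r γ g s)
    {C₁ : ℝ} (hC₁ : 0 ≤ C₁) (hdb : ∀ x ∈ (μ.map (X 0)).support, ∀ y, fYX y x ≤ C₁)
    {θ C : ℝ} (hC : 0 ≤ C)
    (hR1 : Tendsto (fun n : ℕ => √(h n) * (n : ℝ) ^ θ) atTop (𝓝 0))
    (hR2 : Tendsto (fun n : ℕ => (n : ℝ) ^ θ / √(n : ℝ) / h n) atTop (𝓝 0))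
    (hfs : Whp μ fun (n : ℕ) ω => |Qhat n ω - q| ≤ C * ((n : ℝ) ^ θ / √(n : ℝ)) ∧
      ∀ x ∈ (μ.map (X 0)).support, |βhat n ω (ξhat n ω x) 0 - β (matching fYX q x) 0| ≤
        C * ((n : ℝ) ^ θ / √(n : ℝ)) * (1 + ‖x‖)) :
    TendstoInDistribution (fun (n : ℕ) ω => (fY q * √((n : ℝ) * h n))⁻¹ *
        ∑ i ∈ Finset.range n, K ((Y i ω - Qhat n ω) / h n) *
          (βhat n ω (ξhat n ω (X i ω)) 0 - g q)) atTop id (fun _ => μ)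
      (gaussianReal 0 (s q * (fY q)⁻¹ * ∫ u, K u ^ 2).toNNReal) := by
  have hX0 := hs.measurable_X 0
  have hY0 := hs.measurable_Y 0
  have hmeas : ∀ i, Measurable fun ω => (X i ω, Y i ω) := fun i =>
    (hs.measurable_X i).prodMk (hs.measurable_Y i)
  have hfYc : Continuous fY := hdd.smooth_fY.1.continuous
  have hgc : Continuous g := hclt.regression_smooth.1.continuous
  have hsc := hclt.variance_continuous
  have hf₀ : 0 < fY q := hq ▸ fY_quantile_pos hs hd hε hm hdd
  obtain ⟨v, hvm, ⟨M, hvM⟩, hv⟩ := exists_measurable_slope hd hε hm ha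
  rw [← hq] at hv
  set V : Ω → ℝ := fun ω => β (matching fYX q (X 0 ω)) 0 with hV
  have hVv : V =ᵐ[μ] fun ω => v (X 0 ω) := by
    filter_upwards [hs.ae_mem_support 0] with ω hω using hv _ hω
  have hVm : AEStronglyMeasurable V μ :=
    (hvm.comp hX0).aestronglyMeasurable.congr hVv.symm
  have hVM : ∀ᵐ ω ∂μ, |V ω| ≤ M := by
    filter_upwards [hVv] with ω hω
    rw [hω]
    exact hvM _
  have hfYB : ∀ y, |fY y| ≤ C₁ := fun u => by
    rw [abs_of_nonneg (hd.fY_nonneg u)]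
    exact hd.fY_le hX0 hY0 hC₁ hdb hfYc u
  have hpos : ∀ y, fY y ≠ 0 → 0 < fY y := fun y hy => (hd.fY_nonneg y).lt_of_ne' hy
  -- The almost sure bound on the slopes reaches `g` only where `fY` is positive. This suffices,
  -- because `g` and `s` enter the moment densities multiplied by `fY`.
  have hgM : ∀ y, fY y ≠ 0 → |g y| ≤ M := fun y hy =>
    hd.le_of_ae_le hY0 hfYc hgc.abs (hclt.regression.ae_abs_le hVM) (hpos y hy)
  have hsM : ∀ y, fY y ≠ 0 → |s y| ≤ (2 * M) ^ 2 := fun y hy =>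
    hd.le_of_ae_le hY0 hfYc hsc.abs
      (hclt.regression.integral_mul_sub_sq hd hY0 hclt.variance hVm hVM 0
        (φ := fun _ => 0) measurable_const (B := 0) (by simp)).1 (hpos y hy)
  have hgqM : |g q| ≤ M := hgM q hf₀.ne'
  have hM0 : 0 ≤ M := (abs_nonneg _).trans hgqM
  have hgq : ∀ y, fY y ≠ 0 → |g y - g q| ≤ 2 * M := fun y hy =>
    (abs_sub _ _).trans (by linarith [hgM y hy])
  set w : (Fin (d + 1) → ℝ) × ℝ → ℝ := fun z => v z.1 - g q with hw
  have hwm : Measurable w := (hvm.comp measurable_fst).sub_const _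
  have hwM : ∀ z, |w z| ≤ 2 * M := fun z => (abs_sub _ _).trans (by linarith [hvM z.1])
  -- `m₁` and `m₂` are the first and second moment densities of the centred slope. As `m₁ q = 0` and
  -- `m₂ q = s q * fY q`, the centre produces no leading bias and the variance is that of the
  -- residual.
  set m₁ : ℝ → ℝ := fun y => (g y - g q) * fY y with hm₁
  set m₂ : ℝ → ℝ := fun y => (s y + (g y - g q) ^ 2) * fY y with hm₂
  have hm₁c : Continuous m₁ := by fun_prop
  have hm₂c : Continuous m₂ := by fun_prop
  have hm₁s : ContDiff ℝ (r + 1 : ℕ) m₁ :=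
    (hclt.regression_smooth.1.sub contDiff_const).mul hdd.smooth_fY.1
  have hm₁D : ∀ {j : ℕ}, j ≤ r + 1 → ∃ B, ∀ y, |iteratedDeriv j m₁ y| ≤ B := fun hj =>
    exists_bound_iteratedDeriv_mul (hclt.regression_smooth.sub_const (g q)) hdd.smooth_fY hfYB
      hgq hj
  have hm₁B : ∃ B, ∀ y, |m₁ y| ≤ B := by simpa using hm₁D (Nat.zero_le _)
  have hm₁L : ∃ L, ∀ u v, |m₁ u - m₁ v| ≤ L * |u - v| := by
    obtain ⟨L, hL⟩ := hm₁D (j := 1) (by omega)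
    exact ⟨L, abs_sub_le_of_deriv_bdd (hm₁s.of_le (by exact_mod_cast (by omega : 1 ≤ r + 1))) hL⟩
  have hm₂B : ∃ B, ∀ y, |m₂ y| ≤ B := by
    refine ⟨((2 * M) ^ 2 + (2 * M) ^ 2) * C₁, fun y => ?_⟩
    rcases eq_or_ne (fY y) 0 with h0 | h0
    · simp only [hm₂, h0, mul_zero, abs_zero]
      positivity
    · rw [hm₂, abs_mul]
      refine mul_le_mul ((abs_add_le _ _).trans (add_le_add (hsM y h0) ?_)) (hfYB y)
        (abs_nonneg _) (by positivity)
      rw [abs_pow]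
      exact pow_le_pow_left₀ (abs_nonneg _) (hgq y h0) 2
  have hdens : ∀ ψ : ℝ → ENNReal, Measurable ψ →
      ∫⁻ ω, ψ (Y 0 ω) ∂μ ≤ ENNReal.ofReal C₁ * ∫⁻ y, ψ y := fun ψ hψ =>
    hd.lintegral_le hX0 hY0 hdb hψ
  have hmom₁ : ∀ φ : ℝ → ℝ, Measurable φ → (∃ B, ∀ u, |φ u| ≤ B) →
      ∫ ω, φ (Y 0 ω) * w (X 0 ω, Y 0 ω) ∂μ = ∫ u, φ u * m₁ u := fun φ hφ ⟨B, hB⟩ => by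
    rw [← hclt.regression.integral_mul_sub hd hY0 hVm hVM (g q) hφ hB]
    refine integral_congr_ae ?_
    filter_upwards [hVv] with ω hω
    simp only [hw, hω]
  have hmom₂ : ∀ φ : ℝ → ℝ, Measurable φ → (∃ B, ∀ u, |φ u| ≤ B) →
      ∫ ω, φ (Y 0 ω) * w (X 0 ω, Y 0 ω) ^ 2 ∂μ = ∫ u, φ u * m₂ u := fun φ hφ ⟨B, hB⟩ => by
    rw [← (hclt.regression.integral_mul_sub_sq hd hY0 hclt.variance hVm hVM (g q) hφ hB).2]
    refine integral_congr_ae ?_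
    filter_upwards [hVv] with ω hω
    simp only [hw, hω]
  have hm₁q : m₁ q = 0 := by simp [hm₁]
  have hclt' := tendstoInDistribution_kernel_sum (q := q) hmeas hs.indep hs.ident hK hb
    measurable_snd hwm hwM hmom₁ hm₁B hmom₂ hm₂c hm₂B (fY q)
  have hvar : (fY q)⁻¹ ^ 2 * (m₂ q * ∫ u, K u ^ 2) = s q * (fY q)⁻¹ * ∫ u, K u ^ 2 := by
    simp only [hm₂, sub_self]
    field_simp
    ring
  rw [hvar] at hclt'
  refine tendstoInDistribution_of_tendstoInMeasure_sub _ id hclt' ?_ fun n => ?_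
  -- The numerator minus the centred sum is `(fY q)⁻¹` times three negligible terms: the slope
  -- error, the shift of the evaluation point, and the bias.
  · have hfirst := tendstoInMeasure_kernel_error hs hd (hm.moment.integrable (by norm_num)) hK hb
      hC₁ hdb hC hR1 hR2 hfs
    have hshift := tendstoInMeasure_kernel_sub hmeas hs.indep hs.ident hK hb measurable_snd hwm
      hC₁ hwM hdens hmom₁ hm₁c hm₁B hm₁L hR1 hR2 hC
      (hfs.mono (Eventually.of_forall fun n => ae_of_all _ fun ω hω => hω.1))
    have hbias : Tendsto (fun n : ℕ => √((n : ℝ) * h n) * ∫ u, K u * m₁ (q + h n * u)) atTop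
        (𝓝 0) := by
      obtain ⟨D, hD⟩ := hm₁D (j := r) (by omega)
      obtain ⟨B, hB⟩ := hm₁B
      have h1 := hb.tendsto_bias.const_mul (D * ∫ u, |u| ^ r * |K u|)
      rw [mul_zero] at h1
      refine squeeze_zero_norm (fun n => ?_) h1
      have h2 := abs_integral_kernel_sub_le hK hr
        (hm₁s.of_le (by exact_mod_cast (by omega : r ≤ r + 1))) hD q (hb.pos n)
        (integrable_kernel_mul_shift hK hm₁c hB _ _)
      rw [hm₁q, sub_zero] at h2
      rw [norm_mul, Real.norm_of_nonneg (Real.sqrt_nonneg _), Real.norm_eq_abs]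
      calc _ ≤ √((n : ℝ) * h n) * ((D * ∫ u, |u| ^ r * |K u|) * h n ^ r) :=
            mul_le_mul_of_nonneg_left h2 (Real.sqrt_nonneg _)
        _ = _ := by ring
    have htot := tendstoInMeasure_zero_add (tendstoInMeasure_zero_add hfirst hshift)
      (tendstoInMeasure_zero_of_tendsto (μ := μ) hbias)
    refine tendstoInMeasure_zero_mono (tendstoInMeasure_zero_const_mul (fY q)⁻¹ htot) ?_
    filter_upwards [eventually_gt_atTop 0] with n hn
    have hn' : (0 : ℝ) < n := by exact_mod_cast hn
    have hnh : 0 < (n : ℝ) * h n := mul_pos hn' (hb.pos n)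
    filter_upwards [ae_all_iff.2 hs.ae_mem_support] with ω hω
    refine le_of_eq (congrArg _ ?_)
    simp only [Pi.sub_apply]
    rw [integral_kernel_eq (Z := fun i ω => (X i ω, Y i ω)) (y := Prod.snd) (w := w) hK hmom₁ q
      (hb.pos n), ← Finset.mul_sum, Finset.sum_sub_distrib, Finset.sum_const, Finset.card_range,
      nsmul_eq_mul]
    have e1 : ∑ i ∈ Finset.range n, K ((Y i ω - Qhat n ω) / h n) *
        (βhat n ω (ξhat n ω (X i ω)) 0 - g q) =
        ∑ i ∈ Finset.range n, K ((Y i ω - Qhat n ω) / h n) *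
          (βhat n ω (ξhat n ω (X i ω)) 0 - β (matching fYX q (X i ω)) 0) +
        ∑ i ∈ Finset.range n, K ((Y i ω - Qhat n ω) / h n) * w (X i ω, Y i ω) := by
      rw [← Finset.sum_add_distrib]
      refine Finset.sum_congr rfl fun i _ => ?_
      rw [hv _ (hω i), hw]
      ring
    rw [e1]
    have hsq : √((n : ℝ) * h n) = (√((n : ℝ) * h n))⁻¹ * (n * h n) := by
      have hsp : √((n : ℝ) * h n) ≠ 0 := (Real.sqrt_pos.2 hnh).ne'
      rw [eq_inv_mul_iff_mul_eq₀ hsp, Real.mul_self_sqrt hnh.le]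
    generalize (∫ u, K u * m₁ (q + h n * u)) = I at *
    have e2 : √((n : ℝ) * h n) * I = (√((n : ℝ) * h n))⁻¹ * (n * (h n * I)) := by
      nth_rewrite 1 [hsq]
      ring
    rw [e2, mul_inv]
    ring
  · exact (aemeasurable_kernel_sum hs hK hf n
      fun i => (aemeasurable_slopeHat hs hf hm.isGrid n i).sub_const _).const_mul _

end Limits

end UQPE

/-! ### Asymptotic normality of the estimator -/

theorem corollary1 {Ω : Type*} [MeasurableSpace Ω] (μ : Measure Ω) [IsProbabilityMeasure μ]
    {d : ℕ} (X : ℕ → Ω → Fin (d + 1) → ℝ) (Y : ℕ → Ω → ℝ)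
    (ν : Measure (Fin (d + 1) → ℝ)) [SigmaFinite ν]
    (fYX : ℝ → (Fin (d + 1) → ℝ) → ℝ) (fX : (Fin (d + 1) → ℝ) → ℝ) (fY : ℝ → ℝ)
    (β : ℝ → Fin (d + 1) → ℝ) (ε τ : ℝ) (m : ℕ → ℕ) (grid : (n : ℕ) → Fin (m n + 1) → ℝ)
    (βhat : ℕ → Ω → ℝ → Fin (d + 1) → ℝ) (Qhat : ℕ → Ω → ℝ)
    (ξhat : ℕ → Ω → (Fin (d + 1) → ℝ) → ℝ)
    (K : ℝ → ℝ) (h : ℕ → ℝ) (r : ℕ) (a γ : ℝ) (g s : ℝ → ℝ)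
    (hε : ε ∈ Set.Ioo (0 : ℝ) (1 / 2)) (hτ : τ ∈ Set.Ioo (0 : ℝ) 1) (hr : 2 ≤ r)
    (hsample : UQPE.IsIIDSample μ X Y)
    (hdens : UQPE.AreDensities μ (X 0) (Y 0) ν fYX fX fY)
    (hfirst : UQPE.IsFirstStep μ X Y ε τ m grid βhat Qhat ξhat)
    (hmatching : UQPE.MatchingAssumption μ X Y fYX fY β ε τ m grid βhat Qhat)
    (hkernel : UQPE.KernelAssumption K r)
    (hdensity : UQPE.DensityAssumption μ (X 0) fYX fX fY r)
    (hbandwidth : UQPE.BandwidthAssumption h a r)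
    (happrox : UQPE.ApproxAssumption μ X Y fYX β ε τ βhat Qhat ξhat)
    (hclt : UQPE.CLTAssumption μ
      (fun ω => β (UQPE.matching fYX (UQPE.quantile (μ.map (Y 0)) τ) (X 0 ω)) 0) (Y 0)
      K r γ g s) :
    TendstoInDistribution
      (fun (n : ℕ) ω => √((n : ℝ) * h n) *
        (UQPE.uqpeHat X Y K h βhat Qhat ξhat n ω - g (UQPE.quantile (μ.map (Y 0)) τ)))
      atTop id (fun _ => μ)
      (gaussianReal 0 (Real.toNNReal
        (s (UQPE.quantile (μ.map (Y 0)) τ) * (fY (UQPE.quantile (μ.map (Y 0)) τ))⁻¹ *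
          ∫ u, K u ^ 2))) := by
  set q := UQPE.quantile (μ.map (Y 0)) τ with hq
  have hf₀ : 0 < fY q := UQPE.fY_quantile_pos hsample hdens hε hmatching hdensity
  obtain ⟨C₁', hdb'⟩ := happrox.density_bdd
  obtain ⟨C₁, hC₁, hdb⟩ : ∃ C₁ : ℝ, 0 ≤ C₁ ∧
      ∀ x ∈ (μ.map (X 0)).support, ∀ y, fYX y x ≤ C₁ :=
    ⟨|C₁'|, abs_nonneg _, fun x hx y => (hdb' x hx y).trans (le_abs_self _)⟩
  obtain ⟨θ, hθ, hR1, hR2⟩ := hbandwidth.exists_rate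
  obtain ⟨C, hC, hfs⟩ := UQPE.whp_firstStep hsample hdens hε hτ hfirst hmatching happrox hθ
  rw [← hq] at hfs
  have hN := UQPE.tendstoInDistribution_numerator hsample hdens hε (by omega) hfirst hmatching
    hkernel hdensity hbandwidth happrox hq hclt hC₁ hdb hC hR1 hR2 hfs
  have hD := UQPE.tendstoInMeasure_density_estimator hsample hdens hkernel hbandwidth (by omega)
    hC₁ hdb hdensity.smooth_fY hC hR1 hR2
    (hfs.mono (Eventually.of_forall fun n => ae_of_all _ fun ω hω => hω.1))
  refine UQPE.tendstoInDistribution_ratio hf₀ hN hD (fun n => ?_) (fun n => ?_) ?_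
  · have := (UQPE.aemeasurable_kernel_sum (h := h) hsample hkernel hfirst n
      (W := fun _ _ => 1) fun _ => aemeasurable_const).const_mul ((n : ℝ) * h n)⁻¹
    simpa only [mul_one] using this
  · exact ((UQPE.aemeasurable_uqpeHat hsample hkernel hfirst hmatching.isGrid n).sub_const
      _).const_mul _
  -- When the kernel weights do not sum to zero, the factor `h⁻¹` in `K_h` cancels from the ratio.
  -- Subtracting `g q` inside the weighted average gives the exact quotient required by Slutsky's
  -- theorem.
  · filter_upwards [eventually_gt_atTop 0] with n hn
    refine ae_of_all _ fun ω hω => ?_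
    have hn' : (0 : ℝ) < n := by exact_mod_cast hn
    have hhn := hbandwidth.pos n
    have hnh : 0 < (n : ℝ) * h n := mul_pos hn' hhn
    have hS : ∑ i ∈ Finset.range n, K ((Y i ω - Qhat n ω) / h n) ≠ 0 := right_ne_zero_of_mul hω
    have hsp : √((n : ℝ) * h n) ≠ 0 := (Real.sqrt_pos.2 hnh).ne'
    simp only [UQPE.uqpeHat, mul_assoc, ← Finset.mul_sum]
    simp only [mul_sub, Finset.sum_sub_distrib, ← Finset.sum_mul]
    generalize ∑ i ∈ Finset.range n, K ((Y i ω - Qhat n ω) / h n) *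
      βhat n ω (ξhat n ω (X i ω)) 0 = B
    generalize ∑ i ∈ Finset.range n, K ((Y i ω - Qhat n ω) / h n) = S at *
    have hsq : √((n : ℝ) * h n) * √((n : ℝ) * h n) = n * h n := Real.mul_self_sqrt hnh.le
    generalize √((n : ℝ) * h n) = t at *
    rw [← hsq]
    field_simp
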